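/- Let $M\subset S^2$ be a closed subset that is a two-dimensional submanifold with boundary (of class $C^1$, in particular any smooth one), with boundary curve $\partial M$. Let $\gamma$ be a simple closed curve in $S^2$, that is, an injective continuous map $\mathbb R/\mathbb Z\to S^2$ (the same letter denotes its image). Suppose that $\gamma\cap\partial M$ is non-empty and that the intersection is transversal: at every parameter $t$ with $\gamma(t)\in\partial M$ the curve $\gamma$ is differentiable and its velocity does not lie in the tangent line $T_{\gamma(t)}\partial M$. Let $A$ be a connected component of $S^2\setminus\gamma$, and suppose that no connected component of $M$ is contained in $A$ (this is automatic if $M$ is connected). Then there are an arc $a\subset\gamma$ and an arc $b\subset\partial M$ with the same two distinct end points $p,q$ and with $a\cap b=\{p,q\}$, such that the simple closed curve $a\cup b$ bounds a closed topological disc $D$ with $D\setminus a\subset A$, for which $D\cap M$ is connected and $M$ meets the interior $D\setminus(a\cup b)$ of the disc. -/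

import Mathlib

open scoped Manifold ContDiff

/-- The 2-sphere, as the unit sphere of Euclidean 3-space, with Mathlib's smooth structure. -/
abbrev Sphere2 : Type := Metric.sphere (0 : EuclideanSpace ℝ (Fin 3)) 1

/-- `φ` is a chart of class `C¹` of the sphere around `p` that identifies `M` with the closed
half-plane `{x₀ ≥ 0}` and sends `p` to the boundary line `{x₀ = 0}`. -/
structure IsBoundaryChart (M : Set Sphere2)
    (φ : OpenPartialHomeomorph Sphere2 (EuclideanSpace ℝ (Fin 2))) (p : Sphere2) : Prop where
  mem_maximalAtlas : φ ∈ IsManifold.maximalAtlas (𝓡 2) 1 Sphere2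
  mem_source : p ∈ φ.source
  mem_iff : ∀ q ∈ φ.source, q ∈ M ↔ 0 ≤ φ q 0
  apply_eq_zero : φ p 0 = 0

/-- The manifold boundary `∂M`: the points with a half-plane chart that puts them on the
boundary line. -/
def manifoldBoundary (M : Set Sphere2) : Set Sphere2 :=
  {p | ∃ φ, IsBoundaryChart M φ p}

/-- `M` is a closed two-dimensional submanifold with boundary, of class `C¹`, of the sphere:
it is a closed set, and each of its points either has a neighbourhood in the sphere contained
in `M`, or has a half-plane chart. -/
structure IsSubmanifoldWithBoundary (M : Set Sphere2) : Prop where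
  isClosed : IsClosed M
  interior_or_boundary : ∀ p ∈ M, p ∈ interior M ∨ p ∈ manifoldBoundary M

/-- `γ` is a parametrized simple closed curve; the parameter space is the circle `ℝ / ℤ`. -/
structure IsSimpleClosedCurve (γ : AddCircle (1 : ℝ) → Sphere2) : Prop where
  continuous : Continuous γ
  injective : Function.Injective γ

/-- At the parameter `t` the curve `γ` crosses `∂M` transversally: in a chart that straightens
`∂M` to the line `{x₀ = 0}`, the curve is differentiable at `t` and its velocity is not tangent
to this line. (By the chain rule this does not depend on the chart.) -/
def CrossesTransversally (γ : AddCircle (1 : ℝ) → Sphere2) (M : Set Sphere2) (t : ℝ) : Prop :=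
  ∃ φ, IsBoundaryChart M φ (γ (t : AddCircle (1 : ℝ))) ∧
    ∃ v : EuclideanSpace ℝ (Fin 2),
      HasDerivAt (fun s : ℝ => φ (γ (s : AddCircle (1 : ℝ)))) v t ∧ v 0 ≠ 0

/-- `γ` and `∂M` intersect transversally. -/
def IsTransversal (γ : AddCircle (1 : ℝ) → Sphere2) (M : Set Sphere2) : Prop :=
  ∀ t : ℝ, γ (t : AddCircle (1 : ℝ)) ∈ manifoldBoundary M → CrossesTransversally γ M t

/-- `A` is a connected component of the set `U`. -/
def IsComponentOf (A U : Set Sphere2) : Prop :=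
  ∃ x ∈ U, A = connectedComponentIn U x

/-- `a` is a (closed, non-degenerate) arc with end points `p` and `q`. -/
def IsArc (a : Set Sphere2) (p q : Sphere2) : Prop :=
  ∃ f : ℝ → Sphere2, ContinuousOn f (Set.Icc 0 1) ∧ Set.InjOn f (Set.Icc 0 1) ∧
    f '' Set.Icc 0 1 = a ∧ f 0 = p ∧ f 1 = q

/-- `D` is a closed topological disc whose boundary circle is `c`. -/
def IsDiscBoundedBy (D c : Set Sphere2) : Prop :=
  ∃ h : EuclideanSpace ℝ (Fin 2) → Sphere2,
    ContinuousOn h (Metric.closedBall 0 1) ∧ Set.InjOn h (Metric.closedBall 0 1) ∧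
      h '' Metric.closedBall 0 1 = D ∧ h '' Metric.sphere 0 1 = c

/-! After stereographic projection from a point outside the closure of `A`, the curve `γ` is a
Jordan curve in the plane and `A` is a bounded component of its complement. Transversality says that
at each crossing `γ` passes between the interior and the complement of `M`. Hence there are finitely
many crossings, and at each of them one of the two branches of `∂M` goes into `A` and the other into
another component. So `∂M ∩ closure A` is a compact one-dimensional manifold whose boundary points
are exactly the crossings (`isOneManifold_frontier_inter_closure`).

Follow `∂M` from a crossing into `A`. The path must end at another crossing, so it is a crosscut
`b`; with an arc `a` of `γ` it bounds a region `E` inside `A` (`exists_isCutOff`). The arc `a` is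
chosen so that it runs through the interior of `M`, which forces `E` to meet `M`. If the closed
region `D` meets `M` in a disconnected set, split `D ∩ M` into two closed parts and let `L` be the
part without `b`. It touches `a`, for otherwise it would contain a whole component of `M` lying in
`A`. At the first point of `a` in `L` the curve enters `M`; the boundary arc starting there stays in
`E`, cannot meet `b`, and returns to `a` further on. It cuts off a disc with strictly fewer
crossings on its arc (`IsBoundaryCut.exists_smaller`), so finitely many repetitions suffice.

The plane topology rests on Eilenberg's criterion: a compact set `K` does not separate `a` from `b`
exactly when `(z - a) / (z - b)` has a continuous logarithm on `K`. Gluing logarithms gives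
Janiszewski's theorem `NotSeparates.union`. From it, and from the fact that arcs do not separate,
come the frontier theorem `frontier_component_eq` and the local connectivity of complementary
domains along the curve, `exists_local_connection`. Borsuk's theorem on maps to the punctured plane
yields a bounded component. Of the Jordan curve theorem only the existence of a second component is
used.

That a bounded complementary component together with its curve is a closed disc
(`exists_closedDisc`) is Carathéodory's theorem. Logarithms on the component give square roots,
hence a Riemann map by Koebe's extremal argument. The length-area estimate and Janiszewski's theorem
extend its inverse continuously to the closed disc, and a separation argument with two radii shows
that the extension is injective on the circle. -/

section

/-! ### Continuous logarithms -/

/-- `f` has a continuous logarithm on `K`. -/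
def HasLogOn {X : Type*} [TopologicalSpace X] (f : X → ℂ) (K : Set X) : Prop :=
  ∃ g : X → ℂ, ContinuousOn g K ∧ ∀ z ∈ K, Complex.exp (g z) = f z

/-- `K` does not separate `a` from `b`. -/
def NotSeparates {X : Type*} [TopologicalSpace X] (K : Set X) (a b : X) : Prop :=
  ∃ C ⊆ Kᶜ, IsPreconnected C ∧ a ∈ C ∧ b ∈ C

namespace HasLogOn

open Complex Set Topology

variable {X : Type*} [TopologicalSpace X] {f h : X → ℂ} {K L : Set X}

theorem ne_zero (hf : HasLogOn f K) {z : X} (hz : z ∈ K) : f z ≠ 0 := by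
  obtain ⟨g, -, hg⟩ := hf
  rw [← hg z hz]; exact exp_ne_zero _

theorem congr (hf : HasLogOn f K) (e : ∀ z ∈ K, f z = h z) : HasLogOn h K := by
  obtain ⟨g, hc, hg⟩ := hf
  exact ⟨g, hc, fun z hz => (hg z hz).trans (e z hz)⟩

theorem mono (hf : HasLogOn f K) (e : L ⊆ K) : HasLogOn f L := by
  obtain ⟨g, hc, hg⟩ := hf
  exact ⟨g, hc.mono e, fun z hz => hg z (e hz)⟩

theorem mul (hf : HasLogOn f K) (hh : HasLogOn h K) : HasLogOn (fun z => f z * h z) K := by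
  obtain ⟨g, hc, hg⟩ := hf
  obtain ⟨g', hc', hg'⟩ := hh
  exact ⟨fun z => g z + g' z, hc.add hc', fun z hz => by rw [exp_add, hg z hz, hg' z hz]⟩

theorem inv (hf : HasLogOn f K) : HasLogOn (fun z => (f z)⁻¹) K := by
  obtain ⟨g, hc, hg⟩ := hf
  exact ⟨fun z => - g z, hc.neg, fun z hz => by rw [exp_neg, hg z hz]⟩

theorem zpow (hf : HasLogOn f K) (n : ℤ) : HasLogOn (fun z => (f z) ^ n) K := by
  obtain ⟨g, hc, hg⟩ := hf
  exact ⟨fun z => n * g z, continuousOn_const.mul hc, fun z hz => by rw [exp_int_mul, hg z hz]⟩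

theorem div (hf : HasLogOn f K) (hh : HasLogOn h K) : HasLogOn (fun z => f z / h z) K :=
  (hf.mul hh.inv).congr fun _ _ => (div_eq_mul_inv _ _).symm

theorem const {c : ℂ} (hc : c ≠ 0) : HasLogOn (fun _ : X => c) K :=
  ⟨fun _ => log c, continuousOn_const, fun _ _ => exp_log hc⟩

theorem of_mem_slitPlane (hf : ContinuousOn f K) (h : ∀ z ∈ K, f z ∈ slitPlane) :
    HasLogOn f K :=
  ⟨fun z => log (f z), hf.clog h, fun z hz => exp_log (slitPlane_ne_zero (h z hz))⟩

/-- Stability as in Rouché's theorem: `f / h` stays at distance less than 1 from 1, hence in the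
slit plane, where the principal logarithm is continuous. -/
theorem of_norm_sub_lt (hf : ContinuousOn f K) (hh : ContinuousOn h K) (hl : HasLogOn h K)
    (hd : ∀ z ∈ K, ‖f z - h z‖ < ‖h z‖) : HasLogOn f K := by
  have : HasLogOn (fun z => f z / h z) K := by
    refine of_mem_slitPlane (hf.div hh fun z hz => hl.ne_zero hz) fun z hz => ?_
    have h0 := hl.ne_zero hz
    apply mem_slitPlane_of_norm_lt_one (z := f z / h z - 1) _ |> fun h => by simpa using h
    rw [div_sub_one h0, norm_div, div_lt_one (norm_pos_iff.2 h0)]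
    exact hd z hz
  refine (hl.mul this).congr fun z hz => ?_
  field_simp [hl.ne_zero hz]

theorem of_isClosed_union {A B : Set X} (hA : IsClosed A) (hB : IsClosed B) {gA gB : X → ℂ}
    (cA : ContinuousOn gA A) (cB : ContinuousOn gB B) (eA : ∀ z ∈ A, exp (gA z) = f z)
    (eB : ∀ z ∈ B, exp (gB z) = f z) (hAB : ∀ z ∈ A ∩ B, gA z = gB z) : HasLogOn f (A ∪ B) := by
  classical
  refine ⟨A.piecewise gA gB, ?_, fun z hz => ?_⟩
  · refine ContinuousOn.union_of_isClosed (cA.congr fun z hz => by simp [hz])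
      (cB.congr fun z hz => ?_) hA hB
    by_cases h : z ∈ A
    · simp [h, hAB z ⟨h, hz⟩]
    · simp [h]
  · by_cases h : z ∈ A
    · simp [h, eA z h]
    · simp [h, eB z (hz.resolve_left h)]

/-- The difference divided by `2πi` is continuous and integer-valued, so it is constant on a
preconnected set. -/
theorem eq_add_int_of_preconnected {S : Set X} (hS : IsPreconnected S) {g g' : X → ℂ}
    (hg : ContinuousOn g S) (hg' : ContinuousOn g' S) (e : ∀ z ∈ S, exp (g z) = exp (g' z)) :
    ∃ n : ℤ, ∀ z ∈ S, g z = g' z + n * (2 * Real.pi * I) := by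
  have key : ∀ z ∈ S, ∃ n : ℤ, g z = g' z + n * (2 * Real.pi * I) := fun z hz =>
    exp_eq_exp_iff_exists_int.1 (e z hz)
  choose! n hn using key
  have hpi : (2 * Real.pi * I : ℂ) ≠ 0 := two_pi_I_ne_zero
  have hc : ContinuousOn n S := by
    have h1 : ContinuousOn (fun z => ((g z - g' z) / (2 * Real.pi * I))) S :=
      (hg.sub hg').div_const _
    have h2 : ContinuousOn (fun z => ((n z : ℤ) : ℂ)) S := h1.congr fun z hz => by
      have := hn z hz
      beta_reduce
      rw [this, add_sub_cancel_left, mul_div_cancel_right₀ _ hpi]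
    have h3 : ContinuousOn (fun z => ((n z : ℤ) : ℝ)) S := by
      simpa using! Complex.continuous_re.comp_continuousOn h2
    exact Int.isClosedEmbedding_coe_real.isInducing.continuousOn_iff.2 h3
  rcases S.eq_empty_or_nonempty with rfl | ⟨x, hx⟩
  · exact ⟨0, by simp⟩
  · refine ⟨n x, fun z hz => ?_⟩
    rw [hn z hz]
    have : n z = n x := hS.constant hc hz hx
    rw [this]

/-- On the overlap the two logarithms differ by a single multiple of `2πi`; after a shift by it they
glue. This is where Janiszewski's theorem gets its connectedness hypothesis. -/
theorem union_of_isPreconnected_inter {A B : Set X} (hA : IsClosed A) (hB : IsClosed B)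
    (fA : HasLogOn f A) (fB : HasLogOn f B) (hAB : IsPreconnected (A ∩ B)) :
    HasLogOn f (A ∪ B) := by
  obtain ⟨gA, cA, eA⟩ := fA
  obtain ⟨gB, cB, eB⟩ := fB
  obtain ⟨n, hn⟩ := eq_add_int_of_preconnected hAB (cA.mono inter_subset_left)
    (cB.mono inter_subset_right) fun z hz => (eA z hz.1).trans (eB z hz.2).symm
  refine of_isClosed_union hA hB cA (gB := fun z => gB z + n * (2 * Real.pi * I))
    (cB.add continuousOn_const) eA (fun z hz => ?_) hn
  rw [exp_add, exp_int_mul_two_pi_mul_I, mul_one, eB z hz]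

theorem of_simplyConnectedSpace [SimplyConnectedSpace X] [LocallyPathConnectedSpace X]
    (hf : Continuous f) (h0 : ∀ x, f x ≠ 0) : HasLogOn f univ := by
  obtain ⟨x0⟩ : Nonempty X := inferInstance
  obtain ⟨F, ⟨-, hF⟩, -⟩ := isCoveringMapOn_exp.existsUnique_continuousMap_lifts
    (⟨f, hf⟩ : C(X, ℂ)) (a₀ := x0) (e₀ := log (f x0)) (exp_log (h0 x0)) (fun a => h0 a)
  exact ⟨F, F.continuous.continuousOn, fun z _ => congrFun hF z⟩

theorem real_Icc {u : ℝ → ℂ} {a b : ℝ} (hu : ContinuousOn u (Icc a b))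
    (h0 : ∀ x ∈ Icc a b, u x ≠ 0) : HasLogOn u (Icc a b) := by
  rcases le_or_gt a b with hab | hab
  · have : HasLogOn (fun x => IccExtend hab ((Icc a b).domRestrict u) x) univ :=
      of_simplyConnectedSpace (hu.domRestrict.Icc_extend') fun x => h0 _ (projIcc a b hab x).2
    refine (this.mono (subset_univ _)).congr fun z hz => ?_
    rw [IccExtend_of_mem hab _ hz]; rfl
  · exact ⟨fun _ => 0, continuousOn_const, by simp [Icc_eq_empty_of_lt hab]⟩

/-- Compactness makes `u` a homeomorphism onto its image, so a logarithm can be transported along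
the inverse. -/
theorem image [T2Space X] {Y : Type*} [TopologicalSpace Y] {S : Set Y} (hS : IsCompact S)
    {u : Y → X} (hu : ContinuousOn u S) (hi : InjOn u S) (h : HasLogOn (f ∘ u) S) :
    HasLogOn f (u '' S) := by
  obtain ⟨g, hg, e⟩ := h
  rcases S.eq_empty_or_nonempty with rfl | ⟨y, hy⟩
  · exact ⟨fun _ => 0, continuousOn_const, by simp⟩
  have : Nonempty Y := ⟨y⟩
  have hinv : ContinuousOn (Function.invFunOn u S) (u '' S) := by
    rw [continuousOn_iff_isClosed]
    intro t ht
    refine ⟨u '' (t ∩ S), ((hS.inter_left ht).image_of_continuousOn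
      (hu.mono inter_subset_right)).isClosed, ?_⟩
    ext x
    constructor
    · rintro ⟨hx, s, hs, rfl⟩
      refine ⟨⟨s, ⟨?_, hs⟩, rfl⟩, ⟨s, hs, rfl⟩⟩
      simpa [hi.leftInvOn_invFunOn hs] using! hx
    · rintro ⟨⟨s, ⟨hst, hs⟩, rfl⟩, _⟩
      refine ⟨?_, ⟨s, hs, rfl⟩⟩
      simpa [hi.leftInvOn_invFunOn hs] using! hst
  refine ⟨g ∘ Function.invFunOn u S, hg.comp hinv ?_, ?_⟩
  · rintro _ ⟨s, hs, rfl⟩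
    rwa [hi.leftInvOn_invFunOn hs]
  · rintro _ ⟨s, hs, rfl⟩
    simp only [Function.comp, hi.leftInvOn_invFunOn hs]
    exact e s hs

theorem arc {f : ℂ → ℂ} {u : ℝ → ℂ} {a b : ℝ} (hu : ContinuousOn u (Icc a b))
    (hi : InjOn u (Icc a b)) (hf : ContinuousOn f (u '' Icc a b))
    (h0 : ∀ z ∈ u '' Icc a b, f z ≠ 0) : HasLogOn f (u '' Icc a b) :=
  image isCompact_Icc hu hi (real_Icc (hf.comp hu (mapsTo_image _ _))
    fun _ hx => h0 _ (mem_image_of_mem _ hx))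

end HasLogOn

end

/-! ### Eilenberg's criterion and Janiszewski's theorem -/

section

namespace NotSeparates

open Complex Set Topology

variable {X : Type*} [TopologicalSpace X] {K L : Set X} {a b c : X}

theorem symm (h : NotSeparates K a b) : NotSeparates K b a := by
  obtain ⟨C, hC, hp, ha, hb⟩ := h
  exact ⟨C, hC, hp, hb, ha⟩

theorem trans (h : NotSeparates K a b) (h' : NotSeparates K b c) : NotSeparates K a c := by
  obtain ⟨C, hC, hp, ha, hb⟩ := h
  obtain ⟨C', hC', hp', ha', hb'⟩ := h'
  exact ⟨C ∪ C', union_subset hC hC', hp.union b hb ha' hp', .inl ha, .inr hb'⟩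

theorem left_notMem (h : NotSeparates K a b) : a ∉ K := by
  obtain ⟨C, hC, hp, ha, hb⟩ := h
  exact hC ha

theorem iff_mem_connectedComponentIn (ha : a ∉ K) :
    NotSeparates K a b ↔ b ∈ connectedComponentIn Kᶜ a := by
  constructor
  · rintro ⟨C, hC, hp, ha, hb⟩
    exact hp.subset_connectedComponentIn ha hC hb
  · intro h
    exact ⟨_, connectedComponentIn_subset _ _, isPreconnected_connectedComponentIn,
      mem_connectedComponentIn ha, h⟩

end NotSeparates

open Complex Set Topology

theorem isPreconnected_norm_sub_gt (c : ℂ) (r : ℝ) :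
    IsPreconnected {z : ℂ | r < ‖z - c‖} := by
  have h : IsPreconnected ((fun p : ℝ × ℝ => c + p.1 * exp (p.2 * I)) '' (Ioi r ×ˢ univ)) :=
    (isPreconnected_Ioi.prod isPreconnected_univ).image _ (by fun_prop)
  convert h using 1
  ext z
  simp only [mem_ofPred_eq, mem_image, mem_prod, mem_Ioi, mem_univ, and_true, Prod.exists]
  constructor
  · intro hz
    exact ⟨‖z - c‖, arg (z - c), hz, by rw [norm_mul_exp_arg_mul_I]; ring⟩
  · rintro ⟨ρ, θ, h, rfl⟩
    rw [add_sub_cancel_left, norm_mul, norm_exp_ofReal_mul_I, mul_one, norm_real,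
      Real.norm_eq_abs]
    exact h.trans_le (le_abs_self _)

namespace HasLogOn

theorem sub_of_bounded {K : Set ℂ} {a c : ℂ} {R : ℝ} (hK : ∀ z ∈ K, ‖z - c‖ < R)
    (ha : R ≤ ‖a - c‖) : HasLogOn (fun z => z - a) K := by
  rcases K.eq_empty_or_nonempty with rfl | ⟨x, hx⟩
  · exact ⟨fun _ => 0, continuousOn_const, by simp⟩
  have hac : c - a ≠ 0 := by
    intro h
    have : a = c := (sub_eq_zero.1 h).symm
    subst this
    have := hK x hx
    simp at ha
    linarith [norm_nonneg (x - a)]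
  refine of_norm_sub_lt (h := fun _ => c - a) (by fun_prop) (by fun_prop) (const hac)
    fun z hz => ?_
  calc ‖z - a - (c - a)‖ = ‖z - c‖ := by congr 1; ring
    _ < R := hK z hz
    _ ≤ ‖a - c‖ := ha
    _ = ‖c - a‖ := norm_sub_rev _ _

/-- If `a` and `b` are not separated by the compact set `K`, then `(z - a) / (z - b)` has a
continuous logarithm on `K`. -/
theorem sub_div_sub {K : Set ℂ} (hK : IsCompact K) {a b : ℂ} (h : NotSeparates K a b) :
    HasLogOn (fun z => (z - a) / (z - b)) K := by
  obtain ⟨C, hC, hp, ha, hb⟩ := h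
  have hne : ∀ x ∈ C, ∀ z ∈ K, z - x ≠ 0 := fun x hx z hz h =>
    hC hx (by rwa [← sub_eq_zero.1 h])
  -- Having a logarithm of the quotient is an equivalence relation on `C` that holds between nearby
  -- points, so connectedness spreads it over all of `C`.
  refine hp.induction₂ (fun a b => HasLogOn (fun z => (z - a) / (z - b)) K) ?_ ?_ ?_ ha hb
  · intro x hx
    have hd : ∀ᶠ y in 𝓝[C] x, y ∈ C ∧ ∀ z ∈ K, ‖x - y‖ < ‖z - y‖ := by
      refine eventually_mem_nhdsWithin.and (nhdsWithin_le_nhds ?_)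
      obtain ⟨ε, hε, hb⟩ := Metric.isOpen_iff.1 hK.isClosed.isOpen_compl x (hC hx)
      filter_upwards [Metric.ball_mem_nhds x (half_pos hε)] with y hy z hz
      have h1 : ε ≤ ‖z - x‖ := by
        by_contra! h
        exact hb (by rwa [mem_ball_iff_norm]) hz
      have h2 : ‖z - x‖ ≤ ‖z - y‖ + ‖y - x‖ := norm_sub_le_norm_sub_add_norm_sub _ _ _
      rw [mem_ball_iff_norm] at hy
      rw [norm_sub_rev x y]
      linarith
    filter_upwards [hd] with y hy
    have : HasLogOn (fun z => (z - x) / (z - y)) K := by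
      refine of_norm_sub_lt (h := fun _ => 1) ?_ continuousOn_const (const one_ne_zero) ?_
      · exact ContinuousOn.div (by fun_prop) (by fun_prop) (hne y hy.1)
      · intro z hz
        have := hne y hy.1 z hz
        rw [div_sub_one this, norm_div, norm_one, div_lt_one (norm_pos_iff.2 this)]
        rw [sub_sub_sub_cancel_left, norm_sub_rev]
        exact hy.2 z hz
    exact this
  · intro x y z hx hy hz h1 h2
    refine (h1.mul h2).congr fun w hw => ?_
    have := hne y hy w hw
    field_simp
  · intro x y hx hy h1
    exact h1.inv.congr fun _ _ => inv_div _ _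

/-- Inside its unbounded component `a` can be moved to a point `b` so far away that `z - b` has a
logarithm on `K`; the quotient is handled by `sub_div_sub`. -/
theorem sub_of_not_isBounded {K : Set ℂ} (hK : IsCompact K) {a : ℂ} (ha : a ∉ K)
    (h : ¬ Bornology.IsBounded (connectedComponentIn Kᶜ a)) : HasLogOn (fun z => z - a) K := by
  obtain ⟨R, hR⟩ := hK.isBounded.subset_ball 0
  obtain ⟨b, hb, hbR⟩ : ∃ b ∈ connectedComponentIn Kᶜ a, R ≤ ‖b - 0‖ := by
    by_contra! H
    exact h (Metric.isBounded_ball.subset (t := Metric.ball 0 R) fun b hb => by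
      simpa using H b hb)
  have h1 := sub_div_sub hK ((NotSeparates.iff_mem_connectedComponentIn ha).2 hb)
  have h2 : HasLogOn (fun z => z - b) K :=
    sub_of_bounded (c := 0) (fun z hz => by simpa using hR hz) hbR
  refine (h1.mul h2).congr fun z hz => ?_
  have := h2.ne_zero hz
  field_simp

end HasLogOn

/-- The winding number is one. Moving `a` to the center multiplies by a function with a logarithm,
and along the circle a logarithm of `z - c` must be `log R + it` up to a constant, which does not
return to its initial value. -/
theorem not_hasLogOn_sub_sphere (a c : ℂ) {R : ℝ} (hR : ‖a - c‖ < R) :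
    ¬ HasLogOn (fun z => z - a) (Metric.sphere c R) := by
  intro h
  have hR0 : 0 < R := (norm_nonneg _).trans_lt hR
  have hcirc : ∀ t : ℝ, c + R * exp (t * I) ∈ Metric.sphere c R := fun t => by
    rw [mem_sphere_iff_norm, add_sub_cancel_left, norm_mul, norm_exp_ofReal_mul_I, mul_one,
      norm_real, Real.norm_of_nonneg hR0.le]
  have h1 : HasLogOn (fun z => z - c) (Metric.sphere c R) := by
    have h2 : NotSeparates (Metric.sphere c R) c a :=
      ⟨Metric.ball c R, fun z hz hz' => (Metric.mem_ball.1 hz).ne (Metric.mem_sphere.1 hz'),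
        (convex_ball c R).isPreconnected, Metric.mem_ball_self hR0, by rwa [mem_ball_iff_norm]⟩
    refine ((HasLogOn.sub_div_sub (isCompact_sphere c R) h2).mul h).congr fun z hz => ?_
    have := h.ne_zero hz
    field_simp
  obtain ⟨g, hg, e⟩ := h1
  have h2 : ContinuousOn (fun t : ℝ => g (c + R * exp (t * I))) univ :=
    hg.comp (by fun_prop) fun t _ => hcirc t
  obtain ⟨n, hn⟩ := HasLogOn.eq_add_int_of_preconnected isPreconnected_univ h2
    (g' := fun t : ℝ => Real.log R + t * I) (by fun_prop) fun t _ => by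
      rw [e _ (hcirc t)]; beta_reduce; rw [add_sub_cancel_left, exp_add, ← ofReal_exp, Real.exp_log hR0]
  have e0 := hn 0 trivial
  have e1 := hn (2 * Real.pi) trivial
  have : exp (((2 * Real.pi : ℝ) : ℂ) * I) = exp (((0 : ℝ) : ℂ) * I) := by
    push_cast; rw [exp_two_pi_mul_I]; simp
  rw [this, e0] at e1
  have hpi := two_pi_I_ne_zero
  push_cast at e1
  apply hpi
  linear_combination -e1


section

variable {X : Type*} [TopologicalSpace X] [LocallyConnectedSpace X]

theorem frontier_connectedComponentIn_subset_compl {U : Set X} (hU : IsOpen U) (x : X) :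
    frontier (connectedComponentIn U x) ⊆ Uᶜ := by
  intro z hz hzU
  rw [hU.connectedComponentIn.frontier_eq] at hz
  obtain ⟨y, hy, hy'⟩ := mem_closure_iff.1 hz.1 _ (hU.connectedComponentIn (x := z))
    (mem_connectedComponentIn hzU)
  apply hz.2
  rw [connectedComponentIn_eq hy', ← connectedComponentIn_eq hy]
  exact mem_connectedComponentIn hzU

end

/-- If `b` were outside the bounded component `U` of `a`, extend the logarithm to `G` on the plane
by Tietze. The function equal to `exp G * (z - b)` on `U` and to `z - a` elsewhere is continuous and
without zeros, so it has a global logarithm; but on a large circle it is `z - a`, which has none. -/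
theorem HasLogOn.mem_connectedComponentIn_of_isBounded {K : Set ℂ} (hK : IsCompact K) {a b : ℂ}
    (ha : a ∉ K) (hb : b ∉ K) (hU : Bornology.IsBounded (connectedComponentIn Kᶜ a))
    (h : HasLogOn (fun z => (z - a) / (z - b)) K) : b ∈ connectedComponentIn Kᶜ a := by
  classical
  by_contra hbU
  set U := connectedComponentIn Kᶜ a
  have hfr : frontier U ⊆ K := by
    simpa using frontier_connectedComponentIn_subset_compl hK.isClosed.isOpen_compl a
  obtain ⟨g, hg, e⟩ := h
  obtain ⟨G, hG⟩ := ContinuousMap.exists_restrict_eq hK.isClosed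
    (⟨K.domRestrict g, hg.domRestrict⟩ : C(K, ℂ))
  have hG' : ∀ z ∈ K, G z = g z := fun z hz => congrArg (fun f => f ⟨z, hz⟩) hG
  have hF : Continuous (U.piecewise (fun z => exp (G z) * (z - b)) (fun z => z - a)) := by
    refine continuous_piecewise (fun z hz => ?_) (by fun_prop) (by fun_prop)
    have hz := hfr hz
    rw [hG' z hz, e z hz]
    have : z - b ≠ 0 := fun h => hb (by rwa [← sub_eq_zero.1 h])
    field_simp
  have haU : a ∈ U := mem_connectedComponentIn ha
  have hlog := HasLogOn.of_simplyConnectedSpace hF fun z => by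
    by_cases hz : z ∈ U
    · rw [piecewise_eq_of_mem _ _ _ hz]
      exact mul_ne_zero (exp_ne_zero _) fun h => hbU (by rwa [← sub_eq_zero.1 h])
    · rw [piecewise_eq_of_notMem _ _ _ hz]
      exact fun h => hz (by rwa [sub_eq_zero.1 h])
  obtain ⟨R, hR⟩ := hU.subset_ball a
  have hR0 : ‖a - a‖ < R := by simpa using! hR haU
  refine not_hasLogOn_sub_sphere a a hR0 ((hlog.mono (subset_univ _)).congr fun z hz => ?_)
  refine piecewise_eq_of_notMem _ _ _ fun hzU => ?_
  exact (Metric.mem_ball.1 (hR hzU)).ne (Metric.mem_sphere.1 hz)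

/-- If either point lies in a bounded component, the preceding lemma applies. Otherwise both
components reach beyond a disc that contains `K`, and the exterior of that disc is connected. -/
theorem HasLogOn.notSeparates {K : Set ℂ} (hK : IsCompact K) {a b : ℂ}
    (ha : a ∉ K) (hb : b ∉ K) (h : HasLogOn (fun z => (z - a) / (z - b)) K) :
    NotSeparates K a b := by
  by_cases hU : Bornology.IsBounded (connectedComponentIn Kᶜ a)
  · exact (NotSeparates.iff_mem_connectedComponentIn ha).2
      (h.mem_connectedComponentIn_of_isBounded hK ha hb hU)
  by_cases hV : Bornology.IsBounded (connectedComponentIn Kᶜ b)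
  · exact ((NotSeparates.iff_mem_connectedComponentIn hb).2 (mem_connectedComponentIn_of_isBounded
      hK hb ha hV (h.inv.congr fun _ _ => inv_div _ _))).symm
  obtain ⟨R, hR⟩ := hK.isBounded.subset_closedBall 0
  have key : ∀ x, x ∉ K → ¬ Bornology.IsBounded (connectedComponentIn Kᶜ x) →
      ∃ y, R < ‖y - 0‖ ∧ NotSeparates K x y := by
    intro x hx hb
    by_contra! H
    refine hb (Metric.isBounded_closedBall.subset (t := Metric.closedBall 0 R) fun y hy => ?_)
    by_contra hy'
    exact H y (by simpa using hy') ((NotSeparates.iff_mem_connectedComponentIn hx).2 hy)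
  obtain ⟨y, hy, h1⟩ := key a ha hU
  obtain ⟨y', hy', h2⟩ := key b hb hV
  refine (h1.trans ⟨{z | R < ‖z - 0‖}, fun z hz hzK => ?_, isPreconnected_norm_sub_gt 0 R,
    hy, hy'⟩).trans h2.symm
  have := hR hzK
  rw [mem_closedBall_iff_norm] at this
  exact this.not_gt hz

/-- Janiszewski's theorem. -/
theorem NotSeparates.union {K L : Set ℂ} (hK : IsCompact K) (hL : IsCompact L)
    (hKL : IsPreconnected (K ∩ L)) {a b : ℂ} (h : NotSeparates K a b) (h' : NotSeparates L a b) :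
    NotSeparates (K ∪ L) a b :=
  HasLogOn.notSeparates (hK.union hL)
    (fun H => H.elim h.left_notMem h'.left_notMem)
    (fun H => H.elim h.symm.left_notMem h'.symm.left_notMem)
    (.union_of_isPreconnected_inter hK.isClosed hL.isClosed (.sub_div_sub hK h)
      (.sub_div_sub hL h') hKL)

/-- Every continuous function without zeros has a logarithm on an arc, because it has one on an
interval. -/
theorem notSeparates_arc {u : ℝ → ℂ} {s t : ℝ} (hu : ContinuousOn u (Icc s t))
    (hi : InjOn u (Icc s t)) {a b : ℂ} (ha : a ∉ u '' Icc s t) (hb : b ∉ u '' Icc s t) :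
    NotSeparates (u '' Icc s t) a b := by
  have h : ∀ {x}, x ∉ u '' Icc s t → ∀ z ∈ u '' Icc s t, z - x ≠ 0 := fun hx z hz h =>
    hx (by rwa [← sub_eq_zero.1 h])
  exact HasLogOn.notSeparates (isCompact_Icc.image_of_continuousOn hu) ha hb
    (.arc hu hi (ContinuousOn.div (by fun_prop) (by fun_prop) (h hb))
      fun z hz => div_ne_zero (h ha z hz) (h hb z hz))

end

section

open Complex Set Topology

/-! ### Borsuk's theorem -/

/-- The rational function with divisor `l`. -/
noncomputable def divisorProd (l : List (ℂ × ℤ)) (z : ℂ) : ℂ := (l.map fun p => (z - p.1) ^ p.2).prod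

theorem divisorProd_cons (p : ℂ × ℤ) (l : List (ℂ × ℤ)) (z : ℂ) :
    divisorProd (p :: l) z = (z - p.1) ^ p.2 * divisorProd l z := by
  simp [divisorProd]

theorem divisorProd_append (l l' : List (ℂ × ℤ)) (z : ℂ) :
    divisorProd (l ++ l') z = divisorProd l z * divisorProd l' z := by
  simp [divisorProd]

theorem HasLogOn.divisorProd {K : Set ℂ} {l : List (ℂ × ℤ)}
    (h : ∀ p ∈ l, HasLogOn (fun z => z - p.1) K) : HasLogOn (divisorProd l) K := by
  induction l with
  | nil => exact (HasLogOn.const one_ne_zero).congr fun z _ => by simp [_root_.divisorProd]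
  | cons p l ih =>
    exact (((h p (by simp)).zpow p.2).mul (ih fun q hq => h q (by simp [hq]))).congr
      fun z _ => (divisorProd_cons p l z).symm

/-- Up to a rational function with divisor off `K`, the function `f` has a continuous logarithm
on `K`. -/
def HasLogModDivisorOn (f : ℂ → ℂ) (K : Set ℂ) : Prop :=
  ∃ l : List (ℂ × ℤ), (∀ p ∈ l, p.1 ∉ K) ∧ HasLogOn (fun z => f z * divisorProd l z) K

/-- By uniform continuity `N` takes equal values at points of `T` closer than `δ`. Sweep the line in
steps of `δ / 2`: a jump is needed only at a sweep point outside `T`, since a sweep point in `T`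
already determines the value on the next step. The jumps thus lie in the gaps of `T`, where zeros
and poles may be placed. -/
theorem exists_list_step {T : Set ℝ} (hT : IsCompact T) {N : ℝ → ℤ} (hN : ContinuousOn N T) :
    ∃ (m : List (ℝ × ℤ)) (k : ℤ), (∀ p ∈ m, p.1 ∉ T) ∧
      ∀ t ∈ T, N t = k + (m.map fun p => if p.1 < t then p.2 else 0).sum := by
  obtain ⟨δ, hδ, hu⟩ : ∃ δ > 0, ∀ s ∈ T, ∀ t ∈ T, dist s t < δ → N s = N t := by
    have := hT.uniformContinuousOn_of_continuous hN
    rw [Metric.uniformContinuousOn_iff] at this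
    obtain ⟨δ, hδ, h⟩ := this 1 one_pos
    refine ⟨δ, hδ, fun s hs t ht hst => ?_⟩
    have := h s hs t ht hst
    rw [Int.dist_eq] at this
    have h2 : |N s - N t| < 1 := by exact_mod_cast this
    have := Int.abs_lt_one_iff.1 h2
    omega
  obtain ⟨R, hR⟩ := hT.isBounded.subset_ball 0
  have hR' : ∀ t ∈ T, -R < t ∧ t < R := fun t ht => by
    simpa [abs_lt] using hR ht
  have key : ∀ n : ℕ, ∃ (m : List (ℝ × ℤ)) (k : ℤ), (∀ p ∈ m, p.1 ∉ T ∧ p.1 ≤ -R + n * (δ / 2)) ∧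
      ∀ t ∈ T, t ≤ -R + n * (δ / 2) →
        N t = k + (m.map fun p => if p.1 < t then p.2 else 0).sum := by
    intro n
    induction n with
    | zero =>
      refine ⟨[], 0, by simp, fun t ht h => ?_⟩
      have := (hR' t ht).1
      simp at h; linarith
    | succ n ih =>
      obtain ⟨m, k, hm, hk⟩ := ih
      set τ := -R + n * (δ / 2) with hτ
      have hτ' : -R + ((n + 1 : ℕ) : ℝ) * (δ / 2) = τ + δ / 2 := by push_cast; rw [hτ]; ring
      rw [hτ']
      have hsum : ∀ t, τ < t → (m.map fun p => if p.1 < t then p.2 else 0) = m.map Prod.snd := by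
        intro t ht
        refine List.map_congr_left fun p hp => ?_
        rw [if_pos ((hm p hp).2.trans_lt ht)]
      by_cases hτT : τ ∈ T
      · refine ⟨m, k, fun p hp => ⟨(hm p hp).1, by linarith [(hm p hp).2]⟩, fun t ht htl => ?_⟩
        rcases le_or_gt t τ with h | h
        · exact hk t ht h
        · rw [hsum t h]
          have h1 : (m.map fun p => if p.1 < τ then p.2 else 0) = m.map Prod.snd := by
            refine List.map_congr_left fun p hp => ?_
            rw [if_pos ((hm p hp).2.lt_of_ne fun h => (hm p hp).1 (h ▸ hτT))]
          rw [← h1, ← hk τ hτT le_rfl]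
          refine hu t ht τ hτT ?_
          rw [Real.dist_eq, abs_of_pos (by linarith)]; linarith
      by_cases hS : ∃ s ∈ T, τ < s ∧ s ≤ τ + δ / 2
      · obtain ⟨s, hsT, hs1, hs2⟩ := hS
        refine ⟨(τ, N s - k - (m.map Prod.snd).sum) :: m, k, ?_, fun t ht htl => ?_⟩
        · intro p hp
          rcases List.mem_cons.1 hp with rfl | hp
          · exact ⟨hτT, by simp; linarith⟩
          · exact ⟨(hm p hp).1, by linarith [(hm p hp).2]⟩
        · rw [List.map_cons, List.sum_cons]
          rcases le_or_gt t τ with h | h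
          · rw [if_neg (not_lt.2 h), zero_add]
            exact hk t ht h
          · rw [if_pos h, hsum t h]
            have : N t = N s := hu t ht s hsT (by rw [Real.dist_eq, abs_lt]; constructor <;> linarith)
            rw [this]; ring
      · push Not at hS
        refine ⟨m, k, fun p hp => ⟨(hm p hp).1, by linarith [(hm p hp).2]⟩, fun t ht htl => ?_⟩
        rcases le_or_gt t τ with h | h
        · exact hk t ht h
        · exact absurd htl (not_le.2 (hS t ht h))
  obtain ⟨n, hn⟩ := exists_nat_gt (2 * R / (δ / 2))
  rw [div_lt_iff₀ (by positivity)] at hn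
  obtain ⟨m, k, hm, hk⟩ := key n
  exact ⟨m, k, fun p hp => (hm p hp).1, fun t ht => hk t ht (by linarith [(hR' t ht).2])⟩

/-! ### Gluing logarithms across a line -/

section halfplane

variable {u : ℂ} (hu : u ≠ 0) {c : ℝ} {K : Set ℂ}
include hu

theorem mem_slitPlane_mul_sub {z a : ℂ} (hza : z ≠ a) (h : (u * a).re ≤ (u * z).re) :
    u * (z - a) ∈ slitPlane := by
  rw [mem_slitPlane_iff]
  by_contra! H
  apply hza
  have hre : (u * (z - a)).re = (u * z).re - (u * a).re := by rw [mul_sub, sub_re]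
  have : u * (z - a) = 0 := Complex.ext (by simp only [zero_re]; linarith [H.1]) H.2
  exact sub_eq_zero.1 ((mul_eq_zero.1 this).resolve_left hu)

theorem HasLogOn.sub_of_le_re {a : ℂ} (ha : a ∉ K) (h : ∀ z ∈ K, (u * a).re ≤ (u * z).re) :
    HasLogOn (fun z => z - a) K := by
  have h1 : HasLogOn (fun z => u * (z - a)) K := .of_mem_slitPlane (by fun_prop) fun z hz =>
    mem_slitPlane_mul_sub hu (fun e => ha (e ▸ hz)) (h z hz)
  refine (h1.mul (.const (inv_ne_zero hu))).congr fun z _ => ?_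
  field_simp

/-- Each jump is removed by a zero or pole `a` on the dividing line. The logarithm `log (-u(z - a))`
on one side and `log (u(z - a)) + πi` on the other agree below `a` and differ by `-2πi` above it, so
multiplication by the `j`-th power cancels a jump of height `j`. When no jump is left, the two
logarithms differ by a constant and glue. -/
theorem hasLogModDivisorOn_of_step {f : ℂ → ℂ} (hK : IsClosed K)
    {gA gB : ℂ → ℂ} (cA : ContinuousOn gA (K ∩ {z | (u * z).re ≤ c}))
    (cB : ContinuousOn gB (K ∩ {z | c ≤ (u * z).re}))
    (eA : ∀ z ∈ K ∩ {z | (u * z).re ≤ c}, exp (gA z) = f z)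
    (eB : ∀ z ∈ K ∩ {z | c ≤ (u * z).re}, exp (gB z) = f z)
    (m : List (ℝ × ℤ)) (k : ℤ) (hm : ∀ p ∈ m, ∀ z ∈ K, (u * z).re = c → (u * z).im ≠ p.1)
    (hg : ∀ z ∈ K, (u * z).re = c → gA z = gB z +
      ((k + (m.map fun p => if p.1 < (u * z).im then p.2 else 0).sum : ℤ) : ℂ) *
        (2 * Real.pi * I)) : HasLogModDivisorOn f K := by
  induction m generalizing f gA gB with
  | nil =>
    refine ⟨[], by simp, ?_⟩
    have hKu : K = (K ∩ {z | (u * z).re ≤ c}) ∪ (K ∩ {z | c ≤ (u * z).re}) := by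
      ext z; simp only [mem_union, mem_inter_iff, mem_ofPred_eq]
      constructor
      · intro h; exact (le_total (u * z).re c).imp (⟨h, ·⟩) (⟨h, ·⟩)
      · rintro (h | h) <;> exact h.1
    rw [hKu]
    refine HasLogOn.of_isClosed_union (hK.inter (isClosed_le (by fun_prop) continuous_const))
      (hK.inter (isClosed_le continuous_const (by fun_prop))) cA
      (gB := fun z => gB z + k * (2 * Real.pi * I)) (cB.add continuousOn_const)
      (fun z hz => by simp [divisorProd, eA z hz])
      (fun z hz => by rw [exp_add, exp_int_mul_two_pi_mul_I, eB z hz]; simp [divisorProd]) ?_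
    rintro z ⟨⟨hz, h1⟩, -, h2⟩
    simpa using hg z hz (le_antisymm h1 h2)
  | cons p m ih =>
    obtain ⟨τ, j⟩ := p
    set a : ℂ := u⁻¹ * (c + τ * I) with ha
    have hua : u * a = c + τ * I := by rw [ha]; field_simp
    have hare : (u * a).re = c := by rw [hua]; simp
    have haim : (u * a).im = τ := by rw [hua]; simp
    have haK : a ∉ K := fun h => hm (τ, j) (by simp) a h hare haim
    have hne : ∀ z ∈ K, z ≠ a := fun z hz e => haK (e ▸ hz)
    have hnu : -u ≠ 0 := neg_ne_zero.2 hu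
    have sA : ∀ z ∈ K ∩ {z | (u * z).re ≤ c}, -u * (z - a) ∈ slitPlane := fun z hz =>
      mem_slitPlane_mul_sub hnu (hne z hz.1) (by
        rw [neg_mul, neg_mul, neg_re, neg_re, hare]; exact neg_le_neg hz.2)
    have sB : ∀ z ∈ K ∩ {z | c ≤ (u * z).re}, u * (z - a) ∈ slitPlane := fun z hz =>
      mem_slitPlane_mul_sub hu (hne z hz.1) (by rw [hare]; exact hz.2)
    have key := ih (f := fun z => f z * (-u * (z - a)) ^ j)
      (gA := fun z => gA z + j * log (-u * (z - a)))
      (gB := fun z => gB z + j * (log (u * (z - a)) + Real.pi * I))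
      (cA.add (continuousOn_const.mul (ContinuousOn.clog (by fun_prop) sA)))
      (cB.add (continuousOn_const.mul
        ((ContinuousOn.clog (by fun_prop) sB).add continuousOn_const)))
      (fun z hz => by
        rw [exp_add, exp_int_mul, exp_log (slitPlane_ne_zero (sA z hz)), eA z hz])
      (fun z hz => by
        rw [exp_add, exp_int_mul, exp_add, exp_log (slitPlane_ne_zero (sB z hz)), eB z hz,
          exp_pi_mul_I, mul_neg_one, neg_mul])
      (fun p hp => hm p (List.mem_cons_of_mem _ hp)) ?_
    · obtain ⟨l, hl, hlog⟩ := key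
      refine ⟨(a, j) :: l, ?_, ?_⟩
      · intro p hp
        rcases List.mem_cons.1 hp with rfl | hp
        · exact haK
        · exact hl p hp
      · refine (hlog.mul (.const (zpow_ne_zero (-j) hnu))).congr fun z hz => ?_
        beta_reduce
        rw [divisorProd_cons, mul_zpow, zpow_neg]
        have := zpow_ne_zero j hnu
        field_simp
    · intro z hz hzc
      have h1 := hg z hz hzc
      rw [List.map_cons, List.sum_cons] at h1
      have huz : u * (z - a) = ((u * z).im - τ : ℝ) * I := by
        apply Complex.ext
        · simp [mul_sub, hare, hzc]
        · simp [mul_sub, haim]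
      have huz' : -u * (z - a) = ((u * z).im - τ : ℝ) * -I := by
        rw [neg_mul, huz]; ring
      have hτ : (u * z).im ≠ τ := hm (τ, j) (by simp) z hz hzc
      rw [huz, huz', h1]
      rcases lt_or_gt_of_ne hτ with h | h
      · have e : ((u * z).im - τ : ℝ) = -(τ - (u * z).im) := by ring
        have hp : 0 < τ - (u * z).im := by linarith
        rw [if_neg (not_lt.2 h.le), e]
        push_cast
        rw [show (-((τ : ℂ) - (u * z).im)) * -I = ((τ - (u * z).im : ℝ) : ℂ) * I by push_cast; ring,
          show (-((τ : ℂ) - (u * z).im)) * I = ((τ - (u * z).im : ℝ) : ℂ) * -I by push_cast; ring,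
          log_ofReal_mul hp I_ne_zero, log_ofReal_mul hp (neg_ne_zero.2 I_ne_zero), log_I, log_neg_I]
        ring
      · have hp : 0 < (u * z).im - τ := by linarith
        rw [if_pos h, log_ofReal_mul hp I_ne_zero, log_ofReal_mul hp (neg_ne_zero.2 I_ne_zero), log_I,
          log_neg_I]
        push_cast; ring

end halfplane

/-- A factor `z - a` that has a logarithm on `S` can be dropped from the divisor. This is used to
keep only those points that lie strictly on one side of the dividing line, and so avoid the whole of
`K`. -/
theorem HasLogOn.prune_divisor {S : Set ℂ} {P : ℂ → Prop} {f : ℂ → ℂ} (l : List (ℂ × ℤ))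
    (hl : ∀ p ∈ l, p.1 ∉ S) (hP : ∀ a ∉ S, ¬ P a → HasLogOn (fun z => z - a) S)
    (h : HasLogOn (fun z => f z * _root_.divisorProd l z) S) :
    ∃ l' : List (ℂ × ℤ), (∀ p ∈ l', p.1 ∉ S ∧ P p.1) ∧
      HasLogOn (fun z => f z * _root_.divisorProd l' z) S := by
  induction l generalizing f with
  | nil => exact ⟨[], by simp, h⟩
  | cons p l ih =>
    obtain ⟨l', hl', log'⟩ := ih (f := fun z => f z * (z - p.1) ^ p.2)
      (fun q hq => hl q (List.mem_cons_of_mem _ hq))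
      (h.congr fun z _ => by rw [divisorProd_cons, mul_assoc])
    by_cases hp : P p.1
    · refine ⟨p :: l', fun q hq => ?_, log'.congr fun z _ => by
        rw [divisorProd_cons, mul_assoc]⟩
      rcases List.mem_cons.1 hq with rfl | hq
      · exact ⟨hl q (by simp), hp⟩
      · exact hl' q hq
    · have h1 := hP p.1 (hl p (by simp)) hp
      refine ⟨l', hl', (log'.div (h1.zpow p.2)).congr fun z hz => ?_⟩
      have := (h1.zpow p.2).ne_zero hz
      field_simp

/-- After pruning, each half's divisor lies off `K`, and its factors have logarithms on the opposite
half. The product of both divisors therefore works on both halves, and the two logarithms differ on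
the line by a locally constant integer, a step function. -/
theorem HasLogModDivisorOn.of_halfplanes {u : ℂ} (hu : u ≠ 0) {c : ℝ} {K : Set ℂ}
    (hK : IsCompact K) {f : ℂ → ℂ}
    (hA : HasLogModDivisorOn f (K ∩ {z | (u * z).re ≤ c}))
    (hB : HasLogModDivisorOn f (K ∩ {z | c ≤ (u * z).re})) : HasLogModDivisorOn f K := by
  have hnu : -u ≠ 0 := neg_ne_zero.2 hu
  obtain ⟨lA, hlA, logA⟩ := hA
  obtain ⟨lB, hlB, logB⟩ := hB
  obtain ⟨lA, hlA, logA⟩ := HasLogOn.prune_divisor (P := fun a => (u * a).re < c) lA hlA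
    (fun a ha h => .sub_of_le_re hnu ha fun z hz => by
      rw [neg_mul, neg_mul, neg_re, neg_re]
      exact neg_le_neg (hz.2.trans (not_lt.1 h))) logA
  obtain ⟨lB, hlB, logB⟩ := HasLogOn.prune_divisor (P := fun a => c < (u * a).re) lB hlB
    (fun a ha h => .sub_of_le_re hu ha fun z hz => (not_lt.1 h).trans hz.2) logB
  replace hlA : ∀ p ∈ lA, p.1 ∉ K ∧ (u * p.1).re < c := fun p hp =>
    ⟨fun h => (hlA p hp).1 ⟨h, (hlA p hp).2.le⟩, (hlA p hp).2⟩
  replace hlB : ∀ p ∈ lB, p.1 ∉ K ∧ c < (u * p.1).re := fun p hp =>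
    ⟨fun h => (hlB p hp).1 ⟨h, (hlB p hp).2.le⟩, (hlB p hp).2⟩
  have logA' : HasLogOn (fun z => f z * divisorProd (lA ++ lB) z) (K ∩ {z | (u * z).re ≤ c}) := by
    have : HasLogOn (divisorProd lB) (K ∩ {z | (u * z).re ≤ c}) := .divisorProd fun p hp =>
      .sub_of_le_re hnu (fun h => (hlB p hp).1 h.1) fun z hz => by
        rw [neg_mul, neg_mul, neg_re, neg_re]
        exact neg_le_neg (hz.2.trans (hlB p hp).2.le)
    exact (logA.mul this).congr fun z _ => by rw [divisorProd_append, mul_assoc]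
  have logB' : HasLogOn (fun z => f z * divisorProd (lA ++ lB) z) (K ∩ {z | c ≤ (u * z).re}) := by
    have : HasLogOn (divisorProd lA) (K ∩ {z | c ≤ (u * z).re}) := .divisorProd fun p hp =>
      .sub_of_le_re hu (fun h => (hlA p hp).1 h.1) fun z hz => (hlA p hp).2.le.trans hz.2
    exact (logB.mul this).congr fun z _ => by rw [divisorProd_append]; ring
  have hAB : ∀ p ∈ lA ++ lB, p.1 ∉ K := fun p hp =>
    (List.mem_append.1 hp).elim (fun h => (hlA p h).1) (fun h => (hlB p h).1)
  obtain ⟨gA, cA, eA⟩ := logA'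
  obtain ⟨gB, cB, eB⟩ := logB'
  set ℓ : ℝ → ℂ := fun t => u⁻¹ * (c + t * I) with hℓ
  have hℓc : Continuous ℓ := by fun_prop
  have hℓ1 : ∀ t, u * ℓ t = c + t * I := fun t => by rw [hℓ]; field_simp
  have hℓ2 : ∀ z, (u * z).re = c → ℓ ((u * z).im) = z := fun z hz => by
    have : (c : ℂ) + ((u * z).im : ℝ) * I = u * z := by rw [← hz, re_add_im]
    simp only [hℓ, this]; field_simp
  set T : Set ℝ := (fun z => (u * z).im) '' (K ∩ {z | (u * z).re = c}) with hT
  have hTc : IsCompact T :=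
    (hK.inter_right (isClosed_eq (by fun_prop) continuous_const)).image (by fun_prop)
  have hℓT : ∀ t ∈ T, ℓ t ∈ K ∧ (u * ℓ t).re = c := by
    rintro _ ⟨z, ⟨hz, hzc⟩, rfl⟩
    simp only [hℓ2 z hzc]; exact ⟨hz, hzc⟩
  have hex : ∀ t ∈ T, ∃ n : ℤ, gA (ℓ t) = gB (ℓ t) + n * (2 * Real.pi * I) := fun t ht => by
    refine exp_eq_exp_iff_exists_int.1 ((eA _ ?_).trans (eB _ ?_).symm)
    · exact ⟨(hℓT t ht).1, (hℓT t ht).2.le⟩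
    · exact ⟨(hℓT t ht).1, (hℓT t ht).2.ge⟩
  choose! N hN using hex
  have hNc : ContinuousOn N T := by
    have h1 : ContinuousOn (fun t => (gA (ℓ t) - gB (ℓ t)) / (2 * Real.pi * I)) T :=
      ((cA.comp hℓc.continuousOn fun t ht => ⟨(hℓT t ht).1, (hℓT t ht).2.le⟩).sub
        (cB.comp hℓc.continuousOn fun t ht => ⟨(hℓT t ht).1, (hℓT t ht).2.ge⟩)).div_const _
    have h2 : ContinuousOn (fun t => ((N t : ℤ) : ℂ)) T := h1.congr fun t ht => by
      have := hN t ht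
      beta_reduce
      rw [this, add_sub_cancel_left, mul_div_cancel_right₀ _ two_pi_I_ne_zero]
    have h3 : ContinuousOn (fun t => ((N t : ℤ) : ℝ)) T := by
      simpa using! Complex.continuous_re.comp_continuousOn h2
    exact Int.isClosedEmbedding_coe_real.isInducing.continuousOn_iff.2 h3
  obtain ⟨m, k, hm, hk⟩ := exists_list_step hTc hNc
  obtain ⟨l, hl, hlog⟩ := hasLogModDivisorOn_of_step hu hK.isClosed cA cB eA eB m k
    (fun p hp z hz hzc e => hm p hp ⟨z, ⟨hz, hzc⟩, e⟩) fun z hz hzc => by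
      have hzT : (u * z).im ∈ T := ⟨z, ⟨hz, hzc⟩, rfl⟩
      rw [← hk _ hzT]
      simpa only [hℓ2 z hzc] using hN _ hzT
  refine ⟨(lA ++ lB) ++ l, fun p hp => (List.mem_append.1 hp).elim (hAB p) (hl p),
    hlog.congr fun z _ => ?_⟩
  rw [divisorProd_append, mul_assoc]

/-- Borsuk's theorem: a continuous map from a compact plane set to the punctured plane is
homotopic to the restriction of a rational function. -/
theorem hasLogModDivisorOn_of_continuousOn {K : Set ℂ} (hK : IsCompact K) {f : ℂ → ℂ}
    (hf : ContinuousOn f K) (h0 : ∀ z ∈ K, f z ≠ 0) : HasLogModDivisorOn f K := by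
  rcases K.eq_empty_or_nonempty with rfl | hne
  · exact ⟨[], by simp, fun _ => 0, continuousOn_const, by simp⟩
  obtain ⟨z0, hz0, hmin⟩ := hK.exists_isMinOn hne hf.norm
  have hm : 0 < ‖f z0‖ := norm_pos_iff.2 (h0 z0 hz0)
  obtain ⟨δ, hδ, hu⟩ := Metric.uniformContinuousOn_iff.1
    (hK.uniformContinuousOn_of_continuous hf) _ hm
  set η := δ / 4 with hη
  -- A square of side `η` is so small that `f` stays within its own minimum modulus of a fixed value
  -- there, hence has a logarithm. Larger squares are halved twice, by a vertical and by horizontal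
  -- lines, so their side doubles at each stage.
  have key : ∀ n : ℕ, ∀ a b : ℝ, HasLogModDivisorOn f
      (K ∩ {z | a ≤ z.re ∧ z.re ≤ a + 2 ^ n * η ∧ b ≤ z.im ∧ z.im ≤ b + 2 ^ n * η}) := by
    intro n
    induction n with
    | zero =>
      intro a b
      refine ⟨[], by simp, ?_⟩
      rcases (K ∩ {z | a ≤ z.re ∧ z.re ≤ a + 2 ^ 0 * η ∧ b ≤ z.im ∧ z.im ≤ b + 2 ^ 0 * η})
        |>.eq_empty_or_nonempty with he | ⟨w, hw, hw1, hw2, hw3, hw4⟩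
      · rw [he]; exact ⟨fun _ => 0, continuousOn_const, by simp⟩
      simp only [divisorProd, List.map_nil, List.prod_nil, mul_one]
      refine .of_norm_sub_lt (h := fun _ => f w) (hf.mono inter_subset_left) continuousOn_const
        (.const (h0 w hw)) ?_
      rintro z ⟨hz, hz1, hz2, hz3, hz4⟩
      have h1 : dist z w < δ := by
        rw [dist_eq]
        refine (norm_le_abs_re_add_abs_im _).trans_lt ?_
        rw [pow_zero, one_mul] at *
        have h2 : |(z - w).re| ≤ η := by rw [sub_re, abs_le]; constructor <;> linarith
        have h3 : |(z - w).im| ≤ η := by rw [sub_im, abs_le]; constructor <;> linarith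
        linarith
      have h2 := hu z hz w hw h1
      rw [dist_eq] at h2
      exact h2.trans_le (hmin hw)
    | succ n ih =>
      intro a b
      have hc : ∀ a b c d : ℝ, IsCompact (K ∩ {z : ℂ | a ≤ z.re ∧ z.re ≤ b ∧ c ≤ z.im ∧ z.im ≤ d}) := by
        intro a b c d
        refine hK.inter_right ?_
        simp only [ofPred_and]
        exact (isClosed_le continuous_const continuous_re).inter
          ((isClosed_le continuous_re continuous_const).inter
          ((isClosed_le continuous_const continuous_im).inter
          (isClosed_le continuous_im continuous_const)))
      have hpos : 0 < 2 ^ n * η := by positivity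
      have e2 : (2 : ℝ) ^ (n + 1) * η = 2 ^ n * η + 2 ^ n * η := by rw [pow_succ]; ring
      rw [e2]
      generalize 2 ^ n * η = r at *
      have half : ∀ a, HasLogModDivisorOn f
          (K ∩ {z | a ≤ z.re ∧ z.re ≤ a + r ∧ b ≤ z.im ∧ z.im ≤ b + (r + r)}) := by
        intro a
        refine .of_halfplanes (u := -I) (neg_ne_zero.2 I_ne_zero) (c := b + r) (hc _ _ _ _) ?_ ?_
        · convert ih a b using 1
          ext z; simp
          constructor
          · rintro ⟨⟨h0, h1, h2, h3, h4⟩, h5⟩; refine ⟨h0, ?_, ?_, ?_, ?_⟩ <;> linarith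
          · rintro ⟨h0, h1, h2, h3, h4⟩; refine ⟨⟨h0, ?_, ?_, ?_, ?_⟩, ?_⟩ <;> linarith
        · convert ih a (b + r) using 1
          ext z; simp
          constructor
          · rintro ⟨⟨h0, h1, h2, h3, h4⟩, h5⟩; refine ⟨h0, ?_, ?_, ?_, ?_⟩ <;> linarith
          · rintro ⟨h0, h1, h2, h3, h4⟩; refine ⟨⟨h0, ?_, ?_, ?_, ?_⟩, ?_⟩ <;> linarith
      refine .of_halfplanes (u := 1) one_ne_zero (c := a + r) (hc _ _ _ _) ?_ ?_
      · convert half a using 1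
        ext z; simp
        constructor
        · rintro ⟨⟨h0, h1, h2, h3, h4⟩, h5⟩; refine ⟨h0, ?_, ?_, ?_, ?_⟩ <;> linarith
        · rintro ⟨h0, h1, h2, h3, h4⟩; refine ⟨⟨h0, ?_, ?_, ?_, ?_⟩, ?_⟩ <;> linarith
      · convert half (a + r) using 1
        ext z; simp
        constructor
        · rintro ⟨⟨h0, h1, h2, h3, h4⟩, h5⟩; refine ⟨h0, ?_, ?_, ?_, ?_⟩ <;> linarith
        · rintro ⟨h0, h1, h2, h3, h4⟩; refine ⟨⟨h0, ?_, ?_, ?_, ?_⟩, ?_⟩ <;> linarith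
  obtain ⟨R, hR⟩ := hK.isBounded.subset_ball 0
  obtain ⟨n, hn⟩ := pow_unbounded_of_one_lt (2 * R / η) one_lt_two
  rw [div_lt_iff₀ (by positivity)] at hn
  convert key n (-R) (-R) using 1
  refine (inter_eq_left.2 fun z hz => ?_).symm
  have h1 : ‖z‖ < R := by simpa using hR hz
  have h2 := abs_le.1 (abs_re_le_norm z)
  have h3 := abs_le.1 (abs_im_le_norm z)
  refine ⟨?_, ?_, ?_, ?_⟩ <;> linarith

/-- By Borsuk's theorem only factors `z - a` with `a` off `K` obstruct a logarithm, and these have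
one when every complementary component is unbounded. -/
theorem HasLogOn.of_forall_not_isBounded {K : Set ℂ} (hK : IsCompact K)
    (hc : ∀ a ∉ K, ¬ Bornology.IsBounded (connectedComponentIn Kᶜ a)) {f : ℂ → ℂ}
    (hf : ContinuousOn f K) (h0 : ∀ z ∈ K, f z ≠ 0) : HasLogOn f K := by
  obtain ⟨l, hl, hlog⟩ := hasLogModDivisorOn_of_continuousOn hK hf h0
  have h1 : HasLogOn (_root_.divisorProd l) K :=
    .divisorProd fun p hp => .sub_of_not_isBounded hK (hl p hp) (hc p.1 (hl p hp))
  refine (hlog.div h1).congr fun z hz => ?_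
  have := h1.ne_zero hz
  field_simp

end

section

open Complex Set Topology

/-! ### Jordan curves in the plane -/

theorem AddCircle.injOn_coe_Icc {α β : ℝ} (h : β - α < 1) :
    InjOn (fun s : ℝ => (s : AddCircle (1 : ℝ))) (Icc α β) := by
  have : Fact ((0 : ℝ) < 1) := ⟨one_pos⟩
  intro s hs t ht e
  exact (AddCircle.coe_eq_coe_iff_of_mem_Ico (p := (1 : ℝ)) (a := α)
    ⟨hs.1, by linarith [hs.2]⟩ ⟨ht.1, by linarith [ht.2]⟩).1 e

theorem AddCircle.exists_coe_eq (α : ℝ) (x : AddCircle (1 : ℝ)) :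
    ∃ s ∈ Ico α (α + 1), (s : AddCircle (1 : ℝ)) = x := by
  have : Fact ((0 : ℝ) < 1) := ⟨one_pos⟩
  have := AddCircle.coe_image_Ico_eq (1 : ℝ) α
  exact (this ▸ mem_univ x : x ∈ _ '' Ico α (α + 1))

theorem exists_closedCurve_of_Icc {Y : Type*} [TopologicalSpace Y] {w : ℝ → Y}
    (hw : ContinuousOn w (Icc 0 1)) (hi : InjOn w (Ico 0 1)) (h01 : w 0 = w 1) :
    ∃ γ : AddCircle (1 : ℝ) → Y, Continuous γ ∧ Function.Injective γ ∧
      range γ = w '' Icc 0 1 := by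
  have : Fact ((0 : ℝ) < 1) := ⟨one_pos⟩
  have hval : ∀ t ∈ Ico (0 : ℝ) 1, AddCircle.liftIco 1 0 w t = w t := fun t ht =>
    AddCircle.liftIco_zero_coe_apply ht
  refine ⟨AddCircle.liftIco 1 0 w, AddCircle.liftIco_zero_continuous h01 hw, ?_, ?_⟩
  · intro x y hxy
    obtain ⟨s, hs, rfl⟩ := AddCircle.exists_coe_eq 0 x
    obtain ⟨t, ht, rfl⟩ := AddCircle.exists_coe_eq 0 y
    rw [zero_add] at hs ht
    rw [hval s hs, hval t ht] at hxy
    rw [hi hs ht hxy]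
  · ext z
    constructor
    · rintro ⟨x, rfl⟩
      obtain ⟨s, hs, rfl⟩ := AddCircle.exists_coe_eq 0 x
      rw [zero_add] at hs
      exact ⟨s, ⟨hs.1, hs.2.le⟩, (hval s hs).symm⟩
    · rintro ⟨s, hs, rfl⟩
      rcases hs.2.lt_or_eq with h | rfl
      · exact ⟨s, hval s ⟨hs.1, h⟩⟩
      · exact ⟨(0 : ℝ), by rw [hval 0 ⟨le_rfl, one_pos⟩, h01]⟩

/-- Two arcs that meet in their common end points form a simple closed curve. -/
theorem exists_closedCurve_of_arcs {Y : Type*} [TopologicalSpace Y] {f g : ℝ → Y}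
    (hf : ContinuousOn f (Icc 0 1)) (hg : ContinuousOn g (Icc 0 1)) (fi : InjOn f (Icc 0 1))
    (gi : InjOn g (Icc 0 1)) (h0 : f 0 = g 0) (h1 : f 1 = g 1)
    (hfg : f '' Icc 0 1 ∩ g '' Icc 0 1 ⊆ {f 0, f 1}) :
    ∃ γ : AddCircle (1 : ℝ) → Y, Continuous γ ∧ Function.Injective γ ∧
      range γ = f '' Icc 0 1 ∪ g '' Icc 0 1 := by
  classical
  set w : ℝ → Y := fun t => if t ≤ 1 / 2 then f (2 * t) else g (2 - 2 * t) with hw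
  have w1 : ∀ t ≤ 1 / 2, w t = f (2 * t) := fun t ht => if_pos ht
  have w2 : ∀ t, 1 / 2 ≤ t → w t = g (2 - 2 * t) := fun t ht => by
    rcases ht.eq_or_lt with rfl | ht
    · rw [w1 _ le_rfl]; norm_num [h1]
    · exact if_neg (not_le.2 ht)
  have e : Icc (0 : ℝ) 1 = Icc 0 (1 / 2) ∪ Icc (1 / 2) 1 :=
    (Icc_union_Icc_eq_Icc (by norm_num) (by norm_num)).symm
  have w_cont : ContinuousOn w (Icc 0 1) := by
    rw [e]
    refine ContinuousOn.union_of_isClosed ?_ ?_ isClosed_Icc isClosed_Icc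
    · refine (hf.comp (f := fun t => 2 * t) (by fun_prop) fun t ht => ?_).congr
        fun t ht => w1 t ht.2
      exact ⟨by linarith [ht.1], by linarith [ht.2]⟩
    · refine (hg.comp (f := fun t => 2 - 2 * t) (by fun_prop) fun t ht => ?_).congr
        fun t ht => w2 t ht.1
      exact ⟨by linarith [ht.2], by linarith [ht.1]⟩
  have w_inj : InjOn w (Ico 0 1) := by
    have cross : ∀ s ∈ Icc (0 : ℝ) (1 / 2), ∀ t ∈ Ico (1 / 2 : ℝ) 1, w s = w t → s = t := by
      intro s hs t ht hst
      rw [w1 s hs.2, w2 t ht.1] at hst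
      have hs' : 2 * s ∈ Icc (0 : ℝ) 1 := ⟨by linarith [hs.1], by linarith [hs.2]⟩
      have ht' : 2 - 2 * t ∈ Icc (0 : ℝ) 1 := ⟨by linarith [ht.2], by linarith [ht.1]⟩
      have := hfg ⟨⟨_, hs', rfl⟩, ⟨_, ht', hst.symm⟩⟩
      rcases this with h | h
      · have e1 := fi hs' ⟨le_rfl, zero_le_one⟩ h
        rw [h, h0] at hst
        have e2 := gi ht' ⟨le_rfl, zero_le_one⟩ hst.symm
        linarith [ht.2]
      · have e1 := fi hs' ⟨zero_le_one, le_rfl⟩ h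
        rw [mem_singleton_iff.1 h, h1] at hst
        have e2 := gi ht' ⟨zero_le_one, le_rfl⟩ hst.symm
        linarith
    intro s hs t ht hst
    rcases le_total s (1 / 2) with h | h <;> rcases le_total t (1 / 2) with h' | h'
    · rw [w1 s h, w1 t h'] at hst
      have := fi ⟨by linarith [hs.1], by linarith⟩ ⟨by linarith [ht.1], by linarith⟩ hst
      linarith
    · exact cross s ⟨hs.1, h⟩ t ⟨h', ht.2⟩ hst
    · exact (cross t ⟨ht.1, h'⟩ s ⟨h, hs.2⟩ hst.symm).symm
    · rw [w2 s h, w2 t h'] at hst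
      have := gi ⟨by linarith [hs.2], by linarith⟩ ⟨by linarith [ht.2], by linarith⟩ hst
      linarith
  have w01 : w 0 = w 1 := by
    rw [w1 0 (by norm_num), w2 1 (by norm_num)]; norm_num [h0]
  obtain ⟨γ, h, h', h''⟩ := exists_closedCurve_of_Icc (w := w) w_cont w_inj w01
  refine ⟨γ, h, h', ?_⟩
  have e' : w '' Icc 0 1 = w '' Icc 0 (1 / 2) ∪ w '' Icc (1 / 2) 1 := by rw [e, image_union]
  rw [h'', e']
  congr 1
  · ext z; constructor
    · rintro ⟨t, ht, rfl⟩
      exact ⟨2 * t, ⟨by linarith [ht.1], by linarith [ht.2]⟩, (w1 t ht.2).symm⟩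
    · rintro ⟨t, ht, rfl⟩
      refine ⟨t / 2, ⟨by linarith [ht.1], by linarith [ht.2]⟩, ?_⟩
      rw [w1 _ (by linarith [ht.2])]; congr 1; ring
  · ext z; constructor
    · rintro ⟨t, ht, rfl⟩
      exact ⟨2 - 2 * t, ⟨by linarith [ht.2], by linarith [ht.1]⟩, (w2 t ht.1).symm⟩
    · rintro ⟨t, ht, rfl⟩
      refine ⟨1 - t / 2, ⟨by linarith [ht.2], by linarith [ht.1]⟩, ?_⟩
      rw [w2 _ (by linarith [ht.2])]; congr 1; ring

theorem injOn_comp_coe {Y : Type*} {γ : AddCircle (1 : ℝ) → Y} (hi : Function.Injective γ)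
    {α β : ℝ} (h : β - α < 1) : InjOn (fun s : ℝ => γ s) (Icc α β) :=
  hi.comp_injOn (AddCircle.injOn_coe_Icc h)

section

variable {γ : AddCircle (1 : ℝ) → ℂ} (hc : Continuous γ) (hi : Function.Injective γ)
include hc

theorem isCompact_range_closedCurve : IsCompact (range γ) := by
  have : Fact ((0 : ℝ) < 1) := ⟨one_pos⟩
  exact isCompact_range hc

theorem continuous_comp_coe : Continuous fun s : ℝ => γ s :=
  hc.comp (AddCircle.continuous_mk' 1)

include hi

/-- A simple closed curve bounds: some component of its complement is bounded. -/
theorem exists_isBounded_component :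
    ∃ a ∉ range γ, Bornology.IsBounded (connectedComponentIn (range γ)ᶜ a) := by
  have : Fact ((0 : ℝ) < 1) := ⟨one_pos⟩
  by_contra! H
  -- Extend the inverse of `γ`, read as the identity of the unit circle, to the plane. Without
  -- bounded components it would have a logarithm on the curve, hence so would the identity of the
  -- circle.
  obtain ⟨G, hG⟩ := ContinuousMap.exists_extension' (hc.isClosedEmbedding hi)
    (⟨fun t => (AddCircle.toCircle t : ℂ), by fun_prop⟩ : C(AddCircle (1 : ℝ), ℂ))
  have hG' : ∀ t, G (γ t) = (AddCircle.toCircle t : ℂ) := fun t => congrFun hG t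
  obtain ⟨g, hg, e⟩ := HasLogOn.of_forall_not_isBounded (isCompact_range_closedCurve hc) H
    (f := G) G.continuous.continuousOn (by rintro _ ⟨t, rfl⟩; rw [hG']; exact Circle.coe_ne_zero _)
  obtain ⟨n, hn⟩ := HasLogOn.eq_add_int_of_preconnected isPreconnected_univ
    (g := fun t : ℝ => g (γ t)) (g' := fun t : ℝ => t * (2 * Real.pi * I))
    (hg.comp (continuous_comp_coe hc).continuousOn fun t _ => mem_range_self _) (by fun_prop)
    fun t _ => by
      rw [e _ (mem_range_self _), hG', AddCircle.toCircle_apply_mk, Circle.coe_exp]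
      congr 1; push_cast; ring
  have e0 := hn 0 trivial
  have e1 := hn 1 trivial
  have : ((1 : ℝ) : AddCircle (1 : ℝ)) = ((0 : ℝ) : AddCircle (1 : ℝ)) := by
    simp
  rw [this, e0] at e1
  apply two_pi_I_ne_zero
  push_cast at e1
  linear_combination -e1

theorem exists_notMem_component (x : ℂ) :
    ∃ y ∉ range γ, y ∉ connectedComponentIn (range γ)ᶜ x := by
  have hK := isCompact_range_closedCurve hc
  by_cases hb : Bornology.IsBounded (connectedComponentIn (range γ)ᶜ x)
  · obtain ⟨R, hR⟩ := (hb.union hK.isBounded).subset_ball 0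
    have : ((|R| : ℝ) : ℂ) ∉ Metric.ball (0 : ℂ) R := by
      simp [le_abs_self]
    exact ⟨_, fun h => this (hR (.inr h)), fun h => this (hR (.inl h))⟩
  · obtain ⟨a, ha, hab⟩ := exists_isBounded_component hc hi
    refine ⟨a, ha, fun h => hb ?_⟩
    rwa [connectedComponentIn_eq h]

/-- If some point of the curve were not in the closure of the component `E`, neither would a short
subarc around it. The remaining arc `a` does not separate `x` from a point `y` outside `E`; a
connected set that joins them off `a` cannot cross the frontier of `E`. -/
theorem frontier_component_eq {x : ℂ} (hx : x ∉ range γ) :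
    frontier (connectedComponentIn (range γ)ᶜ x) = range γ := by
  have hK := isCompact_range_closedCurve hc
  have hfr : frontier (connectedComponentIn (range γ)ᶜ x) ⊆ range γ := by
    simpa using frontier_connectedComponentIn_subset_compl hK.isClosed.isOpen_compl x
  have hEo : IsOpen (connectedComponentIn (range γ)ᶜ x) :=
    hK.isClosed.isOpen_compl.connectedComponentIn
  obtain ⟨y, hy, hyE⟩ := exists_notMem_component hc hi x
  refine hfr.antisymm ?_
  have hEJ : ∀ z ∈ connectedComponentIn (range γ)ᶜ x, z ∉ range γ := fun z hz =>
    connectedComponentIn_subset _ _ hz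
  have hxE : x ∈ connectedComponentIn (range γ)ᶜ x := mem_connectedComponentIn hx
  generalize connectedComponentIn (range γ)ᶜ x = E at *
  rw [hEo.frontier_eq] at *
  suffices range γ ⊆ closure E from fun z hz => ⟨this hz, fun h => hEJ z h hz⟩
  rintro _ ⟨t, rfl⟩
  obtain ⟨t, rfl⟩ := QuotientAddGroup.mk_surjective t
  by_contra hz
  have hopen : {s : ℝ | γ s ∉ closure E} ∈ 𝓝 t :=
    (isClosed_closure.isOpen_compl.preimage (continuous_comp_coe hc)).mem_nhds hz
  obtain ⟨η, hη, hηs⟩ := Metric.mem_nhds_iff.1 hopen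
  set η' := min (η / 2) (1 / 4) with hη'
  have hp : 0 < η' := by positivity
  have h4 : η' ≤ 1 / 4 := min_le_right _ _
  have h2 : η' < η := (min_le_left _ _).trans_lt (by linarith)
  set a := (fun s : ℝ => γ s) '' Icc (t + η') (t + 1 - η')
  have haJ : a ⊆ range γ := by rintro _ ⟨s, -, rfl⟩; exact mem_range_self _
  have hia : InjOn (fun s : ℝ => γ s) (Icc (t + η') (t + 1 - η')) :=
    injOn_comp_coe hi (by linarith)
  have key : ∀ z ∈ closure E, z ∈ range γ → z ∈ a := by
    rintro _ hz ⟨s, rfl⟩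
    obtain ⟨s, hs, rfl⟩ := AddCircle.exists_coe_eq (t - η') s
    refine ⟨s, ⟨?_, by linarith [hs.2]⟩, rfl⟩
    by_contra! h
    refine hηs (Metric.mem_ball.2 ?_) hz
    rw [Real.dist_eq, abs_lt]; constructor <;> linarith [hs.1]
  obtain ⟨C, hCa, hCp, hxC, hyC⟩ := notSeparates_arc (continuous_comp_coe hc).continuousOn hia
    (fun h => hEJ x hxE (haJ h)) (fun h => hy (haJ h))
  have hCE : C ⊆ E := by
    refine hCp.subset_of_closure_inter_subset hEo ⟨x, hxC, hxE⟩ ?_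
    rintro z ⟨hz, hzC⟩
    by_contra hzE
    exact hCa hzC (key z hz (hfr ⟨hz, hzE⟩))
  exact hyE (hCE hyC)

/-- Uniform continuity bounds the short arc `s` of parameters within `r` of that of `x`. The radius
`δ` is the minimum, over a compact set, of distances between points with parameters at least `r`
apart on the circle; it is positive by injectivity and independent of `x`. -/
theorem exists_local_subarc {ε : ℝ} (hε : 0 < ε) : ∃ δ > 0, ∀ x ∈ range γ, ∃ s c : Set ℂ,
    IsCompact s ∧ IsPreconnected s ∧ IsCompact c ∧ IsPreconnected c ∧ s ∪ c = range γ ∧ x ∈ s ∧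
      s ⊆ Metric.ball x ε ∧ Disjoint c (Metric.ball x δ) := by
  have hcc := continuous_comp_coe hc
  obtain ⟨η, hη, hu⟩ := Metric.uniformContinuousOn_iff.1
    ((isCompact_Icc (a := (-1 : ℝ)) (b := 2)).uniformContinuousOn_of_continuous
      hcc.continuousOn) ε hε
  set r := min (η / 2) (1 / 4) with hr
  have hp : 0 < r := by positivity
  have h4 : r ≤ 1 / 4 := min_le_right _ _
  have h2 : r < η := (min_le_left _ _).trans_lt (by linarith)
  have hcomp : IsCompact (Icc (0 : ℝ) 1 ×ˢ Icc r (1 - r)) := isCompact_Icc.prod isCompact_Icc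
  have hcont : Continuous fun p : ℝ × ℝ => dist (γ ((p.1 + p.2 : ℝ) : AddCircle (1 : ℝ))) (γ p.1) :=
    (hcc.comp (continuous_fst.add continuous_snd)).dist (hcc.comp continuous_fst)
  obtain ⟨p, ⟨hp1, hp2⟩, hmin⟩ := hcomp.exists_isMinOn
    ⟨(0, r), ⟨le_rfl, zero_le_one⟩, le_rfl, by linarith⟩ hcont.continuousOn
  refine ⟨dist (γ ((p.1 + p.2 : ℝ) : AddCircle (1 : ℝ))) (γ p.1), ?_, ?_⟩
  · refine dist_pos.2 fun h => ?_
    have := injOn_comp_coe hi (α := p.1) (β := p.1 + p.2) (by linarith [hp2.2])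
      ⟨by linarith [hp2.1], le_rfl⟩ ⟨le_rfl, by linarith [hp2.1]⟩ h
    linarith [hp2.1]
  · rintro _ ⟨t, rfl⟩
    obtain ⟨t, ht, rfl⟩ := AddCircle.exists_coe_eq 0 t
    rw [zero_add] at ht
    refine ⟨(fun s : ℝ => γ s) '' Icc (t - r) (t + r), (fun s : ℝ => γ s) '' Icc (t + r) (t + (1 - r)),
      isCompact_Icc.image hcc, isPreconnected_Icc.image _ hcc.continuousOn,
      isCompact_Icc.image hcc, isPreconnected_Icc.image _ hcc.continuousOn, ?_,
      ⟨t, ⟨by linarith, by linarith⟩, rfl⟩, ?_, ?_⟩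
    · refine Subset.antisymm ?_ ?_
      · rintro _ (⟨s, -, rfl⟩ | ⟨s, -, rfl⟩) <;> exact mem_range_self _
      · rintro _ ⟨s, rfl⟩
        obtain ⟨s, hs, rfl⟩ := AddCircle.exists_coe_eq (t - r) s
        rcases le_total s (t + r) with h | h
        · exact .inl ⟨s, ⟨hs.1, h⟩, rfl⟩
        · exact .inr ⟨s, ⟨h, by linarith [hs.2]⟩, rfl⟩
    · rintro _ ⟨s, hs, rfl⟩
      refine hu s ⟨by linarith [hs.1, ht.1], by linarith [hs.2, ht.2]⟩ t
        ⟨by linarith [ht.1], by linarith [ht.2]⟩ ?_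
      rw [Real.dist_eq, abs_lt]; constructor <;> linarith [hs.1, hs.2]
    · rw [Set.disjoint_left]
      rintro _ ⟨s, hs, rfl⟩ hb
      have h3 := hmin (a := (t, s - t)) ⟨⟨ht.1, ht.2.le⟩, by linarith [hs.1], by linarith [hs.2]⟩
      simp only [mem_ofPred_eq, add_sub_cancel] at h3
      exact (Metric.mem_ball.1 hb).not_ge h3

/-- The complementary domains of a simple closed curve are uniformly locally connected. -/
theorem exists_local_connection {ε : ℝ} (hε : 0 < ε) : ∃ δ > 0, ∀ x ∈ range γ,
    ∀ u ∈ Metric.ball x δ, ∀ v ∈ Metric.ball x δ, NotSeparates (range γ) u v →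
      ∃ C : Set ℂ, IsPreconnected C ∧ C ⊆ (range γ)ᶜ ∧ C ⊆ Metric.ball x ε ∧ u ∈ C ∧ v ∈ C := by
  obtain ⟨δ, hδ, h⟩ := exists_local_subarc hc hi hε
  refine ⟨min δ ε, lt_min hδ hε, fun x hx u hu v hv huv => ?_⟩
  obtain ⟨s, c, hs, hsp, hcc, hcp, hsc, hxs, hsb, hcb⟩ := h x hx
  -- Apply Janiszewski's theorem to the curve and to this second compact set, which meets the curve
  -- exactly in the connected arc `c`. The set obtained avoids the circle about `x`, so it cannot
  -- leave the ball.
  have hL : NotSeparates (Metric.sphere x ε ∪ c) u v := by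
    refine ⟨Metric.ball x (min δ ε), ?_, (convex_ball _ _).isPreconnected, hu, hv⟩
    rintro z hz (h | h)
    · exact ((Metric.mem_ball.1 hz).trans_le (min_le_right _ _)).ne (Metric.mem_sphere.1 h)
    · exact disjoint_left.1 hcb h (Metric.ball_subset_ball (min_le_left _ _) hz)
  have hcap : range γ ∩ (Metric.sphere x ε ∪ c) = c := by
    refine Subset.antisymm ?_ fun z hz => ⟨hsc ▸ .inr hz, .inr hz⟩
    rintro z ⟨hz, h | h⟩
    · rw [← hsc] at hz
      exact hz.resolve_left fun h' => (Metric.mem_ball.1 (hsb h')).ne (Metric.mem_sphere.1 h)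
    · exact h
  obtain ⟨C, hC, hCp, huC, hvC⟩ := NotSeparates.union (isCompact_range_closedCurve hc)
    ((isCompact_sphere x ε).union hcc) (by rwa [hcap]) huv hL
  refine ⟨C, hCp, fun z hz h => hC hz (.inl h), fun z hz => ?_, huC, hvC⟩
  by_contra hzb
  have himg : IsPreconnected ((fun w => dist w x) '' C) := hCp.image _ (by fun_prop)
  have := himg.ordConnected.out ⟨u, huC, rfl⟩ ⟨z, hz, rfl⟩
    (a := ε) ⟨((Metric.mem_ball.1 hu).trans_le (min_le_right _ _)).le, not_lt.1 hzb⟩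
  obtain ⟨w, hw, hwε⟩ := this
  exact hC hw (.inr (.inl hwε))

end

end

section

open Complex Set Topology

/-! ### Logarithms on the bounded complementary domains of a simple closed curve -/

/-- Normalizing all logarithms to the same value at `x` makes them agree on connected sets
containing `x`, so they fit together on the union. -/
theorem HasLogOn.of_exhaustion {X : Type*} [TopologicalSpace X] {f : X → ℂ} {x : X}
    {V : ℕ → Set X} (hV : ∀ n, IsOpen (V n)) (hx : ∀ n, x ∈ V n) (hp : ∀ n, IsPreconnected (V n))
    (hm : Monotone V) (hl : ∀ n, HasLogOn f (V n)) : HasLogOn f (⋃ n, V n) := by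
  have h0 : f x ≠ 0 := (hl 0).ne_zero (hx 0)
  have h1 : ∀ n, ∃ g : X → ℂ, ContinuousOn g (V n) ∧ (∀ z ∈ V n, exp (g z) = f z) ∧
      g x = log (f x) := by
    intro n
    obtain ⟨g, hg, e⟩ := hl n
    refine ⟨fun z => g z + (log (f x) - g x), hg.add continuousOn_const, fun z hz => ?_, by ring⟩
    rw [exp_add, exp_sub, exp_log h0, e x (hx n), div_self h0, mul_one, e z hz]
  choose g hg e gx using h1
  have hgg : ∀ m n, m ≤ n → ∀ z ∈ V m, g n z = g m z := by
    intro m n hmn z hz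
    obtain ⟨k, hk⟩ := HasLogOn.eq_add_int_of_preconnected (hp m) ((hg n).mono (hm hmn)) (hg m)
      fun z hz => (e n z (hm hmn hz)).trans (e m z hz).symm
    have := hk x (hx m)
    rw [gx, gx, left_eq_add] at this
    rw [hk z hz, this, add_zero]
  have hex : ∀ z ∈ ⋃ n, V n, ∃ n, z ∈ V n := fun z hz => mem_iUnion.1 hz
  choose! N hN using hex
  have hG : ∀ n, ∀ z ∈ V n, g (N z) z = g n z := by
    intro n z hz
    have hz' := hN z (mem_iUnion.2 ⟨n, hz⟩)
    rcases le_total n (N z) with h | h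
    · exact hgg _ _ h z hz
    · exact (hgg _ _ h z hz').symm
  refine ⟨fun z => g (N z) z, ?_, fun z hz => e _ z (hN z hz)⟩
  refine continuousOn_of_forall_continuousAt fun z hz => ?_
  obtain ⟨n, hn⟩ := mem_iUnion.1 hz
  have : (fun z => g (N z) z) =ᶠ[𝓝 z] g n := by
    filter_upwards [(hV n).mem_nhds hn] with w hw using hG n w hw
  exact ((hg n).continuousAt ((hV n).mem_nhds hn)).congr this.symm

section

variable {γ : AddCircle (1 : ℝ) → ℂ} (hc : Continuous γ) (hi : Function.Injective γ)
include hc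

theorem isPreconnected_range_closedCurve : IsPreconnected (range γ) := by
  have : range γ = (fun s : ℝ => γ s) '' Icc 0 1 := by
    refine Subset.antisymm ?_ ?_
    · rintro _ ⟨s, rfl⟩
      obtain ⟨s, hs, rfl⟩ := AddCircle.exists_coe_eq 0 s
      exact ⟨s, ⟨hs.1, by linarith [hs.2]⟩, rfl⟩
    · rintro _ ⟨s, -, rfl⟩; exact mem_range_self _
  rw [this]
  exact isPreconnected_Icc.image _ (continuous_comp_coe hc).continuousOn

include hi

/-- The complement is the curve together with the closures of the other components. Each of these
closures is connected and contains the curve, by the frontier theorem. -/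
theorem isPreconnected_compl_component (x : ℂ) :
    IsPreconnected (connectedComponentIn (range γ)ᶜ x)ᶜ := by
  have hK := isCompact_range_closedCurve hc
  refine isPreconnected_of_forall (γ (0 : ℝ)) fun y hy => ?_
  by_cases hyJ : y ∈ range γ
  · exact ⟨range γ, fun z hz h => connectedComponentIn_subset _ _ h hz, mem_range_self _, hyJ,
      isPreconnected_range_closedCurve hc⟩
  · refine ⟨closure (connectedComponentIn (range γ)ᶜ y), ?_, ?_,
      subset_closure (mem_connectedComponentIn hyJ), isPreconnected_connectedComponentIn.closure⟩
    · have hd : Disjoint (connectedComponentIn (range γ)ᶜ y) (connectedComponentIn (range γ)ᶜ x) := by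
        refine disjoint_left.2 fun w hw hw' => hy ?_
        rw [connectedComponentIn_eq hw', ← connectedComponentIn_eq hw]
        exact mem_connectedComponentIn hyJ
      exact fun z hz hz' => disjoint_left.1
        (hd.closure_left hK.isClosed.isOpen_compl.connectedComponentIn) hz hz'
    · apply frontier_subset_closure
      rw [frontier_component_eq hc hi hyJ]
      exact mem_range_self _

/-- The points of `E` at distance at least `ε` from the curve form a compact set whose complement
has no bounded component, so Borsuk's theorem gives a logarithm there. The components of `x` in
slightly smaller open sets exhaust `E`. -/
theorem hasLogOn_component {x : ℂ} (hx : x ∉ range γ)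
    (hb : Bornology.IsBounded (connectedComponentIn (range γ)ᶜ x)) {f : ℂ → ℂ}
    (hf : ContinuousOn f (connectedComponentIn (range γ)ᶜ x))
    (h0 : ∀ z ∈ connectedComponentIn (range γ)ᶜ x, f z ≠ 0) :
    HasLogOn f (connectedComponentIn (range γ)ᶜ x) := by
  have hK := isCompact_range_closedCurve hc
  have hEo : IsOpen (connectedComponentIn (range γ)ᶜ x) :=
    hK.isClosed.isOpen_compl.connectedComponentIn
  have hfr := frontier_component_eq hc hi hx
  have hEc := isPreconnected_compl_component hc hi x
  have hxE : x ∈ connectedComponentIn (range γ)ᶜ x := mem_connectedComponentIn hx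
  have hEp : IsPreconnected (connectedComponentIn (range γ)ᶜ x) :=
    isPreconnected_connectedComponentIn
  generalize connectedComponentIn (range γ)ᶜ x = E at *
  have hJne : (range γ).Nonempty := range_nonempty _
  have hJE : ∀ z ∈ range γ, z ∉ E := fun z hz => by
    rw [← hfr, hEo.frontier_eq] at hz; exact hz.2
  have hpos : ∀ z ∈ E, 0 < Metric.infDist z (range γ) := fun z hz =>
    (hK.isClosed.notMem_iff_infDist_pos hJne).1 fun h => hJE z h hz
  have hcl : closure E ⊆ E ∪ range γ := fun z hz => by
    by_cases h : z ∈ E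
    · exact .inl h
    · exact .inr (by rw [← hfr, hEo.frontier_eq]; exact ⟨hz, h⟩)
  have hlogK : ∀ ε > 0, HasLogOn f {z | z ∈ E ∧ ε ≤ Metric.infDist z (range γ)} := by
    intro ε hε
    have hKe : {z | z ∈ E ∧ ε ≤ Metric.infDist z (range γ)} =
        closure E ∩ {z | ε ≤ Metric.infDist z (range γ)} := by
      ext z
      refine ⟨fun h => ⟨subset_closure h.1, h.2⟩, fun h => ⟨(hcl h.1).resolve_right fun h' => ?_, h.2⟩⟩
      have := h.2
      rw [mem_ofPred_eq, Metric.infDist_zero_of_mem h'] at this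
      linarith
    have hKc : IsCompact {z | z ∈ E ∧ ε ≤ Metric.infDist z (range γ)} := by
      rw [hKe]
      exact (hb.isCompact_closure).inter_right
        (isClosed_le continuous_const (Metric.continuous_infDist_pt _))
    refine HasLogOn.of_forall_not_isBounded hKc ?_ (hf.mono fun z hz => hz.1) fun z hz => h0 z hz.1
    intro a ha hab
    -- A point of `E` close to the curve reaches it along a segment on which the distance to the
    -- curve stays below `ε`. Outside `E`, the connected set `Eᶜ` leads to points arbitrarily far
    -- away.
    have hout : ∃ j ∉ E, NotSeparates {z | z ∈ E ∧ ε ≤ Metric.infDist z (range γ)} a j := by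
      by_cases haE : a ∈ E
      · have hlt : Metric.infDist a (range γ) < ε := by
          by_contra! h; exact ha ⟨haE, h⟩
        obtain ⟨j, hj, hjd⟩ := (Metric.infDist_lt_iff hJne).1 hlt
        refine ⟨j, hJE j hj, segment ℝ a j, ?_, (convex_segment a j).isPreconnected,
          left_mem_segment _ _ _, right_mem_segment _ _ _⟩
        rintro w hw ⟨-, hwe⟩
        have h1 : dist w j ≤ dist a j := by
          obtain ⟨s, t, hs, ht, hst, rfl⟩ := hw
          rw [dist_eq_norm, dist_eq_norm]
          have : s • a + t • j - j = s • (a - j) := by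
            rw [← eq_sub_iff_add_eq'] at hst; subst hst
            simp only [real_smul]; push_cast; ring
          rw [this, norm_smul, Real.norm_of_nonneg hs]
          exact mul_le_of_le_one_left (norm_nonneg _) (by linarith)
        linarith [Metric.infDist_le_dist_of_mem (x := w) hj]
      · exact ⟨a, haE, {a}, by simpa using ha, isPreconnected_singleton, rfl, rfl⟩
    obtain ⟨j, hjE, hj⟩ := hout
    obtain ⟨R, hR⟩ := (hb.union hab).subset_ball 0
    have hR' : ((|R| : ℝ) : ℂ) ∉ Metric.ball (0 : ℂ) R := by simp [le_abs_self]
    have h2 : NotSeparates {z | z ∈ E ∧ ε ≤ Metric.infDist z (range γ)} j ((|R| : ℝ) : ℂ) :=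
      ⟨Eᶜ, fun z hz h => hz h.1, hEc, hjE, fun h => hR' (hR (.inl h))⟩
    exact hR' (hR (.inr ((NotSeparates.iff_mem_connectedComponentIn ha).1 (hj.trans h2))))
  obtain ⟨ε, hε, hεx⟩ : ∃ ε > 0, ε < Metric.infDist x (range γ) :=
    ⟨_, half_pos (hpos x hxE), half_lt_self (hpos x hxE)⟩
  set U : ℕ → Set ℂ := fun n => {z | z ∈ E ∧ ε / (n + 1) < Metric.infDist z (range γ)} with hU
  have hUo : ∀ n, IsOpen (U n) := fun n =>
    hEo.inter (isOpen_lt continuous_const (Metric.continuous_infDist_pt _))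
  have hxU : ∀ n, x ∈ U n := fun n => ⟨hxE, lt_of_le_of_lt
    (div_le_self hε.le (by linarith [(Nat.cast_nonneg n : (0 : ℝ) ≤ n)])) hεx⟩
  have hUm : Monotone U := fun m n hmn z hz => by
    refine ⟨hz.1, lt_of_le_of_lt ?_ hz.2⟩
    have : (m : ℝ) ≤ n := by exact_mod_cast hmn
    gcongr
  have hfin := HasLogOn.of_exhaustion (f := f) (x := x) (V := fun n => connectedComponentIn (U n) x)
    (fun n => (hUo n).connectedComponentIn) (fun n => mem_connectedComponentIn (hxU n))
    (fun n => isPreconnected_connectedComponentIn)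
    (fun m n hmn => connectedComponentIn_mono _ (hUm hmn))
    (fun n => (hlogK (ε / (n + 1)) (by positivity)).mono fun z hz =>
      have := connectedComponentIn_subset _ _ hz; ⟨this.1, this.2.le⟩)
  refine hfin.mono fun z hz => ?_
  -- A path from `x` to `z` in `E` is compact, so it keeps a positive distance from the curve and
  -- lies in some `U n`.
  have hpath : IsPathConnected E := (hEo.isConnected_iff_isPathConnected).1 ⟨⟨x, hxE⟩, hEp⟩
  obtain ⟨p, hp⟩ := hpath.joinedIn x hxE z hz
  obtain ⟨w, ⟨t, rfl⟩, hw⟩ := (isCompact_range p.continuous).exists_isMinOn (range_nonempty _)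
    (Metric.continuous_infDist_pt (range γ)).continuousOn
  obtain ⟨n, hn⟩ := exists_nat_gt (ε / Metric.infDist (p t) (range γ))
  have hpt := hpos _ (hp t)
  rw [div_lt_iff₀ hpt] at hn
  refine mem_iUnion.2 ⟨n, ?_⟩
  refine (isPreconnected_range p.continuous).subset_connectedComponentIn ⟨0, p.source⟩ ?_
    ⟨1, p.target⟩
  rintro _ ⟨s, rfl⟩
  refine ⟨hp s, lt_of_lt_of_le ?_ (hw (mem_range_self s))⟩
  rw [div_lt_iff₀ (by positivity)]
  nlinarith

end

end

section

open Complex Set Topology Filter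

/-! ### The Riemann mapping theorem -/

theorem HasDerivAt.of_sq_eq {s g : ℂ → ℂ} {g' z : ℂ} (hg : HasDerivAt g g' z)
    (hs : ContinuousAt s z) (e : ∀ᶠ w in 𝓝 z, s w ^ 2 = g w) (h0 : s z ≠ 0) :
    HasDerivAt s (g' / (2 * s z)) z := by
  rw [hasDerivAt_iff_tendsto_slope] at hg ⊢
  have h1 : Tendsto (fun w => s w + s z) (𝓝[≠] z) (𝓝 (2 * s z)) := by
    rw [two_mul]
    exact (hs.tendsto.mono_left nhdsWithin_le_nhds).add_const _
  refine (hg.div h1 (mul_ne_zero two_ne_zero h0)).congr' ?_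
  filter_upwards [nhdsWithin_le_nhds e, h1.eventually_ne (mul_ne_zero two_ne_zero h0),
    self_mem_nhdsWithin] with w hw hne hwz
  have hwz' : w - z ≠ 0 := sub_ne_zero.2 hwz
  rw [Pi.div_apply, slope_def_field, slope_def_field, ← hw, ← e.self_of_nhds]
  field_simp
  ring

/-- The automorphism of the unit disc that maps `w` to `0`. -/
noncomputable def discShift (w ξ : ℂ) : ℂ := (ξ - w) / (1 - starRingEnd ℂ w * ξ)

section discShift

variable {w ξ : ℂ} (hw : ‖w‖ < 1) (hξ : ‖ξ‖ < 1)
include hw hξ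

theorem discShift_denom_ne_zero : 1 - starRingEnd ℂ w * ξ ≠ 0 := by
  intro h
  have h1 : ‖starRingEnd ℂ w * ξ‖ < 1 := by
    rw [norm_mul, RCLike.norm_conj]
    nlinarith [norm_nonneg w, norm_nonneg ξ]
  rw [← sub_eq_zero.1 h, norm_one] at h1
  exact lt_irrefl _ h1

theorem norm_discShift_lt_one : ‖discShift w ξ‖ < 1 := by
  have h0 := discShift_denom_ne_zero hw hξ
  rw [discShift, norm_div, div_lt_one (norm_pos_iff.2 h0)]
  refine lt_of_pow_lt_pow_left₀ 2 (norm_nonneg _) ?_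
  have h1 : ‖w‖ ^ 2 < 1 := by nlinarith [norm_nonneg w]
  have h2 : ‖ξ‖ ^ 2 < 1 := by nlinarith [norm_nonneg ξ]
  rw [← normSq_eq_norm_sq] at *
  rw [← normSq_eq_norm_sq] at *
  rw [normSq_apply] at *
  rw [normSq_apply] at *
  simp only [sub_re, sub_im, one_re, one_im, mul_re, mul_im, conj_re, conj_im] at *
  nlinarith [mul_pos (sub_pos.2 h1) (sub_pos.2 h2)]

theorem hasDerivAt_discShift :
    HasDerivAt (discShift w) ((1 - ‖w‖ ^ 2) / (1 - starRingEnd ℂ w * ξ) ^ 2) ξ := by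
  have h0 := discShift_denom_ne_zero hw hξ
  have h1 : HasDerivAt (fun ξ => (ξ - w) / (1 - starRingEnd ℂ w * ξ)) _ ξ :=
    ((hasDerivAt_id ξ).sub_const w).div
      (((hasDerivAt_id ξ).const_mul (starRingEnd ℂ w)).const_sub 1) h0
  refine h1.congr_deriv ?_
  congr 1
  have : ((‖w‖ : ℂ)) ^ 2 = starRingEnd ℂ w * w := by rw [← conj_mul']
  rw [this]
  simp only [id]
  ring

theorem discShift_injOn_aux {ζ : ℂ} (hζ : ‖ζ‖ < 1) (h : discShift w ξ = discShift w ζ) : ξ = ζ := by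
  rw [discShift, discShift, div_eq_div_iff (discShift_denom_ne_zero hw hξ)
    (discShift_denom_ne_zero hw hζ)] at h
  have h1 : (1 - starRingEnd ℂ w * w) * (ξ - ζ) = 0 := by linear_combination h
  have h2 : 1 - starRingEnd ℂ w * w ≠ 0 := discShift_denom_ne_zero hw hw
  exact sub_eq_zero.1 ((mul_eq_zero.1 h1).resolve_left h2)

theorem discShift_ne_zero (h : ξ ≠ w) : discShift w ξ ≠ 0 :=
  div_ne_zero (sub_ne_zero.2 h) (discShift_denom_ne_zero hw hξ)

end discShift

theorem discShift_self (w : ℂ) : discShift w w = 0 := by simp [discShift]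

/-- A holomorphic injection to the unit disc that omits a value can be replaced by one with a
larger derivative at the base point. -/
theorem exists_larger_deriv {U : Set ℂ} (hU : IsOpen U) {z₀ : ℂ} (hz₀ : z₀ ∈ U)
    (hlog : ∀ f : ℂ → ℂ, ContinuousOn f U → (∀ z ∈ U, f z ≠ 0) → HasLogOn f U)
    {f : ℂ → ℂ} (hf : DifferentiableOn ℂ f U) (hi : InjOn f U) (hm : ∀ z ∈ U, ‖f z‖ < 1)
    (h0 : f z₀ = 0) (hd : deriv f z₀ ≠ 0) {w : ℂ} (hw : ‖w‖ < 1) (hwf : ∀ z ∈ U, f z ≠ w) :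
    ∃ F : ℂ → ℂ, DifferentiableOn ℂ F U ∧ InjOn F U ∧ (∀ z ∈ U, ‖F z‖ < 1) ∧ F z₀ = 0 ∧
      ‖deriv f z₀‖ < ‖deriv F z₀‖ := by
  have hfd : ∀ z ∈ U, HasDerivAt f (deriv f z) z := fun z hz =>
    (hf.differentiableAt (hU.mem_nhds hz)).hasDerivAt
  set g : ℂ → ℂ := fun z => discShift w (f z)
  have hg : ∀ z ∈ U, HasDerivAt g ((1 - ‖w‖ ^ 2) / (1 - starRingEnd ℂ w * f z) ^ 2 * deriv f z) z :=
    fun z hz => (hasDerivAt_discShift hw (hm z hz)).comp z (hfd z hz)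
  have hg0 : ∀ z ∈ U, g z ≠ 0 := fun z hz => discShift_ne_zero hw (hm z hz) (hwf z hz)
  obtain ⟨ℓ, hℓc, hℓ⟩ := hlog g (fun z hz => (hg z hz).continuousAt.continuousWithinAt) hg0
  -- Koebe's trick: shift the omitted value to zero, take a square root, and shift the base point
  -- back to zero.
  set s : ℂ → ℂ := fun z => exp (ℓ z / 2)
  have hs : ∀ z ∈ U, s z ^ 2 = g z := fun z hz => by
    rw [← exp_nat_mul, ← hℓ z hz]; congr 1; push_cast; ring
  have hs0 : ∀ z, s z ≠ 0 := fun z => exp_ne_zero _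
  have hsc : ∀ z ∈ U, ContinuousAt s z := fun z hz =>
    ((hℓc.continuousAt (hU.mem_nhds hz)).div_const 2).cexp
  have hsd : ∀ z ∈ U, HasDerivAt s _ z := fun z hz => (hg z hz).of_sq_eq (hsc z hz)
    (by filter_upwards [hU.mem_nhds hz] with w hw using hs w hw) (hs0 z)
  have hs1 : ∀ z ∈ U, ‖s z‖ < 1 := fun z hz => by
    have h1 : ‖s z‖ ^ 2 < 1 := by
      rw [← norm_pow, hs z hz]; exact norm_discShift_lt_one hw (hm z hz)
    exact (pow_lt_one_iff_of_nonneg (norm_nonneg _) two_ne_zero).1 h1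
  have hF : ∀ z ∈ U, HasDerivAt (fun z => discShift (s z₀) (s z)) _ z := fun z hz =>
    (hasDerivAt_discShift (hs1 z₀ hz₀) (hs1 z hz)).comp z (hsd z hz)
  refine ⟨fun z => discShift (s z₀) (s z),
    fun z hz => (hF z hz).differentiableAt.differentiableWithinAt, fun x hx y hy hxy => ?_,
    fun z hz => norm_discShift_lt_one (hs1 z₀ hz₀) (hs1 z hz), discShift_self _, ?_⟩
  · have h1 := discShift_injOn_aux (hs1 z₀ hz₀) (hs1 x hx) (hs1 y hy) hxy
    have h2 : g x = g y := by rw [← hs x hx, ← hs y hy, h1]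
    exact hi hx hy (discShift_injOn_aux hw (hm x hx) (hm y hy) h2)
  · rw [(hF z₀ hz₀).deriv, h0, mul_zero, sub_zero, one_pow, div_one]
    set σ := ‖s z₀‖ with hσ
    have hσ0 : 0 < σ := norm_pos_iff.2 (hs0 z₀)
    have hσ1 : σ < 1 := hs1 z₀ hz₀
    -- At the base point `g` equals `-w`, and `s` is its square root.
    have hwσ : ‖w‖ = σ ^ 2 := by
      rw [hσ, ← norm_pow, hs z₀ hz₀]
      simp [g, discShift, h0]
    have e1 : 1 - starRingEnd ℂ (s z₀) * s z₀ = ((1 - σ ^ 2 : ℝ) : ℂ) := by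
      rw [conj_mul']; push_cast; rw [hσ]
    have hσ2 : 0 < 1 - σ ^ 2 := by nlinarith
    rw [e1, hwσ]
    have e2 : (1 - (σ : ℂ) ^ 2) = ((1 - σ ^ 2 : ℝ) : ℂ) := by push_cast; ring
    have e3 : (1 - ((σ ^ 2 : ℝ) : ℂ) ^ 2) = ((1 - σ ^ 4 : ℝ) : ℂ) := by push_cast; ring
    have hσ4 : 0 < 1 - σ ^ 4 := by nlinarith [sq_nonneg σ]
    rw [e2, e3]
    simp only [norm_mul, norm_div, norm_pow, norm_real, Real.norm_eq_abs, abs_of_pos hσ2,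
      abs_of_pos hσ4, RCLike.norm_ofNat, ← hσ]
    have hdp : 0 < ‖deriv f z₀‖ := norm_pos_iff.2 hd
    have key : (1 - σ ^ 2) / (1 - σ ^ 2) ^ 2 * ((1 - σ ^ 4) * ‖deriv f z₀‖ / (2 * σ)) =
        (1 + σ ^ 2) / (2 * σ) * ‖deriv f z₀‖ := by
      field_simp
      ring
    rw [key]
    -- The derivative grows by `(1 + σ²) / (2σ)`, which exceeds 1 because `(1 - σ)² > 0`.
    refine lt_mul_of_one_lt_left hdp ?_
    rw [one_lt_div (by positivity)]
    nlinarith [sq_pos_of_pos (sub_pos.2 hσ1)]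

/-- Hurwitz's theorem: values of a nonconstant limit are nearby values of the approximants. -/
theorem eventually_mem_image_closedBall {ι : Type*} {l : Filter ι} {F : ι → ℂ → ℂ} {f : ℂ → ℂ}
    {U : Set ℂ} (hU : IsOpen U) (hF : ∀ n, DifferentiableOn ℂ (F n) U)
    (hFi : ∀ n, InjOn (F n) U)
    (hlim : TendstoLocallyUniformlyOn F f l U) {a : ℂ} {r : ℝ} (hr : 0 < r)
    (hrU : Metric.closedBall a r ⊆ U) (hf : ContinuousOn f U)
    (hne : ∀ z ∈ Metric.closedBall a r, z ≠ a → f z ≠ f a) :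
    ∀ᶠ n in l, f a ∈ F n '' Metric.closedBall a r := by
  have hsU : Metric.sphere a r ⊆ U := Metric.sphere_subset_closedBall.trans hrU
  obtain ⟨m, hm, hmin⟩ : ∃ m > 0, ∀ z ∈ Metric.sphere a r, m ≤ ‖f z - f a‖ := by
    obtain ⟨z, hz, hmin⟩ := (isCompact_sphere a r).exists_isMinOn
      (NormedSpace.sphere_nonempty.2 hr.le)
      ((hf.mono hsU).sub continuousOn_const).norm (f := fun z => ‖f z - f a‖)
    refine ⟨‖f z - f a‖, norm_pos_iff.2 (sub_ne_zero.2 ?_), fun w hw => hmin hw⟩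
    refine hne z (Metric.sphere_subset_closedBall hz) fun h => ?_
    rw [h, Metric.mem_sphere, dist_self] at hz
    exact hr.ne hz
  have hunif := (tendstoLocallyUniformlyOn_iff_forall_isCompact hU).1 hlim _ hrU
    (isCompact_closedBall a r)
  filter_upwards [Metric.tendstoUniformlyOn_iff.1 hunif (m / 4) (by positivity)] with n hn
  have ha := hn a (Metric.mem_closedBall_self hr.le)
  have hd : DiffContOnCl ℂ (F n) (Metric.ball a r) :=
    ((hF n).mono (closure_ball a hr.ne' ▸ hrU)).diffContOnCl
  refine hd.ball_subset_image_closedBall hr (ε := m / 2) (fun z hz => ?_) ?_ ?_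
  · have h1 := hn z (Metric.sphere_subset_closedBall hz)
    have h2 := hmin z hz
    rw [dist_eq] at ha h1
    have h3 : f z - f a = (f z - F n z) + (F n z - F n a) - (f a - F n a) := by ring
    have h4 : ‖f z - f a‖ ≤ ‖f z - F n z‖ + ‖F n z - F n a‖ + ‖f a - F n a‖ := by
      rw [h3]
      exact (norm_sub_le _ _).trans (add_le_add (norm_add_le _ _) le_rfl)
    linarith
  · have h1 : ∀ᶠ z in 𝓝[≠] a, F n z ≠ F n a := by
      filter_upwards [nhdsWithin_le_nhds (Metric.closedBall_mem_nhds a hr), self_mem_nhdsWithin]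
        with z hz hza e
      exact hza (hFi n (hrU hz) (hrU (Metric.mem_closedBall_self hr.le)) e)
    exact h1.frequently.filter_mono nhdsWithin_le_nhds
  · rw [Metric.mem_ball]; linarith

/-- Montel's theorem, along an ultrafilter. -/
theorem exists_tendstoLocallyUniformlyOn {ι : Type*} (l : Ultrafilter ι) {F : ι → ℂ → ℂ}
    {U : Set ℂ} (hU : IsOpen U) (hF : ∀ n, DifferentiableOn ℂ (F n) U)
    (hb : ∀ n, ∀ z ∈ U, ‖F n z‖ ≤ 1) :
    ∃ f : ℂ → ℂ, (∀ z ∈ U, ‖f z‖ ≤ 1) ∧ TendstoLocallyUniformlyOn F f l U := by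
  -- Along an ultrafilter pointwise limits exist by compactness of the closed disc, so no diagonal
  -- sequence is needed. Cauchy's estimate then gives a local Lipschitz bound common to all `F n`,
  -- which makes the convergence locally uniform.
  have hpt : ∀ z ∈ U, ∃ y, ‖y‖ ≤ 1 ∧ Tendsto (fun n => F n z) l (𝓝 y) := by
    intro z hz
    obtain ⟨y, hy, hy'⟩ := (isCompact_closedBall (0 : ℂ) 1).ultrafilter_le_nhds
      (l.map fun n => F n z) (by
        rw [le_principal_iff]
        exact Filter.univ_mem' (f := (l : Filter ι)) (s := (fun n => F n z) ⁻¹' Metric.closedBall 0 1)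
          fun n => by simpa using hb n z hz)
    exact ⟨y, by simpa using hy, hy'⟩
  choose! f hf hlim using hpt
  refine ⟨f, hf, Metric.tendstoLocallyUniformlyOn_iff.2 fun ε hε z hz => ?_⟩
  obtain ⟨r, hr, hrU⟩ := Metric.nhds_basis_closedBall.mem_iff.1 (hU.mem_nhds hz)
  have hlip : ∀ n, ∀ w ∈ Metric.ball z (r / 2), ‖F n w - F n z‖ ≤ 2 / r * ‖w - z‖ := by
    intro n w hw
    refine (convex_ball z (r / 2)).norm_image_sub_le_of_norm_deriv_le (f := F n) (fun x hx => ?_)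
      (fun x hx => ?_) (Metric.mem_ball_self (by positivity)) hw
    · refine (hF n).differentiableAt (hU.mem_nhds (hrU ?_))
      exact Metric.ball_subset_closedBall (Metric.ball_subset_ball (by linarith) hx)
    · have hsub : Metric.closedBall x (r / 2) ⊆ U := by
        refine Subset.trans ?_ hrU
        refine Metric.closedBall_subset_closedBall' ?_
        rw [Metric.mem_ball] at hx; linarith
      have := norm_deriv_le_of_forall_mem_sphere_norm_le (f := F n) (c := x) (R := r / 2) (C := 1)
        (by positivity)
        (((hF n).mono (closure_ball x (by positivity : r / 2 ≠ 0) ▸ hsub)).diffContOnCl)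
        fun y hy => hb n y (hsub (Metric.sphere_subset_closedBall hy))
      refine this.trans_eq ?_
      field_simp
  set ρ := min (r / 2) (ε * r / 8) with hρ
  have hρ0 : 0 < ρ := by positivity
  refine ⟨Metric.ball z ρ, mem_nhdsWithin_of_mem_nhds (Metric.ball_mem_nhds z hρ0), ?_⟩
  filter_upwards [Metric.tendsto_nhds.1 (hlim z hz) (ε / 4) (by positivity)] with n hn w hw
  have hw2 : w ∈ Metric.ball z (r / 2) := Metric.ball_subset_ball (min_le_left _ _) hw
  have hwU : w ∈ U := hrU (Metric.ball_subset_closedBall (Metric.ball_subset_ball (by linarith) hw2))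
  have hwd : 2 / r * ‖w - z‖ ≤ ε / 4 := by
    have h1 : ‖w - z‖ ≤ ε * r / 8 := by
      rw [← dist_eq]; exact (Metric.mem_ball.1 hw).le.trans (min_le_right _ _)
    calc 2 / r * ‖w - z‖ ≤ 2 / r * (ε * r / 8) := by gcongr
      _ = ε / 4 := by field_simp; ring
  have h1 := (hlip n w hw2).trans hwd
  have h2 : ‖f w - f z‖ ≤ ε / 4 :=
    le_of_tendsto ((hlim w hwU).sub (hlim z hz)).norm
      (Eventually.of_forall fun n => (hlip n w hw2).trans hwd)
  rw [dist_eq] at hn ⊢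
  have h3 : f w - F n w = (f w - f z) - (F n z - f z) - (F n w - F n z) := by ring
  rw [h3]
  calc _ ≤ ‖f w - f z‖ + ‖F n z - f z‖ + ‖F n w - F n z‖ :=
        (norm_sub_le _ _).trans (add_le_add (norm_sub_le _ _) le_rfl)
    _ < ε := by linarith

/-- The Riemann mapping theorem for bounded domains on which nonvanishing continuous functions
have logarithms. -/
theorem exists_riemann_map {U : Set ℂ} (hU : IsOpen U) (hUp : IsPreconnected U)
    (hUb : Bornology.IsBounded U) {z₀ : ℂ} (hz₀ : z₀ ∈ U)
    (hlog : ∀ f : ℂ → ℂ, ContinuousOn f U → (∀ z ∈ U, f z ≠ 0) → HasLogOn f U) :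
    ∃ f : ℂ → ℂ, DifferentiableOn ℂ f U ∧ InjOn f U ∧ f '' U = Metric.ball 0 1 := by
  set 𝓕 : Set (ℂ → ℂ) := {f | DifferentiableOn ℂ f U ∧ InjOn f U ∧ (∀ z ∈ U, ‖f z‖ < 1) ∧ f z₀ = 0}
  set S : Set ℝ := (fun f => ‖deriv f z₀‖) '' 𝓕 with hS
  obtain ⟨r, hr, hrU⟩ := Metric.nhds_basis_closedBall.mem_iff.1 (hU.mem_nhds hz₀)
  have hSb : BddAbove S := by
    refine ⟨1 / r, ?_⟩
    rintro _ ⟨f, hf, rfl⟩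
    exact norm_deriv_le_of_forall_mem_sphere_norm_le hr
      ((hf.1.mono (closure_ball z₀ hr.ne' ▸ hrU)).diffContOnCl)
      fun y hy => (hf.2.2.1 y (hrU (Metric.sphere_subset_closedBall hy))).le
  obtain ⟨R, hR⟩ := hUb.subset_ball z₀
  have hR0 : 0 < R := by simpa using! Metric.nonempty_ball.1 ⟨z₀, hR hz₀⟩
  have h𝓕 : (fun z => (z - z₀) / R) ∈ 𝓕 := by
    refine ⟨by fun_prop, fun x hx y hy e => ?_, fun z hz => ?_, by simp⟩
    · have : (R : ℂ) ≠ 0 := ofReal_ne_zero.2 hR0.ne'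
      field_simp at e
      exact sub_left_injective e
    · rw [norm_div, norm_real, Real.norm_of_nonneg hR0.le, div_lt_one hR0, ← dist_eq]
      exact hR hz
  have hSpos : ∃ c ∈ S, 0 < c := by
    refine ⟨_, ⟨_, h𝓕, rfl⟩, ?_⟩
    have : HasDerivAt (fun z => (z - z₀) / (R : ℂ)) (1 / R) z₀ :=
      ((hasDerivAt_id z₀).sub_const z₀).div_const _
    beta_reduce
    rw [this.deriv, norm_pos_iff]
    exact one_div_ne_zero (ofReal_ne_zero.2 hR0.ne')
  obtain ⟨c, hcS, hc⟩ := hSpos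
  obtain ⟨u, -, hu, huS⟩ := exists_seq_tendsto_sSup ⟨c, hcS⟩ hSb
  choose F hF hFu using huS
  set l : Ultrafilter ℕ := Ultrafilter.of atTop
  have hl : (l : Filter ℕ) ≤ atTop := Ultrafilter.of_le _
  obtain ⟨f, hfb, hlim⟩ := exists_tendstoLocallyUniformlyOn l hU (fun n => (hF n).1)
    fun n z hz => ((hF n).2.2.1 z hz).le
  have hFd : ∀ᶠ n in (l : Filter ℕ), DifferentiableOn ℂ (F n) U := Eventually.of_forall fun n => (hF n).1
  have hfd : DifferentiableOn ℂ f U := hlim.differentiableOn hFd hU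
  have hder : ‖deriv f z₀‖ = sSup S := by
    have h1 : Tendsto (fun n => ‖deriv (F n) z₀‖) l (𝓝 ‖deriv f z₀‖) :=
      ((hlim.deriv hFd hU).tendsto_at hz₀).norm
    have h2 : Tendsto (fun n => ‖deriv (F n) z₀‖) l (𝓝 (sSup S)) := by
      simpa only [hFu] using hu.mono_left hl
    exact tendsto_nhds_unique h1 h2
  have hd0 : deriv f z₀ ≠ 0 := norm_pos_iff.1 (hder ▸ hc.trans_le (le_csSup hSb hcS))
  have hf0 : f z₀ = 0 := by
    have h1 := hlim.tendsto_at hz₀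
    simp only [(hF _).2.2.2] at h1
    exact (tendsto_nhds_unique h1 tendsto_const_nhds)
  have hfa : AnalyticOnNhd ℂ f U := hfd.analyticOnNhd hU
  have hnc : ∀ a ∈ U, ∀ᶠ z in 𝓝[≠] a, f z ≠ f a := by
    intro a ha
    refine ((hfa a ha).eventually_eq_or_eventually_ne analyticAt_const).resolve_left fun h => ?_
    have h1 : EqOn f (fun _ => f a) U :=
      hfa.eqOn_of_preconnected_of_eventuallyEq analyticOnNhd_const hUp ha h
    apply hd0
    rw [(eventuallyEq_of_mem (hU.mem_nhds hz₀) h1).deriv_eq]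
    simp
  have hlt : ∀ z ∈ U, ‖f z‖ < 1 := by
    intro z hz
    refine (hfb z hz).lt_of_ne fun h => ?_
    have h1 := Complex.eqOn_of_isPreconnected_of_isMaxOn_norm hUp hU hfd hz
      (fun w hw => by simpa [h] using hfb w hw)
    have h2 := h1 hz₀
    rw [hf0, Function.const_apply] at h2
    rw [← h2, norm_zero] at h
    exact zero_ne_one h
  -- If `f a = f b`, Hurwitz's theorem makes some `F n` take this value in disjoint balls around `a`
  -- and `b`, against its injectivity.
  have hinj : InjOn f U := by
    intro a ha b hb hab
    by_contra hne
    have hball : ∀ x ∈ U, ∃ r > 0, r < dist a b / 2 ∧ Metric.closedBall x r ⊆ U ∧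
        ∀ z ∈ Metric.closedBall x r, z ≠ x → f z ≠ f x := by
      intro x hx
      have h1 : ∀ᶠ z in 𝓝 x, z ∈ U ∧ (z ≠ x → f z ≠ f x) :=
        (hU.eventually_mem hx).and (eventually_nhdsWithin_iff.1 (hnc x hx))
      obtain ⟨r, hr, hr'⟩ := Metric.nhds_basis_closedBall.mem_iff.1 h1
      have hab' : 0 < dist a b := dist_pos.2 hne
      refine ⟨min r (dist a b / 4), by positivity, (min_le_right _ _).trans_lt (by linarith), ?_, ?_⟩
      · exact fun z hz => (hr' (Metric.closedBall_subset_closedBall (min_le_left _ _) hz)).1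
      · exact fun z hz => (hr' (Metric.closedBall_subset_closedBall (min_le_left _ _) hz)).2
    obtain ⟨r, hr, hr1, hr2, hr3⟩ := hball a ha
    obtain ⟨r', hr', hr1', hr2', hr3'⟩ := hball b hb
    obtain ⟨n, ⟨x, hx, hxe⟩, ⟨y, hy, hye⟩⟩ := ((eventually_mem_image_closedBall hU
      (fun n => (hF n).1) (fun n => (hF n).2.1) hlim hr hr2 hfd.continuousOn hr3).and
      (eventually_mem_image_closedBall hU
      (fun n => (hF n).1) (fun n => (hF n).2.1) hlim hr' hr2' hfd.continuousOn hr3')).exists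
    have hxy : x = y := (hF n).2.1 (hr2 hx) (hr2' hy) (by rw [hxe, hye, hab])
    subst hxy
    rw [Metric.mem_closedBall] at hx hy
    have := dist_triangle_left a b x
    linarith
  refine ⟨f, hfd, hinj, Subset.antisymm ?_ ?_⟩
  · rintro _ ⟨z, hz, rfl⟩
    simpa using hlt z hz
  · intro w hw
    -- An omitted value would allow a larger derivative than the supremum attained by `f`.
    by_contra hwf
    obtain ⟨G, hG1, hG2, hG3, hG4, hG5⟩ := exists_larger_deriv hU hz₀ hlog hfd hinj hlt hf0 hd0
      (w := w) (by simpa using hw) fun z hz e => hwf ⟨z, hz, e⟩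
    rw [hder] at hG5
    exact hG5.not_ge (le_csSup hSb ⟨G, ⟨hG1, hG2, hG3, hG4⟩, rfl⟩)

end

section

open Complex Set Topology Filter

/-! ### The length-area estimate -/

open MeasureTheory in
-- The Jacobian of multiplication by `c` is `‖c‖ ^ 2`, so this is the change of variables formula:
-- the integral is the area of the image.
theorem Complex.lintegral_norm_deriv_sq {ψ : ℂ → ℂ} {W : Set ℂ} (hW : IsOpen W)
    (hd : DifferentiableOn ℂ ψ W) (hi : InjOn ψ W) :
    ∫⁻ w in W, ENNReal.ofReal (‖deriv ψ w‖ ^ 2) = volume (ψ '' W) := by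
  have hdet : ∀ c : ℂ, |(c • (1 : ℂ →L[ℝ] ℂ)).det| = ‖c‖ ^ 2 := by
    intro c
    have h1 : (c • (1 : ℂ →L[ℝ] ℂ)).det = Algebra.norm ℝ c := by
      rw [Algebra.norm_apply, ContinuousLinearMap.det]
      congr 1
    rw [h1, Algebra.norm_complex_apply, normSq_eq_norm_sq, abs_of_nonneg (sq_nonneg _)]
  rw [← lintegral_abs_det_fderiv_eq_addHaar_image volume hW.measurableSet
    (f' := fun w => deriv ψ w • (1 : ℂ →L[ℝ] ℂ)) (fun w hw =>
      ((hd.differentiableAt (hW.mem_nhds hw)).hasDerivAt.complexToReal_fderiv).hasFDerivWithinAt) hi]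
  simp only [hdet]

/-- The disc is placed so that the boundary point under study is the origin. A circle around it
meets the disc in a single arc, described by one inequality on the angle. -/
theorem polar_mem_ball_one_iff {r θ : ℝ} (hr : 0 < r) :
    (r : ℂ) * exp (θ * I) ∈ Metric.ball (1 : ℂ) 1 ↔ r < 2 * Real.cos θ := by
  rw [mem_ball_iff_norm, ← sq_lt_one_iff₀ (norm_nonneg _), ← normSq_eq_norm_sq, normSq_apply]
  have h1 : ((r : ℂ) * exp (θ * I) - 1).re = r * Real.cos θ - 1 := by
    simp [exp_ofReal_mul_I_re]
  have h2 : ((r : ℂ) * exp (θ * I) - 1).im = r * Real.sin θ := by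
    simp [exp_ofReal_mul_I_im]
  rw [h1, h2]
  have : (r * Real.cos θ - 1) * (r * Real.cos θ - 1) + r * Real.sin θ * (r * Real.sin θ) =
      r * (r - 2 * Real.cos θ) + 1 := by
    linear_combination r ^ 2 * Real.sin_sq_add_cos_sq θ
  rw [this]
  constructor
  · intro h
    by_contra! h'
    nlinarith [mul_nonneg hr.le (sub_nonneg.2 h')]
  · intro h
    nlinarith [mul_pos hr (sub_pos.2 h)]

open MeasureTheory in
/-- On a circle of radius `r` around `0`, the oscillation of `ψ` is controlled by the integral of
the square of its derivative. -/
theorem length_area_estimate {ψ : ℂ → ℂ} (hd : DifferentiableOn ℂ ψ (Metric.ball 1 1)) {r ε : ℝ}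
    (hr : 0 < r) (hε : 0 < ε) {w w' : ℂ} (hw : w ∈ Metric.ball (1 : ℂ) 1) (hwr : ‖w‖ = r)
    (hw' : w' ∈ Metric.ball (1 : ℂ) 1) (hwr' : ‖w'‖ = r) (h : ε < dist (ψ w) (ψ w')) :
    ENNReal.ofReal (ε ^ 2 / (Real.pi * r)) ≤ ENNReal.ofReal r * ∫⁻ θ in Ioo (-Real.pi) Real.pi,
      (Metric.ball (1 : ℂ) 1).indicator (fun w => ENNReal.ofReal (‖deriv ψ w‖ ^ 2))
        (r * exp (θ * I)) := by
  wlog hle : arg w ≤ arg w' generalizing w w'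
  · exact this hw' hwr' hw hwr (by rwa [dist_comm]) (le_of_not_ge hle)
  have hre : ∀ w : ℂ, w ∈ Metric.ball (1 : ℂ) 1 → 0 < w.re := fun w hw => by
    rw [mem_ball_iff_norm, ← sq_lt_one_iff₀ (norm_nonneg _), ← normSq_eq_norm_sq, normSq_apply,
      sub_re, one_re] at hw
    nlinarith [mul_self_nonneg w.re, mul_self_nonneg (w - 1).im]
  have harg : ∀ w : ℂ, w ∈ Metric.ball (1 : ℂ) 1 → |arg w| < Real.pi / 2 := fun w hw =>
    abs_arg_lt_pi_div_two_iff.2 (.inl (hre w hw))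
  have hpolar : ∀ w : ℂ, ‖w‖ = r → (r : ℂ) * exp (arg w * I) = w := fun w hw => by
    rw [← hw, norm_mul_exp_arg_mul_I]
  have hcos : ∀ w : ℂ, w ∈ Metric.ball (1 : ℂ) 1 → ‖w‖ = r → r < 2 * Real.cos (arg w) :=
    fun w hw hwr => (polar_mem_ball_one_iff hr).1 (by rwa [hpolar w hwr])
  have hmem : ∀ θ ∈ Icc (arg w) (arg w'), (r : ℂ) * exp (θ * I) ∈ Metric.ball (1 : ℂ) 1 := by
    intro θ hθ
    rw [polar_mem_ball_one_iff hr, ← Real.cos_abs]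
    have h1 : |θ| ≤ max |arg w| |arg w'| := by
      rw [abs_le]
      have := neg_abs_le (arg w)
      have := le_abs_self (arg w')
      constructor
      · linarith [le_max_left |arg w| |arg w'|, hθ.1]
      · linarith [le_max_right |arg w| |arg w'|, hθ.2]
    have hpi := Real.pi_pos
    rcases le_max_iff.1 h1 with h1 | h1
    · have := hcos w hw hwr
      rw [← Real.cos_abs] at this
      exact this.trans_le (by
        gcongr; exact Real.cos_le_cos_of_nonneg_of_le_pi (abs_nonneg _)
          (by linarith [harg w hw]) h1)
    · have := hcos w' hw' hwr'
      rw [← Real.cos_abs] at this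
      exact this.trans_le (by
        gcongr; exact Real.cos_le_cos_of_nonneg_of_le_pi (abs_nonneg _)
          (by linarith [harg w' hw']) h1)
  have hderc : ContinuousOn (deriv ψ) (Metric.ball 1 1) :=
    (hd.deriv Metric.isOpen_ball).continuousOn
  have hcirc : ∀ θ : ℝ, HasDerivAt (fun θ : ℝ => (r : ℂ) * exp (θ * I)) (r * (exp (θ * I) * I)) θ := by
    intro θ
    have : HasDerivAt (fun θ : ℂ => (r : ℂ) * exp (θ * I)) (r * (exp (θ * I) * (1 * I))) (θ : ℂ) :=
      (((hasDerivAt_id (θ : ℂ)).mul_const I).cexp).const_mul _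
    simpa using! this.comp_ofReal
  have hu : ∀ θ ∈ Icc (arg w) (arg w'), HasDerivAt (fun θ : ℝ => ψ (r * exp (θ * I)))
      (deriv ψ (r * exp (θ * I)) * (r * (exp (θ * I) * I))) θ := fun θ hθ =>
    (hd.differentiableAt (Metric.isOpen_ball.mem_nhds (hmem θ hθ))).hasDerivAt.comp θ (hcirc θ)
  have hcd : ContinuousOn (fun θ : ℝ => deriv ψ (r * exp (θ * I))) (Icc (arg w) (arg w')) :=
    hderc.comp (by fun_prop) hmem
  have hint : IntervalIntegrable
      (fun θ : ℝ => deriv ψ (r * exp (θ * I)) * (r * (exp (θ * I) * I))) volume (arg w) (arg w') := by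
    refine ContinuousOn.intervalIntegrable ?_
    rw [uIcc_of_le hle]
    exact hcd.mul (by fun_prop)
  have hftc := intervalIntegral.integral_eq_sub_of_hasDerivAt
    (fun θ hθ => hu θ (by rwa [uIcc_of_le hle] at hθ)) hint
  rw [hpolar w hwr, hpolar w' hwr'] at hftc
  have hsqint : IntervalIntegrable (fun θ : ℝ => ‖deriv ψ (r * exp (θ * I))‖ ^ 2) volume
      (arg w) (arg w') := by
    refine ContinuousOn.intervalIntegrable ?_
    rw [uIcc_of_le hle]
    exact hcd.norm.pow 2
  have hpi := Real.pi_pos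
  set Q := ∫ θ in arg w..arg w', ‖deriv ψ (r * exp (θ * I))‖ ^ 2 with hQ
  -- In place of Cauchy–Schwarz, the integrand is bounded by a weighted arithmetic-geometric mean.
  -- The weights make the constant term contribute at most `ε / 2`, as the arc spans an angle of at
  -- most `π`; the other half of `ε` is left for `Q`.
  have hbound : ε ≤ Real.pi / (2 * ε) * r ^ 2 * Q + Real.pi * (ε / (2 * Real.pi)) := by
    calc ε ≤ ‖ψ w' - ψ w‖ := by rw [dist_comm, dist_eq] at h; exact h.le
      _ ≤ ∫ θ in arg w..arg w', ‖deriv ψ (r * exp (θ * I)) * (r * (exp (θ * I) * I))‖ := by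
        rw [← hftc]; exact intervalIntegral.norm_integral_le_integral_norm hle
      _ ≤ ∫ θ in arg w..arg w', (Real.pi / (2 * ε) * r ^ 2 * ‖deriv ψ (r * exp (θ * I))‖ ^ 2 +
            ε / (2 * Real.pi)) := by
        refine intervalIntegral.integral_mono_on hle hint.norm
          ((hsqint.const_mul _).add intervalIntegrable_const) fun θ _ => ?_
        rw [norm_mul, norm_mul, norm_mul, norm_exp_ofReal_mul_I, norm_I, norm_real,
          Real.norm_of_nonneg hr.le]
        set D := ‖deriv ψ (r * exp (θ * I))‖
        have : 0 ≤ Real.pi / (2 * ε) * (r * D - ε / Real.pi) ^ 2 := by positivity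
        have e : Real.pi / (2 * ε) * (r * D - ε / Real.pi) ^ 2 =
          Real.pi / (2 * ε) * r ^ 2 * D ^ 2 + ε / (2 * Real.pi) - D * (r * (1 * 1)) := by
          field_simp; ring
        linarith
      _ = Real.pi / (2 * ε) * r ^ 2 * Q + (arg w' - arg w) * (ε / (2 * Real.pi)) := by
        rw [intervalIntegral.integral_add (hsqint.const_mul _) intervalIntegrable_const,
          intervalIntegral.integral_const_mul, intervalIntegral.integral_const, smul_eq_mul]
      _ ≤ _ := by
        gcongr
        have h1 := abs_lt.1 (harg w hw)
        have h2 := abs_lt.1 (harg w' hw')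
        linarith
  have hQ' : ε ^ 2 / (Real.pi * r) ≤ r * Q := by
    have h1 : Real.pi * (ε / (2 * Real.pi)) = ε / 2 := by field_simp
    rw [h1] at hbound
    rw [div_le_iff₀ (by positivity)]
    have h2 : ε / 2 ≤ Real.pi / (2 * ε) * r ^ 2 * Q := by linarith
    have h3 := mul_le_mul_of_nonneg_left h2 (by positivity : 0 ≤ 2 * ε)
    have h4 : 2 * ε * (Real.pi / (2 * ε) * r ^ 2 * Q) = r * Q * (Real.pi * r) := by field_simp
    nlinarith
  have hQl : ENNReal.ofReal Q ≤ ∫⁻ θ in Ioo (-Real.pi) Real.pi,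
      (Metric.ball (1 : ℂ) 1).indicator (fun w => ENNReal.ofReal (‖deriv ψ w‖ ^ 2))
        (r * exp (θ * I)) := by
    rw [hQ, intervalIntegral.integral_of_le hle, ofReal_integral_eq_lintegral_ofReal]
    · have hsub : Ioc (arg w) (arg w') ⊆ Ioo (-Real.pi) Real.pi := by
        have h1 := abs_lt.1 (harg w hw)
        have h2 := abs_lt.1 (harg w' hw')
        exact fun θ hθ => ⟨by linarith [hθ.1], by linarith [hθ.2]⟩
      refine le_trans (setLIntegral_mono' measurableSet_Ioc fun θ hθ => ?_)
        (lintegral_mono_set hsub)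
      rw [indicator_of_mem (hmem θ ⟨hθ.1.le, hθ.2⟩)]
    · exact (intervalIntegrable_iff_integrableOn_Ioc_of_le hle).1 hsqint
    · exact Eventually.of_forall fun θ => by positivity
  calc ENNReal.ofReal (ε ^ 2 / (Real.pi * r)) ≤ ENNReal.ofReal (r * Q) := ENNReal.ofReal_le_ofReal hQ'
    _ = ENNReal.ofReal r * ENNReal.ofReal Q := ENNReal.ofReal_mul hr.le
    _ ≤ _ := by gcongr

open MeasureTheory in
-- If the oscillation exceeded `ε` on every circle of radius `r < ρ`, integrating the length-area
-- estimate over `r` would bound the finite area of the image below by a multiple of the divergent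
-- integral of `1 / r`.
theorem exists_small_arc_one {ψ : ℂ → ℂ} (hd : DifferentiableOn ℂ ψ (Metric.ball 1 1))
    (hi : InjOn ψ (Metric.ball 1 1)) (hb : Bornology.IsBounded (ψ '' Metric.ball 1 1))
    {ε ρ : ℝ} (hε : 0 < ε) (hρ : 0 < ρ) :
    ∃ r, 0 < r ∧ r < ρ ∧ ∀ w ∈ Metric.ball (1 : ℂ) 1, ∀ w' ∈ Metric.ball (1 : ℂ) 1, ‖w‖ = r →
      ‖w'‖ = r → dist (ψ w) (ψ w') ≤ ε := by
  by_contra! H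
  set h : ℂ → ENNReal :=
    (Metric.ball (1 : ℂ) 1).indicator (fun w => ENNReal.ofReal (‖deriv ψ w‖ ^ 2)) with hh
  have hmeas : Measurable h := by
    refine Measurable.indicator ?_ Metric.isOpen_ball.measurableSet
    exact ((measurable_deriv ψ).norm.pow_const 2).ennreal_ofReal
  have hfin : ∫⁻ w, h w < ⊤ := by
    rw [hh, lintegral_indicator Metric.isOpen_ball.measurableSet,
      Complex.lintegral_norm_deriv_sq Metric.isOpen_ball hd hi]
    exact hb.measure_lt_top
  rw [← Complex.lintegral_comp_polarCoord_symm, polarCoord_target, Measure.volume_eq_prod,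
    ← Measure.prod_restrict, lintegral_prod _ (by
      refine Measurable.aemeasurable ?_
      refine (ENNReal.measurable_ofReal.comp measurable_fst).smul (hmeas.comp ?_)
      rw [show (Complex.polarCoord.symm : ℝ × ℝ → ℂ) = fun p =>
        (p.1 : ℂ) * (Real.cos p.2 + Real.sin p.2 * I) from funext Complex.polarCoord_symm_apply]
      fun_prop)] at hfin
  have hge : ∫⁻ r in Ioo 0 ρ, ENNReal.ofReal (ε ^ 2 / Real.pi * r⁻¹) ≤
      ∫⁻ r in Ioi (0 : ℝ), ∫⁻ θ in Ioo (-Real.pi) Real.pi,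
        ENNReal.ofReal r • h (Complex.polarCoord.symm (r, θ)) := by
    refine le_trans (setLIntegral_mono' measurableSet_Ioo fun r hr => ?_)
      (lintegral_mono_set Ioo_subset_Ioi_self)
    obtain ⟨w, hw, w', hw', hwr, hwr', hdist⟩ := H r hr.1 hr.2
    have := length_area_estimate hd hr.1 hε hw hwr hw' hwr' hdist
    rw [← lintegral_const_mul' _ _ ENNReal.ofReal_ne_top] at this
    refine le_trans (le_of_eq ?_) (this.trans (le_of_eq ?_))
    · congr 1; field_simp
    · refine lintegral_congr fun θ => ?_
      rw [Complex.polarCoord_symm_apply, smul_eq_mul, exp_mul_I]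
      simp only [ofReal_cos, ofReal_sin, hh]
  have hlt := hge.trans_lt hfin
  have hint : IntegrableOn (fun r : ℝ => ε ^ 2 / Real.pi * r⁻¹) (Ioo 0 ρ) := by
    refine ⟨(measurable_inv.const_mul _).aestronglyMeasurable, ?_⟩
    rw [hasFiniteIntegral_iff_ofReal]
    · exact hlt
    · filter_upwards [ae_restrict_mem measurableSet_Ioo] with r hr
      have := hr.1
      have := Real.pi_pos
      simp only [Pi.zero_apply]
      positivity
  have hint2 : IntervalIntegrable (fun r : ℝ => r⁻¹) volume 0 ρ := by
    rw [intervalIntegrable_iff_integrableOn_Ioo_of_le hρ.le]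
    have hc : ε ^ 2 / Real.pi ≠ 0 := by have := Real.pi_pos; positivity
    exact (integrable_const_mul_iff (isUnit_iff_ne_zero.2 hc) _).1 hint
  rw [intervalIntegrable_inv_iff] at hint2
  rcases hint2 with h | h
  · exact hρ.ne h
  · exact h left_mem_uIcc

theorem exists_small_arc {φ : ℂ → ℂ} (hd : DifferentiableOn ℂ φ (Metric.ball 0 1))
    (hi : InjOn φ (Metric.ball 0 1)) (hb : Bornology.IsBounded (φ '' Metric.ball 0 1))
    {ζ : ℂ} (hζ : ‖ζ‖ = 1) {ε ρ : ℝ} (hε : 0 < ε) (hρ : 0 < ρ) :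
    ∃ r, 0 < r ∧ r < ρ ∧ ∀ z ∈ Metric.ball (0 : ℂ) 1, ∀ z' ∈ Metric.ball (0 : ℂ) 1, ‖z - ζ‖ = r →
      ‖z' - ζ‖ = r → dist (φ z) (φ z') ≤ ε := by
  have hζ0 : ζ ≠ 0 := norm_pos_iff.1 (hζ ▸ one_pos)
  have hm : MapsTo (fun w => ζ * (1 - w)) (Metric.ball 1 1) (Metric.ball 0 1) := fun w hw => by
    rw [mem_ball_iff_norm, norm_sub_rev] at hw
    simpa [hζ] using hw
  obtain ⟨r, h0, h1, h2⟩ := exists_small_arc_one (ψ := fun w => φ (ζ * (1 - w)))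
    (hd.comp (by fun_prop) hm)
    (fun x hx y hy e => by
      have := mul_left_cancel₀ hζ0 (hi (hm hx) (hm hy) e)
      linear_combination -this)
    (hb.subset (by rintro _ ⟨w, hw, rfl⟩; exact ⟨_, hm hw, rfl⟩)) hε hρ
  refine ⟨r, h0, h1, fun z hz z' hz' hzr hzr' => ?_⟩
  have key : ∀ z : ℂ, ζ * (1 - (1 - z / ζ)) = z ∧ ‖1 - z / ζ‖ = ‖z - ζ‖ ∧
      (z ∈ Metric.ball (0 : ℂ) 1 → 1 - z / ζ ∈ Metric.ball (1 : ℂ) 1) := fun z => by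
    refine ⟨by field_simp; ring, ?_, fun h => ?_⟩
    · rw [one_sub_div hζ0, norm_div, hζ, div_one, norm_sub_rev]
    · rw [mem_ball_iff_norm]
      simpa [hζ] using h
  have := h2 _ ((key z).2.2 hz) _ ((key z').2.2 hz') ((key z).2.1.trans hzr)
    ((key z').2.1.trans hzr')
  simpa only [(key z).1, (key z').1] using this

end

section

open Complex Set Topology Filter

/-! ### Boundary behaviour of Riemann maps -/

/-- The inverse of an injective holomorphic function is holomorphic. -/
theorem exists_differentiableOn_inverse {U : Set ℂ} (hU : IsOpen U) (hUp : IsPreconnected U)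
    {f : ℂ → ℂ} (hd : DifferentiableOn ℂ f U) (hi : InjOn f U) :
    ∃ φ : ℂ → ℂ, DifferentiableOn ℂ φ (f '' U) ∧ ∀ z ∈ U, φ (f z) = z := by
  have hφ : ∀ z ∈ U, Function.invFunOn f U (f z) = z := fun z hz => hi.leftInvOn_invFunOn hz
  set φ := Function.invFunOn f U
  refine ⟨φ, ?_, hφ⟩
  have hfa : AnalyticOnNhd ℂ f U := hd.analyticOnNhd hU
  have hnc : ∀ z ∈ U, ∀ w, ¬ ∀ᶠ y in 𝓝 z, f y = w := by
    intro z hz w h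
    obtain ⟨y, ⟨hy, hyU⟩, hyz⟩ := ((h.and (hU.mem_nhds hz)).filter_mono nhdsWithin_le_nhds |>.and
      (self_mem_nhdsWithin : {z}ᶜ ∈ 𝓝[≠] z)).exists
    exact hyz (hi hyU hz (hy.trans h.self_of_nhds.symm))
  have hopen : ∀ V ⊆ U, IsOpen V → IsOpen (f '' V) := by
    rcases hfa.is_constant_or_isOpen hUp with ⟨w, hw⟩ | h
    · rintro V hVU hV
      rcases V.eq_empty_or_nonempty with rfl | ⟨z, hz⟩
      · simp
      · exact absurd (eventually_of_mem (hU.mem_nhds (hVU hz)) hw) (hnc z (hVU hz) w)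
    · exact h
  have hfU := hopen U subset_rfl hU
  have hφc : ∀ z ∈ U, ContinuousAt φ (f z) := by
    intro z hz
    rw [ContinuousAt, hφ z hz]
    intro V hV
    obtain ⟨W, hWV, hW, hzW⟩ := mem_nhds_iff.1 (inter_mem hV (hU.mem_nhds hz))
    refine mem_map.2 (mem_of_superset ((hopen W (hWV.trans inter_subset_right) hW).mem_nhds
      ⟨z, hzW, rfl⟩) ?_)
    rintro _ ⟨y, hy, rfl⟩
    rw [mem_preimage, hφ y (hWV hy).2]
    exact (hWV hy).1
  have hright : ∀ z ∈ U, ∀ᶠ w in 𝓝 (f z), f (φ w) = w := fun z hz => by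
    filter_upwards [hfU.mem_nhds ⟨z, hz, rfl⟩]
    rintro _ ⟨y, hy, rfl⟩
    rw [hφ y hy]
  have hder : ∀ z ∈ U, deriv f z ≠ 0 → DifferentiableAt ℂ φ (f z) := fun z hz h =>
    (HasDerivAt.of_local_left_inverse (hφc z hz)
      (by rw [hφ z hz]; exact (hd.differentiableAt (hU.mem_nhds hz)).hasDerivAt) h
      (hright z hz)).differentiableAt
  rintro _ ⟨z, hz, rfl⟩
  refine DifferentiableAt.differentiableWithinAt ?_
  -- The zeros of the derivative of `f` are isolated, so at them the continuous inverse has a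
  -- removable singularity.
  refine (Complex.analyticAt_of_differentiable_on_punctured_nhds_of_continuousAt ?_
    (hφc z hz)).differentiableAt
  have h1 : ∀ᶠ y in 𝓝[≠] z, deriv f y ≠ 0 := by
    refine ((hfa z hz).deriv.eventually_eq_zero_or_eventually_ne_zero).resolve_left fun h => ?_
    obtain ⟨r, hr, hrU⟩ := Metric.mem_nhds_iff.1 (h.and (hU.mem_nhds hz))
    refine hnc z hz (f z) (eventually_of_mem (Metric.ball_mem_nhds z hr) fun y hy => ?_)
    exact (convex_ball z r).is_const_of_fderivWithin_eq_zero
      (hd.mono fun y hy => (hrU hy).2) (fun y hy => by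
        rw [fderivWithin_of_isOpen Metric.isOpen_ball hy]
        exact ContinuousLinearMap.ext_ring (by simpa using (hrU hy).1)) hy (Metric.mem_ball_self hr)
  have h2 : Tendsto φ (𝓝[≠] (f z)) (𝓝[≠] z) := by
    refine tendsto_nhdsWithin_iff.2 ⟨?_, ?_⟩
    · have := hφc z hz
      rw [ContinuousAt, hφ z hz] at this
      exact this.mono_left nhdsWithin_le_nhds
    · filter_upwards [self_mem_nhdsWithin, nhdsWithin_le_nhds (hright z hz)] with w hw hw' e
      rw [mem_singleton_iff] at e
      rw [e] at hw'
      exact hw hw'.symm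
  filter_upwards [h2.eventually h1, nhdsWithin_le_nhds (hfU.mem_nhds ⟨z, hz, rfl⟩)] with w hw hwU
  obtain ⟨y, hy, rfl⟩ := hwU
  rw [hφ y hy] at hw
  exact hder y hy hw

/-- A continuous function on the closed disc, holomorphic inside and
constant on a boundary arc, takes this constant value at the center. -/
theorem eq_of_constant_on_arc {Φ : ℂ → ℂ} {c : ℂ} (hc : ContinuousOn Φ (Metric.closedBall 0 1))
    (hd : DifferentiableOn ℂ Φ (Metric.ball 0 1)) {α β : ℝ} (hαβ : α < β)
    (h : ∀ θ ∈ Ioo α β, Φ (exp (θ * I)) = c) : Φ 0 = c := by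
  obtain ⟨n, hn⟩ := exists_nat_gt (2 * Real.pi / (β - α))
  have hpi := Real.pi_pos
  have hn0 : (0 : ℝ) < n := (div_pos (by linarith) (sub_pos.2 hαβ)).trans hn
  set s : ℝ := 2 * Real.pi / n with hs
  have hs0 : 0 < s := by positivity
  have hsβ : s < β - α := by
    rw [div_lt_iff₀ (sub_pos.2 hαβ)] at hn
    rw [hs, div_lt_iff₀ hn0]
    linarith
  have hrot : ∀ (k : ℕ) (z : ℂ), ‖z * exp ((k * s : ℝ) * I)‖ = ‖z‖ := fun k z => by
    rw [norm_mul, norm_exp_ofReal_mul_I, mul_one]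
  -- The step `s = 2π / n` is shorter than the arc, so every boundary point is moved into the arc by
  -- one of the `n` rotations. The product thus vanishes on the circle, hence at 0 by the maximum
  -- principle.
  set g : ℂ → ℂ := fun z => ∏ k ∈ Finset.range n, (Φ (z * exp ((k * s : ℝ) * I)) - c) with hg
  have hgc : ContinuousOn g (Metric.closedBall 0 1) := by
    refine continuousOn_finsetProd _ fun k _ => ContinuousOn.sub (hc.comp (by fun_prop) ?_) (by fun_prop)
    intro z hz
    simpa only [mem_closedBall_zero_iff, hrot] using hz
  have hgd : DifferentiableOn ℂ g (Metric.ball 0 1) := by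
    refine DifferentiableOn.fun_finsetProd fun k _ => DifferentiableOn.sub_const (hd.comp (by fun_prop) ?_) _
    intro z hz
    simpa only [mem_ball_zero_iff, hrot] using hz
  have hg0 : ∀ z ∈ frontier (Metric.ball (0 : ℂ) 1), ‖g z‖ ≤ 0 := by
    intro z hz
    rw [frontier_ball _ one_ne_zero, mem_sphere_zero_iff_norm] at hz
    obtain ⟨j, hj⟩ : ∃ j : ℤ, arg z + j * s ∈ Ioo α β := by
      refine ⟨⌊(α - arg z) / s⌋ + 1, ?_, ?_⟩
      · have := Int.lt_floor_add_one ((α - arg z) / s)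
        rw [div_lt_iff₀ hs0] at this
        push_cast
        linarith
      · have := Int.floor_le ((α - arg z) / s)
        rw [le_div_iff₀ hs0] at this
        push_cast
        linarith
    have hz' : z = exp (arg z * I) := by
      have := norm_mul_exp_arg_mul_I z
      rw [hz, ofReal_one, one_mul] at this
      exact this.symm
    have hnz : (n : ℤ) ≠ 0 := by exact_mod_cast hn0.ne'
    rw [norm_le_zero_iff, hg]
    refine Finset.prod_eq_zero (i := (j % n).toNat) ?_ ?_
    · rw [Finset.mem_range]
      have := Int.emod_lt_of_pos j (b := n) (by exact_mod_cast hn0)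
      have := Int.emod_nonneg j hnz
      omega
    · rw [sub_eq_zero, ← h _ hj]
      congr 1
      conv_lhs => rw [hz', ← exp_add]
      rw [Complex.exp_eq_exp_iff_exists_int]
      refine ⟨-(j / n), ?_⟩
      have e1 : (((j % n).toNat : ℕ) : ℂ) = j - n * (j / n : ℤ) := by
        have h1 : (((j % n).toNat : ℕ) : ℤ) = j - n * (j / n) := by
          rw [Int.toNat_of_nonneg (Int.emod_nonneg j hnz), Int.emod_def]
        exact_mod_cast h1
      have e2 : (n : ℂ) * (s : ℂ) = 2 * Real.pi := by
        have : (n : ℝ) * s = 2 * Real.pi := by rw [hs]; field_simp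
        exact_mod_cast this
      push_cast
      rw [e1]
      linear_combination (-((j / n : ℤ) : ℂ) * I) * e2
  have := Complex.norm_le_of_forall_mem_frontier_norm_le Metric.isBounded_ball
    ⟨hgd, by rwa [closure_ball _ one_ne_zero]⟩ hg0 (subset_closure (Metric.mem_ball_self one_pos))
  rw [norm_le_zero_iff, hg] at this
  simp only [zero_mul, Finset.prod_const, Finset.card_range] at this
  exact sub_eq_zero.1 (pow_eq_zero_iff (by rintro rfl; simp at hn0) |>.1 this)

/-! ### Carathéodory's theorem on the boundary extension -/

section Caratheodory

variable {γ : AddCircle (1 : ℝ) → ℂ} (hc : Continuous γ) (hi : Function.Injective γ)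
include hc hi

theorem isPreconnected_range_diff_singleton (x : ℂ) (hx : x ∈ range γ) :
    IsPreconnected (range γ \ {x}) := by
  obtain ⟨t, rfl⟩ := hx
  obtain ⟨t, rfl⟩ := QuotientAddGroup.mk_surjective t
  have : range γ \ {γ t} = (fun s : ℝ => γ s) '' Ioo t (t + 1) := by
    ext y
    constructor
    · rintro ⟨⟨u, rfl⟩, hu⟩
      obtain ⟨s, hs, rfl⟩ := AddCircle.exists_coe_eq t u
      refine ⟨s, ⟨hs.1.lt_of_ne ?_, hs.2⟩, rfl⟩
      rintro rfl
      exact hu rfl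
    · rintro ⟨s, hs, rfl⟩
      refine ⟨mem_range_self _, fun h => ?_⟩
      have h1 : (s : AddCircle (1 : ℝ)) = t := hi h
      have h2 := AddCircle.injOn_coe_Icc (α := t) (β := s) (by linarith [hs.2])
        (right_mem_Icc.2 hs.1.le) (left_mem_Icc.2 hs.1.le) h1
      exact hs.1.ne' h2
  exact this ▸ isPreconnected_Ioo.image _ (continuous_comp_coe hc).continuousOn

variable {x : ℂ} (hx : x ∉ range γ) {E : Set ℂ} (hE : E = connectedComponentIn (range γ)ᶜ x)
  {φ f : ℂ → ℂ} (hφ : MapsTo φ (Metric.ball 0 1) E)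
  (hd : DifferentiableOn ℂ φ (Metric.ball 0 1)) (hf : ContinuousOn f E)
  (hfE : MapsTo f E (Metric.ball 0 1)) (hfφ : ∀ z ∈ Metric.ball (0 : ℂ) 1, f (φ z) = z)
  (hφf : ∀ z ∈ E, φ (f z) = z)
include hE hφ hd hf hfE hfφ hφf

/-- Choose a circular crosscut around `ζ` whose image has small closure `Γ`. The points of `Γ` on
the curve lie in one short subarc `s`. If the image of the cut-off part left the small ball,
Janiszewski's theorem for the curve and `Γ ∪ s`, which meet in `s`, would join a point of it to a
point `φ v` beyond the crosscut inside `E` without meeting `Γ`. Pulled back to the disc, the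
connection would have to cross the circle. -/
theorem exists_image_inter_ball_subset (hb : Bornology.IsBounded E) {ζ : ℂ} (hζ : ‖ζ‖ = 1)
    {ε : ℝ} (hε : 0 < ε) :
    ∃ r > 0, ∃ c, φ '' (Metric.ball 0 1 ∩ Metric.ball ζ r) ⊆ Metric.closedBall c ε := by
  have hEo : IsOpen E := hE ▸ (isCompact_range_closedCurve hc).isClosed.isOpen_compl.connectedComponentIn
  have hEJ : E ⊆ (range γ)ᶜ := hE ▸ connectedComponentIn_subset _ _
  have h0 : (0 : ℂ) ∈ Metric.ball (0 : ℂ) 1 := Metric.mem_ball_self one_pos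
  have hφi : InjOn φ (Metric.ball 0 1) := fun a ha b hb e => by rw [← hfφ a ha, ← hfφ b hb, e]
  -- The image of the half disc contains a ball of radius `d`, too large for the small ball around
  -- the crosscut; this provides `v` below.
  obtain ⟨d, hd0, hdsub⟩ : ∃ d > 0, Metric.ball (φ 0) d ⊆ φ '' Metric.ball 0 (1 / 2) := by
    have h1 : E ∩ f ⁻¹' Metric.ball 0 (1 / 2) ∈ 𝓝 (φ 0) :=
      (hf.isOpen_inter_preimage hEo Metric.isOpen_ball).mem_nhds
        ⟨hφ h0, by rw [mem_preimage, hfφ 0 h0]; exact Metric.mem_ball_self (by norm_num)⟩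
    obtain ⟨d, hd0, hd1⟩ := Metric.mem_nhds_iff.1 h1
    exact ⟨d, hd0, fun y hy => ⟨f y, (hd1 hy).2, hφf y (hd1 hy).1⟩⟩
  set e := min ε d / 16 with he
  have he0 : 0 < e := by positivity
  have heε : 16 * e ≤ ε := by rw [he]; linarith [min_le_left ε d]
  have hed : 16 * e ≤ d := by rw [he]; linarith [min_le_right ε d]
  obtain ⟨δ, hδ, hsub⟩ := exists_local_subarc hc hi he0
  set η := min δ e / 4 with hη
  have hη0 : 0 < η := by positivity
  have hηδ : 4 * η ≤ δ := by rw [hη]; linarith [min_le_left δ e]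
  have hηe : 4 * η ≤ e := by rw [hη]; linarith [min_le_right δ e]
  obtain ⟨r, hr0, hr1, hosc⟩ := exists_small_arc hd hφi
    (hb.subset hφ.image_subset) hζ hη0 (by norm_num : (0 : ℝ) < 1 / 2)
  have hz₀ : (1 - r) * ζ ∈ Metric.ball (0 : ℂ) 1 ∧ ‖(1 - r) * ζ - ζ‖ = r := by
    constructor
    · rw [mem_ball_zero_iff, norm_mul, hζ, mul_one, ← ofReal_one, ← ofReal_sub, norm_real,
        Real.norm_of_nonneg (by linarith)]
      linarith
    · rw [show (1 - (r : ℂ)) * ζ - ζ = -(r * ζ) by ring, norm_neg, norm_mul, hζ, norm_real,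
        Real.norm_of_nonneg hr0.le, mul_one]
  set y := φ ((1 - r) * ζ) with hy
  set Γ := closure (φ '' {z | z ∈ Metric.ball (0 : ℂ) 1 ∧ ‖z - ζ‖ = r}) with hΓ
  have hΓy : Γ ⊆ Metric.closedBall y η := by
    refine closure_minimal ?_ Metric.isClosed_closedBall
    rintro _ ⟨z, ⟨hz, hzr⟩, rfl⟩
    exact hosc z hz _ hz₀.1 hzr hz₀.2
  have hΓc : IsCompact Γ := (isCompact_closedBall y η).of_isClosed_subset isClosed_closure hΓy
  obtain ⟨s, hsc, hsp, hsJ, hsy, hΓs⟩ : ∃ s, IsCompact s ∧ IsPreconnected s ∧ s ⊆ range γ ∧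
      s ⊆ Metric.closedBall y (2 * e) ∧ Γ ∩ range γ ⊆ s := by
    rcases (Γ ∩ range γ).eq_empty_or_nonempty with h | ⟨w, hwΓ, hwJ⟩
    · exact ⟨∅, isCompact_empty, isPreconnected_empty, empty_subset _, empty_subset _, h.subset⟩
    · obtain ⟨s, c, hs1, hs2, -, -, hsc, -, hs3, hs4⟩ := hsub w hwJ
      have hwy := hΓy hwΓ
      rw [Metric.mem_closedBall] at hwy
      refine ⟨s, hs1, hs2, hsc ▸ subset_union_left, fun z hz => ?_, fun z hz => ?_⟩
      · have := hs3 hz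
        rw [Metric.mem_ball] at this
        rw [Metric.mem_closedBall]
        linarith [dist_triangle z w y]
      · have hz' : z ∈ s ∪ c := hsc ▸ hz.2
        refine hz'.resolve_right fun hzc => hs4.le_bot ⟨hzc, ?_⟩
        have := hΓy hz.1
        rw [Metric.mem_closedBall] at this
        rw [Metric.mem_ball]
        linarith [dist_triangle_right z w y]
  obtain ⟨v, hv, hvy⟩ : ∃ v ∈ Metric.ball (0 : ℂ) (1 / 2), φ v ∉ Metric.closedBall y (2 * e) := by
    by_contra! H
    have hd1 : φ 0 ∈ Metric.ball (φ 0) d := Metric.mem_ball_self hd0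
    have hd2 : φ 0 + (d / 2 : ℝ) ∈ Metric.ball (φ 0) d := by
      rw [mem_ball_iff_norm, add_sub_cancel_left, norm_real, Real.norm_of_nonneg (by linarith)]
      linarith
    obtain ⟨a, ha, ha'⟩ := hdsub hd1
    obtain ⟨b, hb, hb'⟩ := hdsub hd2
    have h1 := H a ha
    have h2 := H b hb
    rw [ha', Metric.mem_closedBall] at h1
    rw [hb', Metric.mem_closedBall] at h2
    have h3 : dist (φ 0 + (d / 2 : ℝ)) (φ 0) = d / 2 := by
      rw [dist_eq, add_sub_cancel_left, norm_real, Real.norm_of_nonneg (by linarith)]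
    linarith [dist_triangle_right (φ 0 + (d / 2 : ℝ)) (φ 0) y]
  have hv1 : v ∈ Metric.ball (0 : ℂ) 1 := Metric.ball_subset_ball (by norm_num) hv
  refine ⟨r, hr0, y, ?_⟩
  rintro _ ⟨u, ⟨hu, hur⟩, rfl⟩
  refine Metric.closedBall_subset_closedBall (by linarith : 2 * e ≤ ε) ?_
  by_contra huy
  have hJ : NotSeparates (range γ) (φ u) (φ v) :=
    ⟨E, hEJ, hE ▸ isPreconnected_connectedComponentIn, hφ hu, hφ hv1⟩
  have hK : NotSeparates (Γ ∪ s) (φ u) (φ v) := by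
    refine ⟨_, ?_, isPreconnected_norm_sub_gt y (2 * e), ?_, ?_⟩
    · intro z hz hz'
      rw [mem_ofPred_eq, ← dist_eq] at hz
      have : z ∈ Metric.closedBall y (2 * e) := hz'.elim
        (fun h => Metric.closedBall_subset_closedBall (by linarith) (hΓy h)) fun h => hsy h
      exact (Metric.mem_closedBall.1 this).not_gt hz
    · rwa [mem_ofPred_eq, ← dist_eq, ← not_le]
    · rwa [mem_ofPred_eq, ← dist_eq, ← not_le]
  have hJK : range γ ∩ (Γ ∪ s) = s := by
    rw [inter_union_distrib_left, inter_eq_self_of_subset_right hsJ, inter_comm]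
    exact union_eq_self_of_subset_left hΓs
  obtain ⟨C, hC, hCp, huC, hvC⟩ := hJ.union (isCompact_range_closedCurve hc) (hΓc.union hsc)
    (by rwa [hJK]) hK
  have hCE : C ⊆ E := by
    have h1 : connectedComponentIn (range γ)ᶜ (φ u) = E := by
      have : φ u ∈ connectedComponentIn (range γ)ᶜ x := hE ▸ hφ hu
      rw [hE, connectedComponentIn_eq this]
    rw [← h1]
    exact hCp.subset_connectedComponentIn huC fun z hz hz' => hC hz (.inl hz')
  have hcross := (hCp.image (fun z => ‖f z - ζ‖) ((hf.mono hCE).sub continuousOn_const).norm).ordConnected.out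
    ⟨_, huC, rfl⟩ ⟨_, hvC, rfl⟩
  have hrI : r ∈ Icc ‖f (φ u) - ζ‖ ‖f (φ v) - ζ‖ := by
    rw [hfφ u hu, hfφ v hv1]
    rw [mem_ball_iff_norm] at hur
    rw [mem_ball_zero_iff] at hv
    refine ⟨hur.le, ?_⟩
    have := norm_sub_norm_le ζ v
    rw [norm_sub_rev]
    linarith
  obtain ⟨z, hz, hzr⟩ := hcross hrI
  refine hC hz (.inr (.inl (subset_closure ⟨f z, ⟨hfE (hCE hz), hzr⟩, hφf z (hCE hz)⟩)))

include hx in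
-- By the preceding lemma `φ` satisfies the Cauchy criterion at each boundary point. The image of
-- the closed disc is compact and contains `E`, hence its closure, so the whole curve is covered.
theorem exists_continuous_extension (hb : Bornology.IsBounded E) :
    ∃ Φ : ℂ → ℂ, ContinuousOn Φ (Metric.closedBall 0 1) ∧ EqOn Φ φ (Metric.ball 0 1) ∧
      MapsTo Φ (Metric.sphere 0 1) (range γ) ∧ range γ ⊆ Φ '' Metric.sphere 0 1 := by
  have hEo : IsOpen E := hE ▸ (isCompact_range_closedCurve hc).isClosed.isOpen_compl.connectedComponentIn
  have hEJ : E ⊆ (range γ)ᶜ := hE ▸ connectedComponentIn_subset _ _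
  have hEcl : closure E = E ∪ range γ := by
    rw [closure_eq_self_union_frontier, hE, frontier_component_eq hc hi hx]
  have hcl : closure (Metric.ball (0 : ℂ) 1) = Metric.closedBall 0 1 := closure_ball _ one_ne_zero
  have hlim : ∀ ζ ∈ Metric.closedBall (0 : ℂ) 1, ∃ y, Tendsto φ (𝓝[Metric.ball 0 1] ζ) (𝓝 y) := by
    intro ζ hζ
    rw [← Metric.ball_union_sphere] at hζ
    rcases hζ with hζ | hζ
    · exact ⟨φ ζ, hd.continuousOn ζ hζ⟩
    · have hne : (𝓝[Metric.ball (0 : ℂ) 1] ζ).NeBot :=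
        mem_closure_iff_nhdsWithin_neBot.1 (hcl ▸ Metric.sphere_subset_closedBall hζ)
      refine cauchy_map_iff_exists_tendsto.1 ?_
      refine Metric.cauchy_iff.2 ⟨inferInstance, fun ε hε => ?_⟩
      obtain ⟨r, hr, c, hrc⟩ := exists_image_inter_ball_subset hc hi hE hφ hd hf hfE hfφ hφf
        hb (mem_sphere_zero_iff_norm.1 hζ) (by positivity : 0 < ε / 3)
      refine ⟨_, image_mem_map (inter_mem_nhdsWithin _ (Metric.ball_mem_nhds ζ hr)), ?_⟩
      intro a ha b hb
      have h1 := Metric.mem_closedBall.1 (hrc ha)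
      have h2 := Metric.mem_closedBall.1 (hrc hb)
      linarith [dist_triangle_right a b c]
  have hΦ : EqOn (extendFrom (Metric.ball 0 1) φ) φ (Metric.ball 0 1) := fun z hz =>
    extendFrom_eq (subset_closure hz) (hd.continuousOn z hz)
  have hΦc : ContinuousOn (extendFrom (Metric.ball 0 1) φ) (Metric.closedBall 0 1) :=
    continuousOn_extendFrom hcl.ge hlim
  set Φ := extendFrom (Metric.ball 0 1) φ
  have hΦcl : MapsTo Φ (Metric.closedBall 0 1) (closure E) := by
    rw [← hcl] at hΦc ⊢
    exact MapsTo.closure_of_continuousOn (fun z hz => by rw [hΦ hz]; exact hφ hz) hΦc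
  have hS : MapsTo Φ (Metric.sphere 0 1) (range γ) := by
    intro ζ hζ
    have hζ' := Metric.sphere_subset_closedBall hζ
    have h1 := hΦcl hζ'
    rw [hEcl] at h1
    -- If `Φ ζ` were in `E`, then `f ∘ Φ` would tend at `ζ` both to a point of the open disc and to
    -- `ζ` itself.
    refine h1.resolve_left fun hmem => ?_
    have hne : (𝓝[Metric.ball (0 : ℂ) 1] ζ).NeBot :=
      mem_closure_iff_nhdsWithin_neBot.1 (hcl ▸ hζ')
    have h2 : Tendsto (fun z => f (Φ z)) (𝓝[Metric.ball 0 1] ζ) (𝓝 (f (Φ ζ))) :=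
      (hf.continuousAt (hEo.mem_nhds hmem)).tendsto.comp
        ((hΦc ζ hζ').mono_left (nhdsWithin_mono _ Metric.ball_subset_closedBall))
    have h3 : Tendsto (fun z => f (Φ z)) (𝓝[Metric.ball 0 1] ζ) (𝓝 ζ) := by
      refine Tendsto.congr' ?_ (tendsto_id.mono_left nhdsWithin_le_nhds)
      filter_upwards [self_mem_nhdsWithin] with z hz
      rw [hΦ hz, hfφ z hz, id]
    have h4 := hfE hmem
    rw [tendsto_nhds_unique h2 h3, mem_ball_zero_iff] at h4
    rw [mem_sphere_zero_iff_norm] at hζ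
    exact h4.ne hζ
  refine ⟨Φ, hΦc, hΦ, hS, fun y hy => ?_⟩
  have h1 : closure E ⊆ Φ '' Metric.closedBall 0 1 := by
    refine closure_minimal (fun z hz => ?_)
      ((isCompact_closedBall 0 1).image_of_continuousOn hΦc).isClosed
    exact ⟨f z, Metric.ball_subset_closedBall (hfE hz), by rw [hΦ (hfE hz), hφf z hz]⟩
  obtain ⟨z, hz, rfl⟩ := h1 (hEcl.ge (.inr hy))
  rw [← Metric.ball_union_sphere] at hz
  refine ⟨z, hz.resolve_left fun hz => ?_, rfl⟩
  rw [hΦ hz] at hy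
  exact hEJ (hφ hz) hy

variable {Φ : ℂ → ℂ} (hΦc : ContinuousOn Φ (Metric.closedBall 0 1))
  (hΦφ : EqOn Φ φ (Metric.ball 0 1)) (hΦS : MapsTo Φ (Metric.sphere 0 1) (range γ))
include hΦc hΦφ hΦS

omit hf in
-- If two boundary points have the same image `p`, the images of their radii form a Jordan curve `l`
-- in `E ∪ {p}`. The images of the two open sectors, each with a boundary point not sent to `p`, are
-- joined through the connected set `range γ \ {p}`, which avoids `l`. So all of `E \ range l` lies
-- in one component of the complement of `l`. But another component of it also has `l` as frontier,
-- and so comes near the point `Φ 0` of the open set `E`.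
theorem injOn_sphere_of_extension : InjOn Φ (Metric.sphere 0 1) := by
  have hEo : IsOpen E := hE ▸ (isCompact_range_closedCurve hc).isClosed.isOpen_compl.connectedComponentIn
  have hEJ : E ⊆ (range γ)ᶜ := hE ▸ connectedComponentIn_subset _ _
  have h0 : (0 : ℂ) ∈ Metric.ball (0 : ℂ) 1 := Metric.mem_ball_self one_pos
  have hΦE : MapsTo Φ (Metric.ball 0 1) E := fun z hz => by rw [hΦφ hz]; exact hφ hz
  have hΦi : InjOn Φ (Metric.ball 0 1) := fun a ha b hb e => by
    rw [hΦφ ha, hΦφ hb] at e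
    rw [← hfφ a ha, ← hfφ b hb, e]
  intro ξ hξ ξ' hξ' hxx
  by_contra hne
  wlog hα : 0 < arg (ξ' / ξ) generalizing ξ ξ'
  · refine this hξ' hξ hxx.symm (Ne.symm hne) ?_
    have hξ0 : ‖ξ‖ = 1 := mem_sphere_zero_iff_norm.1 hξ
    have hξ0' : ‖ξ'‖ = 1 := mem_sphere_zero_iff_norm.1 hξ'
    rcases lt_or_eq_of_le (not_lt.1 hα) with h | h
    · rw [← inv_div, arg_inv, if_neg]
      · linarith
      · have := Real.pi_pos
        intro h'
        linarith
    · have := norm_mul_exp_arg_mul_I (ξ' / ξ)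
      rw [h, norm_div, hξ0, hξ0'] at this
      have h1 : ξ' / ξ = 1 := by rw [← this]; simp
      exact absurd (eq_of_div_eq_one h1).symm hne
  have hS : ∀ {ν : ℂ}, ν ∈ Metric.sphere (0 : ℂ) 1 ↔ ‖ν‖ = 1 := mem_sphere_zero_iff_norm
  have hξn := hS.1 hξ
  have hξn' := hS.1 hξ'
  have hξ0 : ξ ≠ 0 := norm_pos_iff.1 (hξn ▸ one_pos)
  set α := arg (ξ' / ξ)
  have hαpi : α ≤ Real.pi := arg_le_pi _
  have hpi := Real.pi_pos
  have hξα : ξ' = ξ * exp (α * I) := by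
    have := norm_mul_exp_arg_mul_I (ξ' / ξ)
    rw [norm_div, hξn, hξn', div_one, ofReal_one, one_mul] at this
    rw [this]; field_simp
  have hnorm : ∀ s θ : ℝ, 0 ≤ s → ‖(s : ℂ) * (ξ * exp (θ * I))‖ = s := fun s θ hs => by
    rw [norm_mul, norm_mul, norm_exp_ofReal_mul_I, hξn, norm_real, Real.norm_of_nonneg hs]; ring
  set p := Φ ξ with hp
  -- The Jordan curve made of the images of two radii.
  have hrad : ∀ ν ∈ Metric.sphere (0 : ℂ) 1, ContinuousOn (fun t : ℝ => Φ (t * ν)) (Icc 0 1) ∧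
      InjOn (fun t : ℝ => Φ (t * ν)) (Icc 0 1) ∧
      ∀ t ∈ Ico (0 : ℝ) 1, (t : ℂ) * ν ∈ Metric.ball (0 : ℂ) 1 := by
    intro ν hν
    have hν1 := hS.1 hν
    have hν0 : ν ≠ 0 := norm_pos_iff.1 (hν1 ▸ one_pos)
    have hball : ∀ t ∈ Ico (0 : ℝ) 1, (t : ℂ) * ν ∈ Metric.ball (0 : ℂ) 1 := fun t ht => by
      rw [mem_ball_zero_iff, norm_mul, hν1, norm_real, Real.norm_of_nonneg ht.1, mul_one]
      exact ht.2
    refine ⟨hΦc.comp (by fun_prop) fun t ht => ?_, fun t ht s hs e => ?_, hball⟩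
    · rw [mem_closedBall_zero_iff, norm_mul, hν1, norm_real, Real.norm_of_nonneg ht.1, mul_one]
      exact ht.2
    · beta_reduce at e
      rcases ht.2.eq_or_lt with rfl | ht1 <;> rcases hs.2.eq_or_lt with rfl | hs1
      · rfl
      · refine absurd ?_ (hEJ (hΦE (hball s ⟨hs.1, hs1⟩)))
        rw [← e]; simpa using hΦS hν
      · refine absurd ?_ (hEJ (hΦE (hball t ⟨ht.1, ht1⟩)))
        rw [e]; simpa using hΦS hν
      · exact_mod_cast mul_right_cancel₀ hν0
          (hΦi (hball t ⟨ht.1, ht1⟩) (hball s ⟨hs.1, hs1⟩) e)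
  obtain ⟨r1c, r1i, r1b⟩ := hrad ξ hξ
  obtain ⟨r2c, r2i, r2b⟩ := hrad ξ' hξ'
  obtain ⟨l, lc, li, lr⟩ := exists_closedCurve_of_arcs r1c r2c r1i r2i (by simp) (by simpa using hxx)
    (by
      rintro _ ⟨⟨t, ht, rfl⟩, ⟨s, hs, e⟩⟩
      beta_reduce at e ⊢
      rcases ht.2.eq_or_lt with rfl | ht1
      · right; rfl
      rcases hs.2.eq_or_lt with rfl | hs1
      · refine absurd ?_ (hEJ (hΦE (r1b t ⟨ht.1, ht1⟩)))
        rw [← e]; simpa using hΦS hξ'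
      · left
        have h1 := hΦi (r2b s ⟨hs.1, hs1⟩) (r1b t ⟨ht.1, ht1⟩) e
        have h2 := congrArg norm h1
        rw [norm_mul, norm_mul, hξn, hξn', norm_real, norm_real, Real.norm_of_nonneg ht.1,
          Real.norm_of_nonneg hs.1, mul_one, mul_one] at h2
        subst h2
        rcases eq_or_ne s 0 with rfl | h3
        · rfl
        · exact absurd (mul_left_cancel₀ (ofReal_ne_zero.2 h3) h1).symm hne)
  have hlE : ∀ z ∈ range l, z ∈ E ∨ z = p := by
    rw [lr]
    rintro _ (⟨t, ht, rfl⟩ | ⟨t, ht, rfl⟩)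
    · rcases ht.2.eq_or_lt with rfl | ht1
      · right; simp [p]
      · exact .inl (hΦE (r1b t ⟨ht.1, ht1⟩))
    · rcases ht.2.eq_or_lt with rfl | ht1
      · right; simp [p, hxx]
      · exact .inl (hΦE (r2b t ⟨ht.1, ht1⟩))
  have hΦ0l : Φ 0 ∈ range l := by
    rw [lr]; exact .inl ⟨0, by simp, by simp⟩
  -- The image of a sector together with one boundary point.
  have hsector : ∀ a b : ℝ, 0 ≤ a → b ≤ 2 * Real.pi → (∀ θ ∈ Ioo a b, θ ≠ α) →
      ∀ θ₀ ∈ Ioo a b, Φ (ξ * exp (θ₀ * I)) ≠ p →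
      ∃ T : Set ℂ, IsPreconnected T ∧ T ⊆ (range l)ᶜ ∧ Φ (ξ * exp (θ₀ * I)) ∈ T ∧
        ∀ s ∈ Ioo (0 : ℝ) 1, ∀ θ ∈ Ioo a b, Φ (s * (ξ * exp (θ * I))) ∈ T := by
    intro a b ha hb hab θ₀ hθ₀ hΦp
    set F : ℝ × ℝ → ℂ := fun q => q.1 * (ξ * exp (q.2 * I)) with hF
    have hFc : Continuous F := by fun_prop
    set Q : Set (ℝ × ℝ) := Ioo 0 1 ×ˢ Ioo a b with hQ
    set Q' := insert (1, θ₀) Q with hQ'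
    have hQp : IsPreconnected Q' := by
      refine (isPreconnected_Ioo.prod isPreconnected_Ioo).subset_closure (subset_insert _ _) ?_
      refine insert_subset ?_ subset_closure
      rw [closure_prod_eq, closure_Ioo zero_ne_one]
      exact ⟨right_mem_Icc.2 zero_le_one, subset_closure hθ₀⟩
    have hmaps : MapsTo F Q' (Metric.closedBall 0 1) := by
      rintro q (rfl | hq)
      · rw [mem_closedBall_zero_iff, hnorm _ _ zero_le_one]
      · rw [mem_closedBall_zero_iff, hnorm _ _ hq.1.1.le]; exact hq.1.2.le
    refine ⟨(Φ ∘ F) '' Q', hQp.image _ (hΦc.comp hFc.continuousOn hmaps), ?_,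
      ⟨_, mem_insert _ _, by simp [hF]⟩, fun s hs θ hθ => ⟨(s, θ), .inr ⟨hs, hθ⟩, rfl⟩⟩
    rintro _ ⟨q, rfl | hq, rfl⟩ hl
    · have h1 : (Φ ∘ F) (1, θ₀) = Φ (ξ * exp (θ₀ * I)) := by simp [hF]
      rw [h1] at hl
      rcases hlE _ hl with h2 | h2
      · exact hEJ h2 (hΦS (hS.2 (by rw [norm_mul, norm_exp_ofReal_mul_I, hξn, one_mul])))
      · exact hΦp h2
    · have hq1 : F q ∈ Metric.ball (0 : ℂ) 1 := by
        rw [mem_ball_zero_iff, hnorm _ _ hq.1.1.le]; exact hq.1.2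
      have key : ∀ ν : ℂ, ∀ β : ℝ, ν = ξ * exp (β * I) → ν ∈ Metric.sphere (0 : ℂ) 1 →
          0 ≤ β → β < 2 * Real.pi →
          (∀ t ∈ Ico (0 : ℝ) 1, (t : ℂ) * ν ∈ Metric.ball (0 : ℂ) 1) → q.2 ≠ β → q.2 ≠ β + 2 * Real.pi →
          Φ (F q) ∉ (fun t : ℝ => Φ (t * ν)) '' Icc 0 1 := by
        rintro ν β hν hνS hβ0 hβ1 hνb hqβ hqβ' ⟨t, ht, e⟩
        beta_reduce at e
        rcases ht.2.eq_or_lt with rfl | ht1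
        · refine absurd ?_ (hEJ (hΦE hq1))
          rw [← e]; simpa using hΦS hνS
        · have h1 := hΦi (hνb t ⟨ht.1, ht1⟩) hq1 e
          have h2 := congrArg norm h1
          rw [hν, hnorm _ _ ht.1, hnorm _ _ hq.1.1.le] at h2
          rw [h2, hν] at h1
          have h3 := mul_left_cancel₀ hξ0 (mul_left_cancel₀ (ofReal_ne_zero.2 hq.1.1.ne') h1)
          obtain ⟨n, hn⟩ := Complex.exp_eq_exp_iff_exists_int.1 h3
          have hn' : β = q.2 + n * (2 * Real.pi) := by
            have := congrArg Complex.im hn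
            simpa using this
          have hq2 := hq.2
          have hn1 : (n : ℝ) < 1 := by
            by_contra! h; nlinarith [hq2.1, hq2.2]
          have hn2 : (-2 : ℝ) < n := by
            by_contra! h; nlinarith [hq2.1, hq2.2]
          have hn1' : n < 1 := by exact_mod_cast hn1
          have hn2' : -2 < n := by exact_mod_cast hn2
          obtain rfl | rfl : n = 0 ∨ n = -1 := by omega
          · exact hqβ (by rw [hn']; simp)
          · exact hqβ' (by rw [hn']; push_cast; ring)
      rw [lr] at hl
      have hq2 := hq.2
      rcases hl with hl | hl
      · exact key ξ 0 (by simp) hξ le_rfl (by linarith) r1b (by linarith [hq2.1])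
          (by linarith [hq2.2]) hl
      · exact key ξ' α hξα hξ' hα.le (by linarith) r2b (hab _ hq.2) (by linarith [hq2.2]) hl
  have hΦd : DifferentiableOn ℂ Φ (Metric.ball 0 1) := hd.congr hΦφ
  have hΦ0 : Φ 0 ≠ p := fun h => hEJ (hΦE h0) (h ▸ hΦS hξ)
  -- Were `Φ` constantly `p` on a boundary arc, it would equal `p` at the center, although `Φ 0`
  -- lies in `E`.
  have harc : ∀ a b : ℝ, a < b → ∃ θ ∈ Ioo a b, Φ (ξ * exp (θ * I)) ≠ p := by
    intro a b hab
    by_contra! H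
    refine hΦ0 ?_
    have := eq_of_constant_on_arc (Φ := fun z => Φ (ξ * z)) (c := p)
      (hΦc.comp (by fun_prop) fun z hz => by simpa [hξn] using hz)
      (hΦd.comp (by fun_prop) fun z hz => by simpa [hξn] using hz) hab H
    simpa using this
  obtain ⟨θ₁, hθ₁, hp₁⟩ := harc 0 α hα
  obtain ⟨θ₂, hθ₂, hp₂⟩ := harc α (2 * Real.pi) (by linarith)
  obtain ⟨T₁, hT₁, hTl₁, hm₁, hs₁⟩ := hsector 0 α le_rfl (by linarith) (fun θ hθ => hθ.2.ne) θ₁ hθ₁ hp₁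
  obtain ⟨T₂, hT₂, hTl₂, hm₂, hs₂⟩ := hsector α (2 * Real.pi) hα.le le_rfl (fun θ hθ => hθ.1.ne') θ₂ hθ₂ hp₂
  have hJp : range γ \ {p} ⊆ (range l)ᶜ := by
    rintro z ⟨hz, hzp⟩ hzl
    rcases hlE z hzl with h | h
    · exact hEJ h hz
    · exact hzp h
  have hmem : ∀ θ : ℝ, Φ (ξ * exp (θ * I)) ≠ p → Φ (ξ * exp (θ * I)) ∈ range γ \ {p} := fun θ h =>
    ⟨hΦS (hS.2 (by rw [norm_mul, norm_exp_ofReal_mul_I, hξn, one_mul])), h⟩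
  have hT : IsPreconnected (T₁ ∪ (range γ \ {p}) ∪ T₂) :=
    ((hT₁.union _ hm₁ (hmem _ hp₁) (isPreconnected_range_diff_singleton hc hi p (hΦS hξ))).union _
      (.inr (hmem _ hp₂)) hm₂ hT₂)
  have hTl : T₁ ∪ (range γ \ {p}) ∪ T₂ ⊆ (range l)ᶜ := union_subset (union_subset hTl₁ hJp) hTl₂
  have hET : E \ range l ⊆ T₁ ∪ (range γ \ {p}) ∪ T₂ := by
    rintro z ⟨hz, hzl⟩
    have hw := hfE hz
    have hzw : Φ (f z) = z := by rw [hΦφ hw, hφf z hz]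
    set w := f z
    rw [mem_ball_zero_iff] at hw
    have hw0 : w ≠ 0 := by
      intro h
      rw [h] at hzw
      exact hzl (hzw ▸ hΦ0l)
    have hwpos : 0 < ‖w‖ := norm_pos_iff.2 hw0
    obtain ⟨θ, hθ, hwθ⟩ : ∃ θ ∈ Ico 0 (2 * Real.pi), w = ‖w‖ * (ξ * exp (θ * I)) := by
      have h1 : w / ξ = ‖w‖ * exp (arg (w / ξ) * I) := by
        have := norm_mul_exp_arg_mul_I (w / ξ)
        rw [norm_div, hξn, div_one] at this
        exact this.symm
      have h2 : w = ‖w‖ * (ξ * exp (arg (w / ξ) * I)) := by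
        rw [mul_left_comm, ← h1]; field_simp
      rcases le_or_gt 0 (arg (w / ξ)) with h | h
      · exact ⟨_, ⟨h, by linarith [arg_le_pi (w / ξ)]⟩, h2⟩
      · refine ⟨arg (w / ξ) + 2 * Real.pi, ⟨by linarith [neg_pi_lt_arg (w / ξ)], by linarith⟩, ?_⟩
        conv_lhs => rw [h2]
        push_cast
        rw [add_mul, exp_add, exp_two_pi_mul_I, mul_one]
    rcases hθ.1.eq_or_lt with rfl | hθ0
    · refine absurd ?_ hzl
      rw [lr, ← hzw, hwθ]
      exact .inl ⟨‖w‖, ⟨hwpos.le, hw.le⟩, by simp⟩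
    rcases lt_trichotomy θ α with h | rfl | h
    · left; left
      rw [← hzw, hwθ]
      exact hs₁ _ ⟨hwpos, hw⟩ _ ⟨hθ0, h⟩
    · refine absurd ?_ hzl
      rw [lr, ← hzw, hwθ]
      exact .inr ⟨‖w‖, ⟨hwpos.le, hw.le⟩, by rw [hξα]⟩
    · right
      rw [← hzw, hwθ]
      exact hs₂ _ ⟨hwpos, hw⟩ _ ⟨h, hθ.2⟩
  obtain ⟨y, hyl, hy⟩ := exists_notMem_component lc li (Φ (ξ * exp (θ₁ * I)))
  have hfr := frontier_component_eq lc li hyl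
  have hΦ0cl : Φ 0 ∈ closure (connectedComponentIn (range l)ᶜ y) :=
    frontier_subset_closure (hfr.ge hΦ0l)
  obtain ⟨u, huE, huy⟩ := mem_closure_iff.1 hΦ0cl E hEo (hΦE h0)
  have huT := hET ⟨huE, connectedComponentIn_subset _ _ huy⟩
  have h1 := hT.subset_connectedComponentIn (.inl (.inl hm₁)) hTl huT
  rw [connectedComponentIn_eq h1, ← connectedComponentIn_eq huy] at hy
  exact hy (mem_connectedComponentIn hyl)

end Caratheodory

/-- A bounded complementary component of a Jordan curve is the interior of a closed disc
bounded by the curve. -/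
theorem exists_closedDisc {γ : AddCircle (1 : ℝ) → ℂ} (hc : Continuous γ)
    (hi : Function.Injective γ) {x : ℂ} (hx : x ∉ range γ)
    (hb : Bornology.IsBounded (connectedComponentIn (range γ)ᶜ x)) :
    ∃ h : ℂ → ℂ, ContinuousOn h (Metric.closedBall 0 1) ∧ InjOn h (Metric.closedBall 0 1) ∧
      h '' Metric.closedBall 0 1 = connectedComponentIn (range γ)ᶜ x ∪ range γ ∧
      h '' Metric.sphere 0 1 = range γ := by
  obtain ⟨E, hE⟩ : ∃ E, E = connectedComponentIn (range γ)ᶜ x := ⟨_, rfl⟩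
  rw [← hE] at hb ⊢
  have hEo : IsOpen E := hE ▸ (isCompact_range_closedCurve hc).isClosed.isOpen_compl.connectedComponentIn
  have hEp : IsPreconnected E := hE ▸ isPreconnected_connectedComponentIn
  have hEJ : E ⊆ (range γ)ᶜ := hE ▸ connectedComponentIn_subset _ _
  obtain ⟨f, hfd, hfi, hfim⟩ := exists_riemann_map hEo hEp hb (hE ▸ mem_connectedComponentIn hx)
    (by subst hE; exact fun g hg hg0 => hasLogOn_component hc hi hx hb hg hg0)
  obtain ⟨φ, hφd, hφf⟩ := exists_differentiableOn_inverse hEo hEp hfd hfi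
  rw [hfim] at hφd
  have hfE : MapsTo f E (Metric.ball 0 1) := hfim ▸ mapsTo_image f E
  have hφ : MapsTo φ (Metric.ball 0 1) E := by
    rw [← hfim]
    rintro _ ⟨z, hz, rfl⟩
    rwa [hφf z hz]
  have hfφ : ∀ z ∈ Metric.ball (0 : ℂ) 1, f (φ z) = z := by
    rw [← hfim]
    rintro _ ⟨z, hz, rfl⟩
    rw [hφf z hz]
  obtain ⟨Φ, hΦc, hΦφ, hΦS, hΦS'⟩ := exists_continuous_extension hc hi hx hE hφ hφd
    hfd.continuousOn hfE hfφ hφf hb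
  have hSi := injOn_sphere_of_extension hc hi hE hφ hφd hfE hfφ hφf hΦc hΦφ hΦS
  have hΦE : MapsTo Φ (Metric.ball 0 1) E := fun z hz => by rw [hΦφ hz]; exact hφ hz
  have hSim : Φ '' Metric.sphere 0 1 = range γ := Subset.antisymm hΦS.image_subset hΦS'
  refine ⟨Φ, hΦc, ?_, ?_, hSim⟩
  · rw [← Metric.ball_union_sphere]
    rintro a (ha | ha) b (hb | hb) e
    · rw [hΦφ ha, hΦφ hb] at e
      rw [← hfφ a ha, ← hfφ b hb, e]
    · exact absurd (e ▸ hΦS hb) (hEJ (hΦE ha))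
    · exact absurd (e ▸ hΦS ha) (hEJ (hΦE hb))
    · exact hSi ha hb e
  · rw [← Metric.ball_union_sphere, image_union, hSim]
    congr 1
    refine Subset.antisymm hΦE.image_subset fun z hz => ⟨f z, hfE hz, ?_⟩
    rw [hΦφ (hfE hz), hφf z hz]

end

section

open Set Topology Filter

/-! ### Arcs in compact one-dimensional manifolds with boundary -/

section OneManifold

variable {Y : Type*} [TopologicalSpace Y]

/-- `k` is a coordinate, with inverse `e`, that identifies the part of `X` in the open set `W` with
the interval `I`, and the point `x` with `0`. -/
structure IsLocalInterval (X : Set Y) (x : Y) (I : Set ℝ) (W : Set Y) (k : Y → ℝ) (e : ℝ → Y) :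
    Prop where
  isOpen : IsOpen W
  mem : x ∈ X ∩ W
  continuousOn_coord : ContinuousOn k (X ∩ W)
  continuousOn_param : ContinuousOn e I
  mapsTo_coord : MapsTo k (X ∩ W) I
  mapsTo_param : MapsTo e I (X ∩ W)
  left_inv : ∀ z ∈ X ∩ W, e (k z) = z
  right_inv : ∀ u ∈ I, k (e u) = u
  coord_eq : k x = 0

/-- `X` is a one-dimensional manifold with boundary `P`. -/
structure IsOneManifold (X P : Set Y) : Prop where
  subset : P ⊆ X
  interior_chart : ∀ x ∈ X \ P, ∃ W k e, IsLocalInterval X x (Ioo (-1) 1) W k e ∧ Disjoint W P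
  boundary_chart : ∀ x ∈ P, ∃ W k e, IsLocalInterval X x (Ico 0 1) W k e ∧ W ∩ P ⊆ {x}

/-- `f` parametrizes an arc in `X` by the interval from `0` to `T`. -/
structure IsArcOn (X : Set Y) (f : ℝ → Y) (T : ℝ) : Prop where
  pos : 0 < T
  continuousOn : ContinuousOn f (Icc 0 T)
  injOn : InjOn f (Icc 0 T)
  mapsTo : MapsTo f (Icc 0 T) X

variable {X P : Set Y}

theorem IsLocalInterval.image_mem_nhdsWithin {x : Y} {I : Set ℝ} {W : Set Y} {k : Y → ℝ} {e : ℝ → Y}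
    (h : IsLocalInterval X x I W k e) {s : Set ℝ} (hs : s ∈ 𝓝[I] 0) : e '' (s ∩ I) ∈ 𝓝[X] x := by
  have h1 : Tendsto k (𝓝[X ∩ W] x) (𝓝[I] 0) := by
    refine tendsto_nhdsWithin_iff.2 ⟨?_, ?_⟩
    · have := h.continuousOn_coord x h.mem
      rwa [ContinuousWithinAt, h.coord_eq] at this
    · filter_upwards [self_mem_nhdsWithin] with z hz using h.mapsTo_coord hz
  rw [nhdsWithin_inter_of_mem' (mem_nhdsWithin_of_mem_nhds (h.isOpen.mem_nhds h.mem.2))] at h1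
  filter_upwards [h1 hs, self_mem_nhdsWithin, mem_nhdsWithin_of_mem_nhds (h.isOpen.mem_nhds h.mem.2)]
    with z hz hzX hzW
  exact ⟨k z, ⟨hz, h.mapsTo_coord ⟨hzX, hzW⟩⟩, h.left_inv z ⟨hzX, hzW⟩⟩

namespace IsArcOn

variable {f : ℝ → Y} {T : ℝ}

theorem mono (hf : IsArcOn X f T) {S : ℝ} (hS : 0 < S) (hST : S ≤ T) : IsArcOn X f S :=
  ⟨hS, hf.continuousOn.mono (Icc_subset_Icc_right hST), hf.injOn.mono (Icc_subset_Icc_right hST),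
    hf.mapsTo.mono_left (Icc_subset_Icc_right hST)⟩

theorem coord_facts (hf : IsArcOn X f T) {x : Y} {I : Set ℝ} {W : Set Y} {k : Y → ℝ} {e : ℝ → Y}
    (h : IsLocalInterval X x I W k e) {J : Set ℝ} (hJ : J ⊆ Icc 0 T) (hJW : ∀ s ∈ J, f s ∈ W) :
    ContinuousOn (k ∘ f) J ∧ InjOn (k ∘ f) J ∧ ∀ s ∈ J, e (k (f s)) = f s := by
  have hm : MapsTo f J (X ∩ W) := fun s hs => ⟨hf.mapsTo (hJ hs), hJW s hs⟩
  have hinv : ∀ s ∈ J, e (k (f s)) = f s := fun s hs => h.left_inv _ (hm hs)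
  refine ⟨h.continuousOn_coord.comp (hf.continuousOn.mono hJ) hm, fun s hs t ht e' => ?_, hinv⟩
  refine hf.injOn (hJ hs) (hJ ht) ?_
  rw [← hinv s hs, ← hinv t ht]
  exact congrArg e e'

/-- Invariance of domain in dimension one: in the coordinate, an injective path is strictly monotone
and by the intermediate value theorem covers a neighborhood of 0. The negative coordinate produced
here rules out boundary charts. -/
theorem image_Ioo_mem_nhdsWithin (hf : IsArcOn X f T) {t : ℝ} (ht : t ∈ Ioo 0 T) {I : Set ℝ}
    {W : Set Y} {k : Y → ℝ} {e : ℝ → Y} (h : IsLocalInterval X (f t) I W k e) :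
    f '' Ioo 0 T ∈ 𝓝[X] (f t) ∧ ∃ u ∈ I, u < 0 := by
  have hev : ∀ᶠ s in 𝓝 t, s ∈ Ioo 0 T ∧ f s ∈ W :=
    (Ioo_mem_nhds ht.1 ht.2 : Ioo 0 T ∈ 𝓝 t) |> fun h1 => (eventually_mem_set.2 h1).and
      ((hf.continuousOn.continuousAt (Icc_mem_nhds ht.1 ht.2)).eventually_mem
        (h.isOpen.mem_nhds h.mem.2))
  obtain ⟨η, hη, hη'⟩ := Metric.nhds_basis_closedBall.mem_iff.1 hev
  rw [Real.closedBall_eq_Icc] at hη'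
  have hIoo : Icc (t - η) (t + η) ⊆ Ioo 0 T := fun s hs => (hη' hs).1
  obtain ⟨gc, gi, ginv⟩ := hf.coord_facts h (hIoo.trans Ioo_subset_Icc_self) fun s hs => (hη' hs).2
  have hl : t - η ∈ Icc (t - η) (t + η) := ⟨le_rfl, by linarith⟩
  have hr : t + η ∈ Icc (t - η) (t + η) := ⟨by linarith, le_rfl⟩
  have hm : t ∈ Icc (t - η) (t + η) := ⟨by linarith, by linarith⟩
  have hg0 : (k ∘ f) t = 0 := h.coord_eq
  have hmI : ∀ s ∈ Icc (t - η) (t + η), (k ∘ f) s ∈ I := fun s hs =>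
    h.mapsTo_coord ⟨hf.mapsTo (Ioo_subset_Icc_self (hIoo hs)), (hη' hs).2⟩
  have hle : t - η ≤ t + η := by linarith
  have hivt : uIcc ((k ∘ f) (t - η)) ((k ∘ f) (t + η)) ⊆ (k ∘ f) '' Icc (t - η) (t + η) := by
    have := intermediate_value_uIcc (f := k ∘ f) (a := t - η) (b := t + η) (by rwa [uIcc_of_le hle])
    rwa [uIcc_of_le hle] at this
  have key : uIcc ((k ∘ f) (t - η)) ((k ∘ f) (t + η)) ∈ 𝓝 (0 : ℝ) ∧ ∃ u ∈ I, u < 0 := by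
    rcases gc.strictMonoOn_of_injOn_Icc' hle gi with hmono | hanti
    · have h1 := hmono hl hm (by linarith)
      have h2 := hmono hm hr (by linarith)
      rw [hg0] at h1 h2
      rw [uIcc_of_le (h1.trans h2).le]
      exact ⟨Icc_mem_nhds h1 h2, _, hmI _ hl, h1⟩
    · have h1 := hanti hl hm (by linarith)
      have h2 := hanti hm hr (by linarith)
      rw [hg0] at h1 h2
      rw [uIcc_of_ge (h2.trans h1).le]
      exact ⟨Icc_mem_nhds h2 h1, _, hmI _ hr, h2⟩
  refine ⟨mem_of_superset (h.image_mem_nhdsWithin (mem_nhdsWithin_of_mem_nhds key.1)) ?_, key.2⟩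
  rintro _ ⟨u, ⟨hu, -⟩, rfl⟩
  obtain ⟨s, hs, rfl⟩ := hivt hu
  exact ⟨s, hIoo hs, (ginv s hs).symm⟩

theorem image_Ico_mem_nhdsWithin (hf : IsArcOn X f T) {I : Set ℝ} (hI : ∀ u ∈ I, 0 ≤ u)
    {W : Set Y} {k : Y → ℝ} {e : ℝ → Y} (h : IsLocalInterval X (f 0) I W k e) :
    f '' Ico 0 T ∈ 𝓝[X] (f 0) := by
  have h0 : (0 : ℝ) ∈ Icc 0 T := left_mem_Icc.2 hf.pos.le
  have hev : ∀ᶠ s in 𝓝[Icc 0 T] 0, s < T ∧ f s ∈ W :=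
    ((eventually_lt_nhds hf.pos).filter_mono nhdsWithin_le_nhds).and
      ((hf.continuousOn 0 h0).eventually_mem (h.isOpen.mem_nhds h.mem.2))
  obtain ⟨η, hη, hη'⟩ := Metric.mem_nhdsWithin_iff.1 hev
  have hηT : Icc 0 (min (η / 2) (T / 2)) ⊆ Metric.ball 0 η ∩ Icc 0 T := fun s hs => by
    have h1 := hs.2.trans (min_le_left _ _)
    have h2 := hs.2.trans (min_le_right _ _)
    have := hf.pos
    refine ⟨?_, hs.1, by linarith⟩
    rw [Metric.mem_ball, Real.dist_eq, sub_zero, abs_of_nonneg hs.1]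
    linarith
  set η' := min (η / 2) (T / 2)
  have hη0 : 0 < η' := lt_min (by linarith) (by linarith [hf.pos])
  obtain ⟨gc, gi, ginv⟩ := hf.coord_facts h (fun s hs => (hηT hs).2) fun s hs => (hη' (hηT hs)).2
  have hl : (0 : ℝ) ∈ Icc 0 η' := left_mem_Icc.2 hη0.le
  have hr : η' ∈ Icc 0 η' := right_mem_Icc.2 hη0.le
  have hg0 : (k ∘ f) 0 = 0 := h.coord_eq
  have hpos : 0 < (k ∘ f) η' := by
    refine lt_of_le_of_ne (hI _ (h.mapsTo_coord ⟨hf.mapsTo (hηT hr).2, (hη' (hηT hr)).2⟩)) ?_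
    rw [← hg0]
    exact fun e' => hη0.ne (gi hl hr e')
  refine mem_of_superset (h.image_mem_nhdsWithin (mem_nhdsWithin_of_mem_nhds (Iic_mem_nhds hpos))) ?_
  rintro _ ⟨u, ⟨hu, huI⟩, rfl⟩
  obtain ⟨s, hs, rfl⟩ := intermediate_value_Icc hη0.le gc (by rw [hg0]; exact ⟨hI u huI, hu⟩)
  exact ⟨s, ⟨hs.1, (hη' (hηT hs)).1⟩, (ginv s hs).symm⟩

/-- An arc can be continued by a piece of a chart that it has not met before. -/
theorem concat (hf : IsArcOn X f T) {x : Y} {I : Set ℝ} {W : Set Y} {k : Y → ℝ} {e : ℝ → Y}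
    (h : IsLocalInterval X x I W k e) {Q : Set ℝ} (hQI : Q ⊆ I) (hQ : ∀ t ∈ Ico 0 T, f t ∉ e '' Q)
    {u : ℝ → ℝ} {l : ℝ} (hl : 0 < l) (hu : ContinuousOn u (Icc 0 l)) (ui : InjOn u (Icc 0 l))
    (huQ : MapsTo u (Icc 0 l) Q) (hu0 : e (u 0) = f T) :
    ∃ F, IsArcOn X F (T + l) ∧ EqOn F f (Icc 0 T) ∧ ∀ t ∈ Icc 0 l, F (T + t) = e (u t) := by
  set F : ℝ → Y := fun t => if t ≤ T then f t else e (u (t - T)) with hF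
  have h1 : EqOn F f (Icc 0 T) := fun t ht => if_pos ht.2
  have h2 : ∀ t ∈ Icc 0 l, F (T + t) = e (u t) := by
    intro t ht
    rcases ht.1.eq_or_lt with rfl | ht0
    · rw [hu0, add_zero]; exact if_pos le_rfl
    · simp [hF, ht0]
  have h2' : EqOn F (fun t => e (u (t - T))) (Icc T (T + l)) := fun t ht => by
    have := h2 (t - T) ⟨by linarith [ht.1], by linarith [ht.2]⟩
    rwa [add_sub_cancel] at this
  have hT := hf.pos
  have hsub : MapsTo (fun t => t - T) (Icc T (T + l)) (Icc 0 l) := fun t ht =>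
    ⟨by linarith [ht.1], by linarith [ht.2]⟩
  have hun : Icc 0 (T + l) = Icc 0 T ∪ Icc T (T + l) :=
    (Icc_union_Icc_eq_Icc hT.le (by linarith)).symm
  have hec : ContinuousOn (fun t => e (u (t - T))) (Icc T (T + l)) :=
    (h.continuousOn_param.mono hQI).comp (hu.comp (by fun_prop) hsub) fun t ht => huQ (hsub ht)
  have einj : InjOn e I := fun a ha b hb e' => by rw [← h.right_inv a ha, ← h.right_inv b hb, e']
  refine ⟨F, ⟨by linarith, ?_, ?_, ?_⟩, h1, h2⟩
  · rw [hun]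
    exact (hf.continuousOn.congr h1).union_of_isClosed (hec.congr h2') isClosed_Icc isClosed_Icc
  · have key : ∀ t ∈ Icc 0 (T + l), ∀ s ∈ Icc 0 (T + l), F t = F s → t < s → False := by
      intro t ht s hs e' hts
      rcases le_or_gt s T with hsT | hsT
      · rw [h1 ⟨ht.1, hts.le.trans hsT⟩, h1 ⟨hs.1, hsT⟩] at e'
        exact hts.ne (hf.injOn ⟨ht.1, hts.le.trans hsT⟩ ⟨hs.1, hsT⟩ e')
      · rw [h2' ⟨hsT.le, hs.2⟩] at e'
        have hs' := hsub ⟨hsT.le, hs.2⟩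
        rcases lt_or_ge t T with htT | htT
        · rw [h1 ⟨ht.1, htT.le⟩] at e'
          exact hQ t ⟨ht.1, htT⟩ ⟨_, huQ hs', e'.symm⟩
        · have ht' := hsub ⟨htT, ht.2⟩
          rw [h2' ⟨htT, ht.2⟩] at e'
          have := ui ht' hs' (einj (hQI (huQ ht')) (hQI (huQ hs')) e')
          linarith
    intro t ht s hs e'
    rcases lt_trichotomy t s with h3 | h3 | h3
    · exact (key t ht s hs e' h3).elim
    · exact h3
    · exact (key s hs t ht e'.symm h3).elim
  · rw [hun]
    rintro t (ht | ht)
    · rw [h1 ht]; exact hf.mapsTo ht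
    · rw [h2' ht]; exact (h.mapsTo_param (hQI (huQ (hsub ht)))).1

/-- The core of the chart, the coordinates of absolute value at most `1 / 2`, is compact, so there
is a first time in it. Entry at a coordinate of absolute value below `1 / 2` is impossible, since
slightly earlier the path would already be in the core. -/
theorem exists_first_entry [T2Space Y] (hf : IsArcOn X f T) {x : Y} {I : Set ℝ} {W : Set Y} {k : Y → ℝ}
    {e : ℝ → Y} (h : IsLocalInterval X x I W k e) (hI : IsCompact (I ∩ Icc (-(1 / 2)) (1 / 2)))
    (h0 : f 0 ∉ e '' (I ∩ Icc (-(1 / 2)) (1 / 2))) {t : ℝ} (ht : t ∈ Icc 0 T)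
    (hft : f t ∈ e '' (I ∩ Icc (-(1 / 2)) (1 / 2))) :
    ∃ S, IsArcOn X f S ∧ (∀ t ∈ Ico 0 S, f t ∉ e '' (I ∩ Icc (-(1 / 2)) (1 / 2))) ∧
      ∃ u ∈ I, |u| = 1 / 2 ∧ e u = f S := by
  set Q := e '' (I ∩ Icc (-(1 / 2)) (1 / 2)) with hQ
  have hQc : IsClosed Q := (hI.image_of_continuousOn
    (h.continuousOn_param.mono inter_subset_left)).isClosed
  have hZ : IsCompact (Icc 0 T ∩ f ⁻¹' Q) := isCompact_Icc.of_isClosed_subset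
    (hf.continuousOn.preimage_isClosed_of_isClosed isClosed_Icc hQc) inter_subset_left
  obtain ⟨S, ⟨hST, hSQ⟩, hS⟩ := hZ.exists_isLeast ⟨t, ht, hft⟩
  have hS0 : 0 < S := hST.1.lt_of_ne (by rintro rfl; exact h0 hSQ)
  have hmin : ∀ t ∈ Ico 0 S, f t ∉ Q := fun t ht htQ =>
    ht.2.not_ge (hS ⟨⟨ht.1, ht.2.le.trans hST.2⟩, htQ⟩)
  refine ⟨S, hf.mono hS0 hST.2, hmin, ?_⟩
  obtain ⟨u, hu, huS⟩ := hSQ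
  refine ⟨u, hu.1, ?_, huS⟩
  refine le_antisymm (abs_le.2 hu.2) ?_
  by_contra! hlt
  have hSW : f S ∈ X ∩ W := huS ▸ h.mapsTo_param hu.1
  have hkS : k (f S) = u := by rw [← huS, h.right_inv u hu.1]
  have h1 : Tendsto f (𝓝[Ico 0 S] S) (𝓝[X ∩ W] (f S)) := by
    have h2 : Tendsto f (𝓝[Ico 0 S] S) (𝓝 (f S)) :=
      (hf.continuousOn S hST).mono_left (nhdsWithin_mono _ fun s hs => ⟨hs.1, hs.2.le.trans hST.2⟩)
    refine tendsto_nhdsWithin_iff.2 ⟨h2, ?_⟩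
    filter_upwards [self_mem_nhdsWithin, h2 (h.isOpen.mem_nhds hSW.2)] with s hs hsW
    exact ⟨hf.mapsTo ⟨hs.1, hs.2.le.trans hST.2⟩, hsW⟩
  have h3 : Tendsto (fun s => |k (f s)|) (𝓝[Ico 0 S] S) (𝓝 |u|) := by
    rw [← hkS]
    exact ((h.continuousOn_coord (f S) hSW).tendsto.comp h1).abs
  have hne : (𝓝[Ico 0 S] S).NeBot := mem_closure_iff_nhdsWithin_neBot.1 (by
    rw [closure_Ico hS0.ne]; exact right_mem_Icc.2 hS0.le)
  obtain ⟨s, hs1, hs2, hs3⟩ := ((h3.eventually_lt_const hlt).and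
    ((tendsto_nhdsWithin_iff.1 h1).2.and self_mem_nhdsWithin)).exists
  exact hmin s hs3 ⟨k (f s), ⟨h.mapsTo_coord hs2, abs_le.1 hs1.le⟩, h.left_inv _ hs2⟩

end IsArcOn

theorem Ico_inter_Icc_half : Ico (0 : ℝ) 1 ∩ Icc (-(1 / 2)) (1 / 2) = Icc 0 (1 / 2) := by
  ext u
  exact ⟨fun h => ⟨h.1.1, h.2.2⟩, fun h => ⟨⟨h.1, by linarith [h.2]⟩, by linarith [h.1], h.2⟩⟩

theorem Ioo_inter_Icc_half : Ioo (-1 : ℝ) 1 ∩ Icc (-(1 / 2)) (1 / 2) = Icc (-(1 / 2)) (1 / 2) :=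
  inter_eq_right.2 fun u h => ⟨by linarith [h.1], by linarith [h.2]⟩

namespace IsOneManifold

variable (hX : IsOneManifold X P)
include hX

theorem notMem_of_mem_Ioo {f : ℝ → Y} {T t : ℝ} (hf : IsArcOn X f T) (ht : t ∈ Ioo 0 T) :
    f t ∉ P := by
  intro h
  obtain ⟨W, k, e, hW, -⟩ := hX.boundary_chart _ h
  obtain ⟨-, u, hu, hu0⟩ := hf.image_Ioo_mem_nhdsWithin ht hW
  exact hu0.not_ge hu.1

theorem image_Ico_mem_nhdsWithin {f : ℝ → Y} {T : ℝ} (hf : IsArcOn X f T) (h0 : f 0 ∈ P) {z : Y}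
    (hz : z ∈ f '' Ico 0 T) : f '' Ico 0 T ∈ 𝓝[X] z := by
  obtain ⟨t, ht, rfl⟩ := hz
  rcases ht.1.eq_or_lt with rfl | ht0
  · obtain ⟨W, k, e, hW, -⟩ := hX.boundary_chart _ h0
    exact hf.image_Ico_mem_nhdsWithin (fun u hu => hu.1) hW
  · obtain ⟨W, k, e, hW, -⟩ := hX.interior_chart (f t)
      ⟨hf.mapsTo (Ico_subset_Icc_self ht), hX.notMem_of_mem_Ioo hf ⟨ht0, ht.2⟩⟩
    exact mem_of_superset (hf.image_Ioo_mem_nhdsWithin ⟨ht0, ht.2⟩ hW).1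
      (image_mono Ioo_subset_Ico_self)

variable [T2Space Y]

/-- The half-open arc of `f` is open in `X`, and closed up to the single point `f S`. A connected
set that starts on it and misses `f S` cannot leave it. -/
theorem image_Ico_subset {f g : ℝ → Y} {S T : ℝ} (hf : IsArcOn X f S) (hg : IsArcOn X g T)
    (h0 : f 0 = g 0) (hP : f 0 ∈ P) (h : f S ∉ g '' Ico 0 T) : g '' Ico 0 T ⊆ f '' Ico 0 S := by
  have hgp : IsPreconnected (g '' Ico 0 T) :=
    isPreconnected_Ico.image _ (hg.continuousOn.mono Ico_subset_Icc_self)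
  have hfc : IsClosed (f '' Icc 0 S) := (isCompact_Icc.image_of_continuousOn hf.continuousOn).isClosed
  set u := interior {z | z ∈ X → z ∈ f '' Ico 0 S} with hu
  have huX : ∀ z ∈ X, z ∈ u → z ∈ f '' Ico 0 S := fun z hz hzu => interior_subset hzu hz
  have hfu : f '' Ico 0 S ⊆ u := fun z hz => by
    have := hX.image_Ico_mem_nhdsWithin hf hP hz
    exact mem_interior_iff_mem_nhds.2 (mem_inf_principal.1 this)
  have hgX : g '' Ico 0 T ⊆ X := by
    rintro _ ⟨t, ht, rfl⟩; exact hg.mapsTo (Ico_subset_Icc_self ht)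
  have hg0 : g 0 ∈ g '' Ico 0 T := ⟨0, left_mem_Ico.2 hg.pos, rfl⟩
  have hcov : g '' Ico 0 T ⊆ u ∪ (f '' Icc 0 S)ᶜ := by
    intro z hz
    by_cases hzf : z ∈ f '' Icc 0 S
    · obtain ⟨s, hs, rfl⟩ := hzf
      refine .inl (hfu ⟨s, ⟨hs.1, hs.2.lt_of_ne ?_⟩, rfl⟩)
      rintro rfl
      exact h hz
    · exact .inr hzf
  have hdisj : g '' Ico 0 T ∩ (u ∩ (f '' Icc 0 S)ᶜ) = ∅ :=
    eq_empty_of_forall_notMem fun z ⟨hz, hz1, hz2⟩ =>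
      hz2 (image_mono Ico_subset_Icc_self (huX z (hgX hz) hz1))
  rcases isPreconnected_iff_subset_of_disjoint.1 hgp u (f '' Icc 0 S)ᶜ isOpen_interior
    hfc.isOpen_compl hcov hdisj with h1 | h1
  · exact fun z hz => huX z (hgX hz) (h1 hz)
  · exact absurd ⟨0, left_mem_Icc.2 hf.pos.le, h0⟩ (h1 hg0)

/-- If neither end point lies on the other half-open arc, a containment is immediate. If both do,
shortening `g` to end at `f S` puts `g T` on an earlier part of `g`, against injectivity. So arcs
from a common boundary point are nested. -/
theorem image_Ico_total {f g : ℝ → Y} {S T : ℝ} (hf : IsArcOn X f S) (hg : IsArcOn X g T)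
    (h0 : f 0 = g 0) (hP : f 0 ∈ P) :
    g '' Ico 0 T ⊆ f '' Ico 0 S ∨ f '' Ico 0 S ⊆ g '' Ico 0 T := by
  by_cases h1 : f S ∈ g '' Ico 0 T; swap
  · exact .inl (hX.image_Ico_subset hf hg h0 hP h1)
  by_cases h2 : g T ∈ f '' Ico 0 S; swap
  · exact .inr (hX.image_Ico_subset hg hf h0.symm (h0 ▸ hP) h2)
  exfalso
  obtain ⟨s, hs, hsf⟩ := h1
  have hs0 : 0 < s := hs.1.lt_of_ne (by
    rintro rfl
    rw [← h0] at hsf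
    exact hf.pos.ne (hf.injOn (left_mem_Icc.2 hf.pos.le) (right_mem_Icc.2 hf.pos.le) hsf))
  have hg' := hg.mono hs0 hs.2.le
  have h3 : g s ∉ f '' Ico 0 S := by
    rintro ⟨r, hr, hrs⟩
    rw [hsf] at hrs
    exact hr.2.ne (hf.injOn (Ico_subset_Icc_self hr) (right_mem_Icc.2 hf.pos.le) hrs)
  obtain ⟨r, hr, hrT⟩ := hX.image_Ico_subset hg' hf h0.symm (h0 ▸ hP) h3 h2
  have := hg.injOn ⟨hr.1, hr.2.le.trans hs.2.le⟩ (right_mem_Icc.2 hg.pos.le) hrT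
  linarith [hr.2, hs.2]

/-- A boundary point of a compact one-dimensional manifold is joined by an arc to another boundary
point. -/
theorem exists_arc (hXc : IsCompact X) {p : Y} (hp : p ∈ P) :
    ∃ f T, IsArcOn X f T ∧ f 0 = p ∧ f T ∈ P := by
  by_contra! H
  -- The set reached by half-open arcs from `p`. Assuming that no arc ends in `P`, it is shown to be
  -- compact; being a directed union of relatively open arcs, it is then covered by a single one,
  -- whose end point gives a contradiction.
  set S : Set Y := {z | ∃ f T, IsArcOn X f T ∧ f 0 = p ∧ z ∈ f '' Ico 0 T} with hS
  have hSX : S ⊆ X := by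
    rintro _ ⟨f, T, hf, -, t, ht, rfl⟩
    exact hf.mapsTo (Ico_subset_Icc_self ht)
  have hloc : ∀ x ∈ X \ P, ∃ O ∈ 𝓝[X] x, (O ∩ S).Nonempty → O ⊆ S := by
    rintro x hx
    obtain ⟨W, k, e, hW, hWP⟩ := hX.interior_chart x hx
    refine ⟨_, hW.image_mem_nhdsWithin (s := Ioo (-(1 / 2)) (1 / 2))
      (mem_nhdsWithin_of_mem_nhds (Ioo_mem_nhds (by norm_num) (by norm_num))), ?_⟩
    rintro ⟨_, ⟨u₁, hu₁, rfl⟩, f, T, hf, hf0, t, ht, hft⟩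
    obtain ⟨S, hfS, hSQ, u, huI, hu, huS⟩ := hf.exists_first_entry hW
      (by rw [Ioo_inter_Icc_half]; exact isCompact_Icc) (by
        rintro ⟨v, hv, hv0⟩
        refine hWP.le_bot ⟨(hW.mapsTo_param hv.1).2, ?_⟩
        rw [hv0, hf0]; exact hp) (Ico_subset_Icc_self ht)
      ⟨u₁, ⟨hu₁.2, Ioo_subset_Icc_self hu₁.1⟩, hft.symm⟩
    rw [Ioo_inter_Icc_half] at hSQ
    have hu2 : u * u = 1 / 4 := by rw [← abs_mul_abs_self, hu]; norm_num
    have hue := eq_or_eq_neg_of_abs_eq hu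
    -- The arc is stopped where it first enters the core and then continued straight through to the
    -- opposite end, so it passes every point of the core.
    obtain ⟨F, hF, hF1, hF2⟩ := hfS.concat hW (Q := Icc (-(1 / 2)) (1 / 2))
      (Ioo_inter_Icc_half ▸ inter_subset_left) hSQ (u := fun s => u * (1 - 2 * s)) one_pos
      (by fun_prop) (fun a _ b _ e' => by
        have : u ≠ 0 := by rintro rfl; norm_num at hu2
        have := mul_left_cancel₀ this e'
        linarith) (fun s hs => by
        rcases hue with rfl | rfl
        · constructor <;> linarith [hs.1, hs.2]
        · constructor <;> linarith [hs.1, hs.2]) (by simpa using huS)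
    rintro _ ⟨v, ⟨hv, hvI⟩, rfl⟩
    refine ⟨F, _, hF, ?_, ?_⟩
    · rw [hF1 (left_mem_Icc.2 hfS.pos.le), hf0]
    · have hv' : 1 / 2 - 2 * u * v ∈ Ioo (0 : ℝ) 1 := by
        rcases hue with rfl | rfl
        · constructor <;> linarith [hv.1, hv.2]
        · constructor <;> linarith [hv.1, hv.2]
      refine ⟨S + (1 / 2 - 2 * u * v), ⟨by linarith [hfS.pos, hv'.1], by linarith [hv'.2]⟩, ?_⟩
      rw [hF2 _ (Ioo_subset_Icc_self hv')]
      congr 1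
      linear_combination 4 * v * hu2
  have hlocp : ∃ O ∈ 𝓝[X] p, O ⊆ S := by
    obtain ⟨W, k, e, hW, -⟩ := hX.boundary_chart p hp
    refine ⟨_, hW.image_mem_nhdsWithin (s := Iio (1 / 2))
      (mem_nhdsWithin_of_mem_nhds (Iio_mem_nhds (by norm_num))), ?_⟩
    rintro _ ⟨u, ⟨hu, huI⟩, rfl⟩
    refine ⟨e, 1 / 2, ⟨by norm_num, hW.continuousOn_param.mono ?_, fun a ha b hb e' => ?_,
      fun a ha => (hW.mapsTo_param ⟨ha.1, by linarith [ha.2]⟩).1⟩, ?_, u, ⟨huI.1, hu⟩, rfl⟩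
    · exact fun a ha => ⟨ha.1, by linarith [ha.2]⟩
    · rw [← hW.right_inv a ⟨ha.1, by linarith [ha.2]⟩, ← hW.right_inv b ⟨hb.1, by linarith [hb.2]⟩, e']
    · rw [← hW.coord_eq, hW.left_inv p hW.mem]
  -- Otherwise an arc that comes close to `x` could be continued inside the boundary chart until it
  -- ends at `x`.
  have hlocP : ∀ x ∈ P, x ≠ p → ∃ O ∈ 𝓝[X] x, O ∩ S = ∅ := by
    intro x hx hxp
    obtain ⟨W, k, e, hW, hWP⟩ := hX.boundary_chart x hx
    refine ⟨_, hW.image_mem_nhdsWithin (s := Iio (1 / 2))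
      (mem_nhdsWithin_of_mem_nhds (Iio_mem_nhds (by norm_num))), eq_empty_of_forall_notMem ?_⟩
    rintro _ ⟨⟨u₁, hu₁, rfl⟩, f, T, hf, hf0, t, ht, hft⟩
    obtain ⟨S, hfS, hSQ, u, huI, hu, huS⟩ := hf.exists_first_entry hW
      (by rw [Ico_inter_Icc_half]; exact isCompact_Icc) (by
        rintro ⟨v, hv, hv0⟩
        refine hxp (hWP ⟨(hW.mapsTo_param hv.1).2, ?_⟩ ▸ ?_)
        · rw [hv0, hf0]; exact hp
        · rw [hv0, hf0]) (Ico_subset_Icc_self ht)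
      ⟨u₁, ⟨hu₁.2, by linarith [hu₁.2.1], (hu₁.1 : u₁ < 1 / 2).le⟩, hft.symm⟩
    rw [Ico_inter_Icc_half] at hSQ
    rw [abs_of_nonneg huI.1] at hu
    obtain ⟨F, hF, hF1, hF2⟩ := hfS.concat hW (Q := Icc 0 (1 / 2))
      (Ico_inter_Icc_half ▸ inter_subset_left) hSQ (u := fun s => 1 / 2 - s) (l := 1 / 2)
      (by norm_num) (by fun_prop) (fun a _ b _ e' => sub_right_injective e')
      (fun s hs => ⟨by linarith [hs.2], by linarith [hs.1]⟩) (by rw [sub_zero, ← hu, huS])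
    refine H F _ hF (by rw [hF1 (left_mem_Icc.2 hfS.pos.le), hf0]) ?_
    rw [hF2 _ (right_mem_Icc.2 (by norm_num)), sub_self, ← hW.coord_eq, hW.left_inv x hW.mem]
    exact hx
  have hSc : IsCompact S := by
    refine hXc.of_isClosed_subset (isOpen_compl_iff.1 (isOpen_iff_mem_nhds.2 fun z hz => ?_)) hSX
    by_cases hzX : z ∈ X; swap
    · exact mem_of_superset (hXc.isClosed.isOpen_compl.mem_nhds hzX) (compl_subset_compl.2 hSX)
    obtain ⟨O, hO, hOS⟩ : ∃ O ∈ 𝓝[X] z, O ∩ S = ∅ := by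
      by_cases hzP : z ∈ P
      · refine hlocP z hzP ?_
        rintro rfl
        obtain ⟨O, hO, hOS⟩ := hlocp
        exact hz (hOS (mem_of_mem_nhdsWithin hzX hO))
      · obtain ⟨O, hO, hOS⟩ := hloc z ⟨hzX, hzP⟩
        refine ⟨O, hO, not_nonempty_iff_eq_empty.1 fun h => ?_⟩
        exact hz (hOS h (mem_of_mem_nhdsWithin hzX hO))
    filter_upwards [mem_inf_principal.1 hO] with w hw hwS
    exact (hOS ▸ (⟨hw (hSX hwS), hwS⟩ : w ∈ O ∩ S) : w ∈ (∅ : Set Y))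
  set ι := {q : (ℝ → Y) × ℝ // IsArcOn X q.1 q.2 ∧ q.1 0 = p}
  set U : ι → Set Y := fun i => interior {z | z ∈ X → z ∈ i.1.1 '' Ico 0 i.1.2} with hU
  have hpS : p ∈ S := by
    obtain ⟨O, hO, hOS⟩ := hlocp
    exact hOS (mem_of_mem_nhdsWithin (hX.subset hp) hO)
  have : Nonempty ι := by
    obtain ⟨f, T, hf, hf0, -⟩ := hpS
    exact ⟨⟨(f, T), hf, hf0⟩⟩
  obtain ⟨⟨⟨f, T⟩, hf, hf0⟩, hST⟩ := hSc.elim_directed_cover U (fun _ => isOpen_interior) (by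
      rintro z ⟨f, T, hf, hf0, hz⟩
      refine mem_iUnion.2 ⟨⟨(f, T), hf, hf0⟩, mem_interior_iff_mem_nhds.2 (mem_inf_principal.1 ?_)⟩
      exact hX.image_Ico_mem_nhdsWithin hf (hf0 ▸ hp) hz) (by
      rintro ⟨⟨f, S⟩, hf, hf0⟩ ⟨⟨g, T⟩, hg, hg0⟩
      have hmono : ∀ A B : Set Y, A ⊆ B → interior {z | z ∈ X → z ∈ A} ⊆ interior {z | z ∈ X → z ∈ B} :=
        fun A B h => interior_mono fun z hz hzX => h (hz hzX)
      rcases hX.image_Ico_total hf hg (hf0.trans hg0.symm) (by rw [hf0]; exact hp) with h | h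
      · exact ⟨⟨(f, S), hf, hf0⟩, subset_rfl, hmono _ _ h⟩
      · exact ⟨⟨(g, T), hg, hg0⟩, hmono _ _ h, subset_rfl⟩)
  have hTm := right_mem_Icc.2 hf.pos.le
  have hTX := hf.mapsTo hTm
  obtain ⟨O, hO, hOS⟩ := hloc (f T) ⟨hTX, H f T hf hf0⟩
  -- The end point is a limit of points of `S` and not in `P`, so it belongs to `S`, hence to the
  -- half-open arc itself, against injectivity.
  have hTS : f T ∈ S := by
    refine hOS ?_ (mem_of_mem_nhdsWithin hTX hO)
    have h1 : Tendsto f (𝓝[Ico 0 T] T) (𝓝[X] (f T)) := by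
      refine tendsto_nhdsWithin_iff.2 ⟨(hf.continuousOn T hTm).mono_left
        (nhdsWithin_mono _ Ico_subset_Icc_self), ?_⟩
      filter_upwards [self_mem_nhdsWithin] with s hs using hf.mapsTo (Ico_subset_Icc_self hs)
    have hne : (𝓝[Ico 0 T] T).NeBot := mem_closure_iff_nhdsWithin_neBot.1 (by
      rw [closure_Ico hf.pos.ne]; exact hTm)
    obtain ⟨s, hs1, hs2⟩ := ((h1.eventually_mem hO).and self_mem_nhdsWithin).exists
    exact ⟨f s, hs1, f, T, hf, hf0, s, hs2, rfl⟩
  obtain ⟨s, hs, hsT⟩ := interior_subset (hST hTS) hTX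
  exact hs.2.ne (hf.injOn (Ico_subset_Icc_self hs) hTm hsT)

/-- A boundary point `p` of a compact one-dimensional manifold is the end point of an arc that is
open in the manifold and whose other end point is the only other boundary point on it. -/
theorem exists_open_arc (hXc : IsCompact X) {p : Y} (hp : p ∈ P) :
    ∃ g : ℝ → Y, ContinuousOn g (Icc 0 1) ∧ InjOn g (Icc 0 1) ∧ MapsTo g (Icc 0 1) X ∧
      g 0 = p ∧ g 1 ∈ P ∧ (∀ t ∈ Ioo (0 : ℝ) 1, g t ∉ P) ∧
      ∀ z ∈ g '' Icc 0 1, g '' Icc 0 1 ∈ 𝓝[X] z := by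
  obtain ⟨f, T, hf, hf0, hfT⟩ := hX.exists_arc hXc hp
  have hT := hf.pos
  have hm : MapsTo (fun t => T * t) (Icc 0 1) (Icc 0 T) := fun t ht =>
    ⟨mul_nonneg hT.le ht.1, mul_le_of_le_one_right hT.le ht.2⟩
  have him : (fun t => f (T * t)) '' Icc 0 1 = f '' Icc 0 T := by
    refine Subset.antisymm ?_ ?_
    · rintro _ ⟨t, ht, rfl⟩
      exact ⟨_, hm ht, rfl⟩
    · rintro _ ⟨t, ht, rfl⟩
      exact ⟨t / T, ⟨div_nonneg ht.1 hT.le, (div_le_one hT).2 ht.2⟩, by beta_reduce; congr 1; field_simp⟩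
  refine ⟨fun t => f (T * t), hf.continuousOn.comp (by fun_prop) hm, fun a ha b hb e' =>
    mul_left_cancel₀ hT.ne' (hf.injOn (hm ha) (hm hb) e'), hf.mapsTo.comp hm, by simpa using hf0,
    by simpa using hfT, fun t ht => hX.notMem_of_mem_Ioo hf ⟨mul_pos hT ht.1, mul_lt_of_lt_one_right hT ht.2⟩,
    ?_⟩
  rw [him]
  rintro _ ⟨t, ht, rfl⟩
  rcases ht.2.eq_or_lt with rfl | htT
  -- At the far end the arc is reversed, so that this boundary point becomes the starting point.
  · have hr : MapsTo (fun s => t - s) (Icc 0 t) (Icc 0 t) := fun s hs =>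
      ⟨by linarith [hs.2], by linarith [hs.1]⟩
    have hf' : IsArcOn X (fun s => f (t - s)) t :=
      ⟨hT, hf.continuousOn.comp (by fun_prop) hr, fun a ha b hb e' =>
        sub_right_injective (hf.injOn (hr ha) (hr hb) e'), hf.mapsTo.comp hr⟩
    have := hX.image_Ico_mem_nhdsWithin hf' (by simpa using hfT) (z := f t)
      ⟨0, left_mem_Ico.2 hT, by simp⟩
    refine mem_of_superset this ?_
    rintro _ ⟨s, hs, rfl⟩
    exact ⟨_, hr (Ico_subset_Icc_self hs), rfl⟩
  · exact mem_of_superset (hX.image_Ico_mem_nhdsWithin hf (hf0 ▸ hp) ⟨t, ⟨ht.1, htT⟩, rfl⟩)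
      (image_mono Ico_subset_Icc_self)

end IsOneManifold

end OneManifold

end

section

open Set Topology Filter

/-! ### Regions with boundary crossed by a Jordan curve -/

section Chart

variable {Y : Type*} [TopologicalSpace Y]

/-- Around `p` the set `M` is a half-plane in some chart. -/
def HasHalfPlaneChart (M : Set Y) (p : Y) : Prop :=
  ∃ ψ : OpenPartialHomeomorph Y (EuclideanSpace ℝ (Fin 2)),
    p ∈ ψ.source ∧ ∀ q ∈ ψ.source, q ∈ M ↔ 0 ≤ ψ q 0

theorem mem_frontier_iff_of_halfPlane {M : Set Y}
    {ψ : OpenPartialHomeomorph Y (EuclideanSpace ℝ (Fin 2))}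
    (hψ : ∀ q ∈ ψ.source, q ∈ M ↔ 0 ≤ ψ q 0) {q : Y} (hq : q ∈ ψ.source) :
    q ∈ frontier M ↔ ψ q 0 = 0 := by
  have h : ψ.IsImage M {y | (0 : ℝ) ≤ y 0} := fun q hq => (hψ q hq).symm
  have h1 := h.frontier hq
  rw [frontier_halfSpace] at h1
  rw [← h1, mem_ofPred_eq, eq_comm]

theorem mem_interior_iff_of_halfPlane {M : Set Y}
    {ψ : OpenPartialHomeomorph Y (EuclideanSpace ℝ (Fin 2))}
    (hψ : ∀ q ∈ ψ.source, q ∈ M ↔ 0 ≤ ψ q 0) {q : Y} (hq : q ∈ ψ.source) :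
    q ∈ interior M ↔ 0 < ψ q 0 := by
  rw [← self_sdiff_frontier, Set.mem_sdiff, hψ q hq, mem_frontier_iff_of_halfPlane hψ hq, lt_iff_le_and_ne,
    ne_comm, Ne]

theorem HasHalfPlaneChart.exists_isLocalInterval {M : Set Y} {p : Y} (h : HasHalfPlaneChart M p)
    (hp : p ∈ frontier M) {V : Set Y} (hV : V ∈ 𝓝 p) :
    ∃ W k e, IsLocalInterval (frontier M) p (Ioo (-1) 1) W k e ∧ W ⊆ V := by
  obtain ⟨ψ, hpψ, hψ⟩ := h
  have hfr : ∀ q ∈ ψ.source, q ∈ frontier M ↔ ψ q 0 = 0 := fun q hq =>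
    mem_frontier_iff_of_halfPlane hψ hq
  have hV' : ψ.target ∩ ψ.symm ⁻¹' V ∈ 𝓝 (ψ p) := by
    refine inter_mem (ψ.open_target.mem_nhds (ψ.map_source hpψ)) ?_
    refine (ψ.continuousAt_symm (ψ.map_source hpψ)).preimage_mem_nhds ?_
    rwa [ψ.left_inv hpψ]
  obtain ⟨ρ, hρ, hρV⟩ := Metric.mem_nhds_iff.1 hV'
  set y := ψ p with hy
  set v : EuclideanSpace ℝ (Fin 2) := EuclideanSpace.single 1 1 with hv
  have hv0 : v 0 = 0 := by simp [hv]
  have hv1 : v 1 = 1 := by simp [hv]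
  have hvn : ‖v‖ = 1 := by simp [hv]
  have hy0 : y 0 = 0 := (hfr p hpψ).1 hp
  have hline : ∀ z : EuclideanSpace ℝ (Fin 2), z 0 = 0 → z = y + (z 1 - y 1) • v := fun z hz => by
    ext i
    fin_cases i
    · simp [hz, hy0, hv0]
    · simp [hv1]
  have hW : IsOpen (ψ.source ∩ ψ ⁻¹' Metric.ball y ρ) :=
    ψ.isOpen_inter_preimage Metric.isOpen_ball
  have hball : ∀ u ∈ Ioo (-1 : ℝ) 1, y + (ρ * u) • v ∈ Metric.ball y ρ := fun u hu => by
    rw [mem_ball_iff_norm, add_sub_cancel_left, norm_smul, hvn, mul_one, Real.norm_eq_abs, abs_mul,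
      abs_of_pos hρ]
    nlinarith [abs_lt.2 hu]
  have hk : ∀ q ∈ frontier M ∩ (ψ.source ∩ ψ ⁻¹' Metric.ball y ρ),
      ψ q = y + (ρ * ((ψ q 1 - y 1) / ρ)) • v := fun q hq => by
    rw [mul_div_cancel₀ _ hρ.ne']
    exact hline _ ((hfr q hq.2.1).1 hq.1)
  have h0 : ∀ u : ℝ, (y + (ρ * u) • v) 0 = 0 := fun u => by simp [hy0, hv0]
  have h1 : ∀ u : ℝ, (y + (ρ * u) • v) 1 = y 1 + ρ * u := fun u => by simp [hv1]
  refine ⟨ψ.source ∩ ψ ⁻¹' Metric.ball y ρ, fun q => (ψ q 1 - y 1) / ρ,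
    fun u => ψ.symm (y + (ρ * u) • v), ⟨hW, ⟨hp, hpψ, Metric.mem_ball_self hρ⟩, ?_, ?_, ?_, ?_, ?_, ?_, ?_⟩, ?_⟩
  · refine ContinuousOn.div_const (ContinuousOn.sub ?_ continuousOn_const) _
    exact (EuclideanSpace.proj (1 : Fin 2) : EuclideanSpace ℝ (Fin 2) →L[ℝ] ℝ).continuous.comp_continuousOn
      (ψ.continuousOn.mono fun q hq => hq.2.1)
  · exact ψ.continuousOn_symm.comp (by fun_prop) fun u hu => (hρV (hball u hu)).1
  · intro q hq
    have h2 : ψ q ∈ Metric.ball y ρ := hq.2.2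
    rw [hk q hq, mem_ball_iff_norm, add_sub_cancel_left, norm_smul, hvn, mul_one, Real.norm_eq_abs,
      abs_mul, abs_of_pos hρ] at h2
    exact abs_lt.1 (by nlinarith)
  · intro u hu
    have h2 := (hρV (hball u hu)).1
    have h3 := ψ.map_target h2
    refine ⟨(hfr _ h3).2 (by rw [ψ.right_inv h2, h0]), h3, ?_⟩
    rw [mem_preimage, ψ.right_inv h2]
    exact hball u hu
  · intro q hq
    beta_reduce
    rw [← hk q hq, ψ.left_inv hq.2.1]
  · intro u hu
    beta_reduce
    rw [ψ.right_inv (hρV (hball u hu)).1, h1]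
    field_simp
    ring
  · beta_reduce
    rw [sub_self, zero_div]
  · rintro q ⟨hq, hqb⟩
    have := (hρV hqb).2
    rwa [mem_preimage, ψ.left_inv hq] at this

theorem IsLocalInterval.flip {X : Set Y} {x : Y} {W : Set Y} {k : Y → ℝ} {e : ℝ → Y}
    (h : IsLocalInterval X x (Ioo (-1) 1) W k e) :
    IsLocalInterval X x (Ioo (-1) 1) W (fun z => -k z) fun u => e (-u) := by
  have hm : MapsTo (fun u : ℝ => -u) (Ioo (-1) 1) (Ioo (-1) 1) := fun u hu =>
    ⟨by linarith [hu.2], by linarith [hu.1]⟩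
  refine ⟨h.isOpen, h.mem, h.continuousOn_coord.neg, h.continuousOn_param.comp (by fun_prop) hm,
    fun z hz => hm (h.mapsTo_coord hz), fun u hu => h.mapsTo_param (hm hu), fun z hz => ?_,
    fun u hu => ?_, by rw [h.coord_eq, neg_zero]⟩
  · rw [neg_neg, h.left_inv z hz]
  · rw [h.right_inv _ (hm hu), neg_neg]

/-- The curve `γ` changes at the parameter `t` from the complement of `M` to its interior, or the
other way round. -/
def CrossesFrontier (γ : AddCircle (1 : ℝ) → Y) (M : Set Y) (t : ℝ) : Prop :=
  ∃ η > 0, (∀ s ∈ Ioo (t - η) t, γ (s : AddCircle (1 : ℝ)) ∈ Mᶜ) ∧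
      (∀ s ∈ Ioo t (t + η), γ (s : AddCircle (1 : ℝ)) ∈ interior M) ∨
    (∀ s ∈ Ioo (t - η) t, γ (s : AddCircle (1 : ℝ)) ∈ interior M) ∧
      (∀ s ∈ Ioo t (t + η), γ (s : AddCircle (1 : ℝ)) ∈ Mᶜ)

theorem CrossesFrontier.frequently {γ : AddCircle (1 : ℝ) → Y} {M : Set Y} {t : ℝ}
    (h : CrossesFrontier γ M t) : (∃ᶠ s : ℝ in 𝓝 t, γ (s : AddCircle (1 : ℝ)) ∈ interior M) ∧
      ∃ᶠ s : ℝ in 𝓝 t, γ (s : AddCircle (1 : ℝ)) ∈ Mᶜ := by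
  have hl : ∀ (η : ℝ) (p : ℝ → Prop), 0 < η → (∀ s ∈ Ioo (t - η) t, p s) → ∃ᶠ s in 𝓝 t, p s :=
    fun η p hη hp => ((eventually_of_mem (Ioo_mem_nhdsLT (by linarith)) hp).frequently).filter_mono
      nhdsWithin_le_nhds
  have hr : ∀ (η : ℝ) (p : ℝ → Prop), 0 < η → (∀ s ∈ Ioo t (t + η), p s) → ∃ᶠ s in 𝓝 t, p s :=
    fun η p hη hp => ((eventually_of_mem (Ioo_mem_nhdsGT (by linarith)) hp).frequently).filter_mono
      nhdsWithin_le_nhds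
  obtain ⟨η, hη, ⟨h1, h2⟩ | ⟨h1, h2⟩⟩ := h
  · exact ⟨hr η _ hη h2, hl η _ hη h1⟩
  · exact ⟨hl η _ hη h1, hr η _ hη h2⟩

/-- Parameters of crossings are isolated, and infinitely many in `[0, 1]` would accumulate. -/
theorem finite_frontier_inter_range {γ : AddCircle (1 : ℝ) → Y} (hc : Continuous γ) {M : Set Y}
    (hM : IsClosed M)
    (hcross : ∀ t : ℝ, γ (t : AddCircle (1 : ℝ)) ∈ frontier M → CrossesFrontier γ M t) :
    (frontier M ∩ range γ).Finite := by
  have hc' : Continuous fun s : ℝ => γ (s : AddCircle (1 : ℝ)) :=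
    hc.comp (AddCircle.continuous_mk' 1)
  have hloc : ∀ t : ℝ, ∀ᶠ s : ℝ in 𝓝[≠] t, γ (s : AddCircle (1 : ℝ)) ∉ frontier M := by
    intro t
    by_cases ht : γ (t : AddCircle (1 : ℝ)) ∈ frontier M
    · obtain ⟨η, hη, h⟩ := hcross t ht
      have h1 : ∀ z ∈ interior M, z ∉ frontier M := fun z hz hz' => hz'.2 hz
      have h2 : ∀ z ∈ Mᶜ, z ∉ frontier M := fun z hz hz' => hz (hM.frontier_subset hz')
      rw [← Iio_union_Ioi, nhdsWithin_union, eventually_sup]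
      rcases h with ⟨h3, h4⟩ | ⟨h3, h4⟩
      · exact ⟨eventually_of_mem (Ioo_mem_nhdsLT (by linarith)) fun s hs => h2 _ (h3 s hs),
          eventually_of_mem (Ioo_mem_nhdsGT (by linarith)) fun s hs => h1 _ (h4 s hs)⟩
      · exact ⟨eventually_of_mem (Ioo_mem_nhdsLT (by linarith)) fun s hs => h1 _ (h3 s hs),
          eventually_of_mem (Ioo_mem_nhdsGT (by linarith)) fun s hs => h2 _ (h4 s hs)⟩
    · exact nhdsWithin_le_nhds
        (hc'.continuousAt.eventually_mem (isClosed_frontier.isOpen_compl.mem_nhds ht))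
  have hfin : {t : ℝ | t ∈ Icc (0 : ℝ) 1 ∧ γ (t : AddCircle (1 : ℝ)) ∈ frontier M}.Finite := by
    by_contra hinf
    obtain ⟨t, -, ht⟩ := Set.Infinite.exists_accPt_of_subset_isCompact hinf isCompact_Icc
      fun s hs => hs.1
    obtain ⟨s, hs1, hs2⟩ := ((accPt_iff_frequently_nhdsNE.1 ht).and_eventually (hloc t)).exists
    exact hs2 hs1.2
  refine (hfin.image fun t : ℝ => γ t).subset ?_
  rintro _ ⟨hz, u, rfl⟩
  obtain ⟨t, ht, rfl⟩ := AddCircle.exists_coe_eq 0 u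
  exact ⟨t, ⟨⟨ht.1, by linarith [ht.2]⟩, hz⟩, rfl⟩

end Chart

/-! ### The boundary of `M` inside one complementary component -/

section Branches

variable {γ : AddCircle (1 : ℝ) → ℂ} (hc : Continuous γ) (hi : Function.Injective γ) {M : Set ℂ}
  (hM : IsClosed M)
include hc hi hM

/-- At a crossing, every complementary component of the Jordan curve contains a branch of the
boundary of `M`. -/
theorem branch_subset_component {t : ℝ} (ht : CrossesFrontier γ M t) {W : Set ℂ} {k : ℂ → ℝ} {e : ℝ → ℂ}
    (h : IsLocalInterval (frontier M) (γ t) (Ioo (-1) 1) W k e)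
    (hWP : W ∩ (frontier M ∩ range γ) ⊆ {γ t}) {y : ℂ} (hy : y ∉ range γ) :
    e '' Ioo 0 1 ⊆ connectedComponentIn (range γ)ᶜ y ∨
      e '' Ioo (-1) 0 ⊆ connectedComponentIn (range γ)ᶜ y := by
  set B := connectedComponentIn (range γ)ᶜ y
  have hJ : IsClosed (range γ) := (isCompact_range_closedCurve hc).isClosed
  have hBo : IsOpen B := hJ.isOpen_compl.connectedComponentIn
  have hfr : frontier B = range γ := frontier_component_eq hc hi hy
  obtain ⟨ε, hε, hεW⟩ := Metric.mem_nhds_iff.1 (h.isOpen.mem_nhds h.mem.2)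
  obtain ⟨δ, hδ, hconn⟩ := exists_local_connection hc hi hε
  have hx : γ t ∈ range γ := mem_range_self _
  have hball : ∀ᶠ s : ℝ in 𝓝 t, γ s ∈ Metric.ball (γ t) δ :=
    (continuous_comp_coe hc).continuousAt.eventually_mem (Metric.ball_mem_nhds _ hδ)
  have hex : ∀ S : Set ℂ, IsOpen S → (∃ᶠ s : ℝ in 𝓝 t, γ s ∈ S) → ∃ u ∈ B, u ∈ S ∧ u ∈ Metric.ball (γ t) δ := by
    intro S hS hf
    obtain ⟨s, hs, hsb⟩ := (hf.and_eventually hball).exists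
    have : γ s ∈ closure B := frontier_subset_closure (hfr ▸ mem_range_self _)
    obtain ⟨u, hu, huB⟩ := mem_closure_iff.1 this _ (hS.inter Metric.isOpen_ball) ⟨hs, hsb⟩
    exact ⟨u, huB, hu⟩
  -- Near the crossing `B` contains points `u` in the interior of `M` and `v` off `M`, because every
  -- point of the curve is in the closure of `B`. A small connected set in `B` joining them must
  -- meet the frontier of `M`, and the point found lies on one of the branches.
  obtain ⟨u, huB, huM, hub⟩ := hex _ isOpen_interior ht.frequently.1
  obtain ⟨v, hvB, hvM, hvb⟩ := hex _ hM.isOpen_compl ht.frequently.2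
  obtain ⟨C, hCp, hCJ, hCb, huC, hvC⟩ := hconn _ hx u hub v hvb
    ⟨B, connectedComponentIn_subset _ _, isPreconnected_connectedComponentIn, huB, hvB⟩
  have hCB : C ⊆ B := by
    have := hCp.subset_connectedComponentIn huC hCJ
    rwa [← connectedComponentIn_eq huB] at this
  obtain ⟨z, hzC, hzN⟩ : ∃ z ∈ C, z ∈ frontier M := by
    by_contra! H
    obtain ⟨z, -, hz, hz'⟩ := hCp _ _ isOpen_interior hM.isOpen_compl (fun z hz => by
      by_contra! h
      rw [mem_union, not_or, notMem_compl_iff] at h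
      exact H z hz ⟨subset_closure h.2, h.1⟩) ⟨u, huC, huM⟩ ⟨v, hvC, hvM⟩
    exact hz' (interior_subset hz)
  have hzW : z ∈ frontier M ∩ W := ⟨hzN, hεW (hCb hzC)⟩
  have hk0 : ∀ u ∈ Ioo (-1 : ℝ) 1, e u ∈ range γ → u = 0 := fun u hu hu' => by
    have h1 := h.mapsTo_param hu
    have h2 : e u = γ t := hWP ⟨h1.2, h1.1, hu'⟩
    rw [← h.right_inv u hu, h2, h.coord_eq]
  have hbranch : ∀ a b : ℝ, -1 ≤ a → b ≤ 1 → (0 : ℝ) ∉ Ioo a b → k z ∈ Ioo a b →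
      e '' Ioo a b ⊆ B := by
    intro a b ha hb h0 hkz
    have hsub : Ioo a b ⊆ Ioo (-1) 1 := Ioo_subset_Ioo ha hb
    have := (isPreconnected_Ioo.image e (h.continuousOn_param.mono hsub)).subset_connectedComponentIn
      (F := (range γ)ᶜ) ⟨k z, hkz, h.left_inv z hzW⟩ (by
        rintro _ ⟨u, hu, rfl⟩ hu'
        exact h0 (hk0 u (hsub hu) hu' ▸ hu))
    rwa [← connectedComponentIn_eq (hCB hzC)] at this
  have hkI := h.mapsTo_coord hzW
  rcases lt_trichotomy (k z) 0 with h0 | h0 | h0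
  · exact .inr (hbranch (-1) 0 le_rfl zero_le_one (fun h => h.2.false) ⟨hkI.1, h0⟩)
  · refine absurd ?_ (hCJ hzC)
    have h1 := h.left_inv z hzW
    rw [h0, ← h.coord_eq, h.left_inv _ h.mem] at h1
    exact h1 ▸ mem_range_self _
  · exact .inl (hbranch 0 1 (by norm_num) le_rfl (fun h => h.1.false) ⟨h0, hkI.2⟩)

/-- The part of the boundary of `M` in the closure of a component of the complement of the
Jordan curve is a one-dimensional manifold. -/
theorem isOneManifold_frontier_inter_closure
    (hchart : ∀ p ∈ frontier M, HasHalfPlaneChart M p)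
    (hcross : ∀ t : ℝ, γ t ∈ frontier M → CrossesFrontier γ M t) {x : ℂ} (hx : x ∉ range γ) :
    IsOneManifold (frontier M ∩ closure (connectedComponentIn (range γ)ᶜ x))
      (frontier M ∩ range γ) := by
  set A := connectedComponentIn (range γ)ᶜ x
  have hJ : IsClosed (range γ) := (isCompact_range_closedCurve hc).isClosed
  have hAo : IsOpen A := hJ.isOpen_compl.connectedComponentIn
  have hAJ : A ⊆ (range γ)ᶜ := connectedComponentIn_subset _ _
  have hcl : closure A = A ∪ range γ := by
    rw [closure_eq_self_union_frontier, frontier_component_eq hc hi hx]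
  rw [hcl]
  refine ⟨inter_subset_inter_right _ subset_union_right, ?_, ?_⟩
  · rintro z ⟨⟨hzN, hz⟩, hzP⟩
    have hzA : z ∈ A := hz.resolve_right fun h => hzP ⟨hzN, h⟩
    obtain ⟨W, k, e, hW, hWA⟩ := (hchart z hzN).exists_isLocalInterval hzN (hAo.mem_nhds hzA)
    have hXW : frontier M ∩ (A ∪ range γ) ∩ W = frontier M ∩ W :=
      Subset.antisymm (fun w hw => ⟨hw.1.1, hw.2⟩) fun w hw => ⟨⟨hw.1, .inl (hWA hw.2)⟩, hw.2⟩
    refine ⟨W, k, e, ⟨hW.isOpen, hXW ▸ hW.mem, hXW ▸ hW.continuousOn_coord, hW.continuousOn_param,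
      hXW ▸ hW.mapsTo_coord, hXW ▸ hW.mapsTo_param, hXW ▸ hW.left_inv, hW.right_inv, hW.coord_eq⟩, ?_⟩
    exact disjoint_left.2 fun w hw hwP => hAJ (hWA hw) hwP.2
  · rintro p ⟨hpN, hpJ⟩
    have hfin := finite_frontier_inter_range hc hM hcross
    have hV : ((frontier M ∩ range γ) \ {p})ᶜ ∈ 𝓝 p :=
      (hfin.subset sdiff_subset).isClosed.isOpen_compl.mem_nhds fun h => h.2 rfl
    obtain ⟨W, k, e, hW, hWV⟩ := (hchart p hpN).exists_isLocalInterval hpN hV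
    have hWP : W ∩ (frontier M ∩ range γ) ⊆ {p} := fun w hw => by
      by_contra h
      exact hWV hw.1 ⟨hw.2, h⟩
    obtain ⟨t, rfl⟩ := hpJ
    obtain ⟨t, rfl⟩ := QuotientAddGroup.mk_surjective t
    -- Each of `A` and a second component contains at least one of the two branches, so each
    -- contains exactly one; this makes the chart a half-open interval.
    obtain ⟨y, hy, hyA⟩ := exists_notMem_component hc hi x
    have hkey : ∀ W k e, IsLocalInterval (frontier M) (γ (t : AddCircle (1 : ℝ))) (Ioo (-1) 1) W k e →
        W ∩ (frontier M ∩ range γ) ⊆ {γ (t : AddCircle (1 : ℝ))} → e '' Ioo 0 1 ⊆ A →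
        ∃ W k e, IsLocalInterval (frontier M ∩ (A ∪ range γ)) (γ (t : AddCircle (1 : ℝ))) (Ico 0 1) W k e ∧
          W ∩ (frontier M ∩ range γ) ⊆ {γ (t : AddCircle (1 : ℝ))} := by
      intro W k e hW hWP hA
      have hB : e '' Ioo (-1) 0 ⊆ connectedComponentIn (range γ)ᶜ y := by
        refine (branch_subset_component hc hi hM (hcross t hpN) hW hWP hy).resolve_left fun h => ?_
        have h1 : e (1 / 2) ∈ e '' Ioo 0 1 := ⟨_, by norm_num, rfl⟩
        have h2 := connectedComponentIn_eq (h h1)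
        have h3 : A = _ := connectedComponentIn_eq (hA h1)
        exact hyA (by
          change y ∈ A
          rw [h3, ← h2]
          exact mem_connectedComponentIn hy)
      have hBA : ∀ z ∈ connectedComponentIn (range γ)ᶜ y, z ∉ A ∪ range γ := by
        rintro z hz (hzA | hzJ)
        · have h3 : A = _ := connectedComponentIn_eq hzA
          refine hyA (?_ : y ∈ A)
          rw [h3, ← connectedComponentIn_eq hz]
          exact mem_connectedComponentIn hy
        · exact connectedComponentIn_subset _ _ hz hzJ
      have he0 : e 0 = γ (t : AddCircle (1 : ℝ)) := by
        rw [← hW.coord_eq, hW.left_inv _ hW.mem]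
      have hsub : Ico (0 : ℝ) 1 ⊆ Ioo (-1) 1 := fun u hu => ⟨by linarith [hu.1], hu.2⟩
      have hXW : frontier M ∩ (A ∪ range γ) ∩ W ⊆ frontier M ∩ W := fun w hw => ⟨hw.1.1, hw.2⟩
      refine ⟨W, k, e, ⟨hW.isOpen, ⟨⟨hpN, .inr (mem_range_self _)⟩, hW.mem.2⟩,
        hW.continuousOn_coord.mono hXW, hW.continuousOn_param.mono hsub, fun z hz => ?_, fun u hu => ?_,
        fun z hz => hW.left_inv z (hXW hz), fun u hu => hW.right_inv u (hsub hu), hW.coord_eq⟩, hWP⟩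
      · have h1 := hW.mapsTo_coord (hXW hz)
        refine ⟨?_, h1.2⟩
        by_contra! h2
        refine hBA z ?_ hz.1.2
        rw [← hW.left_inv z (hXW hz)]
        exact hB ⟨_, ⟨h1.1, h2⟩, rfl⟩
      · have h1 := hW.mapsTo_param (hsub hu)
        refine ⟨⟨h1.1, ?_⟩, h1.2⟩
        rcases hu.1.eq_or_lt with rfl | h2
        · exact .inr (he0 ▸ mem_range_self _)
        · exact .inl (hA ⟨u, ⟨h2, hu.2⟩, rfl⟩)
    rcases branch_subset_component hc hi hM (hcross t hpN) hW hWP hx with h | h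
    · exact hkey W k e hW hWP h
    · refine hkey W _ _ hW.flip hWP ?_
      rintro _ ⟨u, hu, rfl⟩
      exact h ⟨-u, ⟨by linarith [hu.2], by linarith [hu.1]⟩, rfl⟩

end Branches

end

/-! ### Discs cut off by arcs of the boundary of `M` -/

section

open Set Topology Filter

section Crosscut

/-- The curve `g` is a piece of the boundary of `M` that cuts `A` and joins the points of the
Jordan curve `γ` with parameters `s₀` and `s₁`. -/
structure IsBoundaryCut (γ : AddCircle (1 : ℝ) → ℂ) (M A : Set ℂ) (s₀ s₁ : ℝ) (g : ℝ → ℂ) : Prop where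
  lt : s₀ < s₁
  lt_add_one : s₁ < s₀ + 1
  continuousOn : ContinuousOn g (Icc 0 1)
  injOn : InjOn g (Icc 0 1)
  zero : g 0 = γ s₀
  one : g 1 = γ s₁
  mapsTo : MapsTo g (Icc 0 1) (frontier M)
  mem : ∀ t ∈ Ioo (0 : ℝ) 1, g t ∈ A
  -- The arc is open, as well as compact, in this set, so a connected subset of it that is not
  -- inside the arc is disjoint from it.
  mem_nhdsWithin : ∀ z ∈ g '' Icc 0 1, g '' Icc 0 1 ∈ 𝓝[frontier M ∩ closure A] z

/-- The region `E`, the interior of a closed disc, is cut off from `A` by the arc `b`, and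
the arc `a` is the rest of its boundary. -/
structure IsCutOff (A a b E : Set ℂ) : Prop where
  isOpen : IsOpen E
  subset : E ⊆ A
  frontier_eq : frontier E = a ∪ b
  maximal : ∀ C, IsPreconnected C → C ⊆ (a ∪ b)ᶜ → (C ∩ E).Nonempty → C ⊆ E
  exists_disc : ∃ h : ℂ → ℂ, ContinuousOn h (Metric.closedBall 0 1) ∧
    InjOn h (Metric.closedBall 0 1) ∧ h '' Metric.closedBall 0 1 = E ∪ (a ∪ b) ∧
    h '' Metric.sphere 0 1 = a ∪ b

variable {γ : AddCircle (1 : ℝ) → ℂ} (hc : Continuous γ) (hi : Function.Injective γ)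
include hc hi

/-- The arcs `a` and `b` form a Jordan curve; `E` is a component of its complement not containing
the rest `R` of `γ`. Then `E` avoids all of `γ` and meets `A` near an inner point of `b`, so it lies
in `A`; being bounded, it is the interior of a disc. -/
theorem exists_isCutOff {x : ℂ} {A : Set ℂ} (hA : A = connectedComponentIn (range γ)ᶜ x)
    (hb : Bornology.IsBounded A) {s₀ s₁ : ℝ} (h01 : s₀ < s₁) (h10 : s₁ < s₀ + 1) {g : ℝ → ℂ}
    (gc : ContinuousOn g (Icc 0 1)) (gi : InjOn g (Icc 0 1)) (g0 : g 0 = γ s₀) (g1 : g 1 = γ s₁)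
    (gA : ∀ t ∈ Ioo (0 : ℝ) 1, g t ∈ A) :
    ∃ E, IsCutOff A ((fun s : ℝ => γ s) '' Icc s₀ s₁) (g '' Icc 0 1) E := by
  have hJ : IsClosed (range γ) := (isCompact_range_closedCurve hc).isClosed
  have hAo : IsOpen A := hA ▸ hJ.isOpen_compl.connectedComponentIn
  have hAJ : A ⊆ (range γ)ᶜ := hA ▸ connectedComponentIn_subset _ _
  have hpos : 0 < s₁ - s₀ := sub_pos.2 h01
  have him : (fun t : ℝ => γ ((s₀ + (s₁ - s₀) * t : ℝ) : AddCircle (1 : ℝ))) '' Icc 0 1 =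
      (fun s : ℝ => γ s) '' Icc s₀ s₁ := by
    refine Subset.antisymm ?_ ?_
    · rintro _ ⟨t, ht, rfl⟩
      exact ⟨_, ⟨by nlinarith [ht.1], by nlinarith [ht.2]⟩, rfl⟩
    · rintro _ ⟨s, hs, rfl⟩
      refine ⟨(s - s₀) / (s₁ - s₀), ⟨div_nonneg (by linarith [hs.1]) hpos.le,
        (div_le_one hpos).2 (by linarith [hs.2])⟩, ?_⟩
      beta_reduce
      rw [mul_div_cancel₀ _ hpos.ne', add_sub_cancel]
  have hbJ : ∀ z ∈ g '' Icc 0 1, z ∈ range γ → z = γ s₀ ∨ z = γ s₁ := by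
    rintro _ ⟨t, ht, rfl⟩ hz
    rcases ht.1.eq_or_lt with rfl | ht0
    · exact .inl g0
    rcases ht.2.eq_or_lt with rfl | ht1
    · exact .inr g1
    · exact absurd hz (hAJ (gA t ⟨ht0, ht1⟩))
  obtain ⟨l, lc, li, lr⟩ := exists_closedCurve_of_arcs
    (f := fun t : ℝ => γ ((s₀ + (s₁ - s₀) * t : ℝ) : AddCircle (1 : ℝ))) (g := g)
    (((continuous_comp_coe hc).comp (by fun_prop)).continuousOn) gc
    (fun a ha b hb e => by
      have := injOn_comp_coe hi (by linarith : s₁ - s₀ < 1)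
        (⟨by nlinarith [ha.1], by nlinarith [ha.2]⟩ : s₀ + (s₁ - s₀) * a ∈ Icc s₀ s₁)
        (⟨by nlinarith [hb.1], by nlinarith [hb.2]⟩ : s₀ + (s₁ - s₀) * b ∈ Icc s₀ s₁) e
      exact mul_left_cancel₀ hpos.ne' (add_left_cancel this)) gi (by simpa using g0.symm)
    (by simpa using g1.symm) (by
      rintro z ⟨⟨t, ht, rfl⟩, hz⟩
      simpa using hbJ _ hz (mem_range_self _))
  rw [him] at lr
  set a := (fun s : ℝ => γ s) '' Icc s₀ s₁ with ha
  set b := g '' Icc 0 1 with hbdef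
  set R := (fun s : ℝ => γ s) '' Ioo s₁ (s₀ + 1) with hR
  have hRp : IsPreconnected R := isPreconnected_Ioo.image _ (continuous_comp_coe hc).continuousOn
  have hRa : ∀ z ∈ R, z ∉ a := by
    rintro _ ⟨s, hs, rfl⟩ ⟨s', hs', e⟩
    have := injOn_comp_coe hi (by linarith [hs.2] : s - s₀ < 1) ⟨hs'.1, hs'.2.trans hs.1.le⟩
      ⟨by linarith [hs.1], le_rfl⟩ e
    linarith [hs'.2, hs.1]
  have hRl : R ⊆ (range l)ᶜ := by
    intro z hz hzl
    rw [lr] at hzl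
    rcases hzl with h | h
    · exact hRa z hz h
    · have hzJ : z ∈ range γ := by obtain ⟨s, -, rfl⟩ := hz; exact mem_range_self _
      rcases hbJ z h hzJ with h1 | h1
      · exact hRa z hz ⟨s₀, ⟨le_rfl, h01.le⟩, h1.symm⟩
      · exact hRa z hz ⟨s₁, ⟨h01.le, le_rfl⟩, h1.symm⟩
  have hJaR : range γ ⊆ a ∪ R := by
    rintro _ ⟨u, rfl⟩
    obtain ⟨s, hs, rfl⟩ := AddCircle.exists_coe_eq s₀ u
    rcases le_or_gt s s₁ with h | h
    · exact .inl ⟨s, ⟨hs.1, h⟩, rfl⟩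
    · exact .inr ⟨s, ⟨h, hs.2⟩, rfl⟩
  have hr₀ : γ (((s₁ + (s₀ + 1)) / 2 : ℝ) : AddCircle (1 : ℝ)) ∈ R :=
    ⟨_, ⟨by linarith, by linarith⟩, rfl⟩
  obtain ⟨y, hyl, hy⟩ := exists_notMem_component lc li
    (γ (((s₁ + (s₀ + 1)) / 2 : ℝ) : AddCircle (1 : ℝ)))
  set E := connectedComponentIn (range l)ᶜ y with hE
  have hEl : E ⊆ (range l)ᶜ := connectedComponentIn_subset _ _
  have hEo : IsOpen E :=
    (isCompact_range_closedCurve lc).isClosed.isOpen_compl.connectedComponentIn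
  have hEp : IsPreconnected E := isPreconnected_connectedComponentIn
  have hfr : frontier E = a ∪ b := by rw [hE, frontier_component_eq lc li hyl, lr]
  have hER : ∀ z ∈ E, z ∉ R := by
    intro z hz hzR
    have h1 := hRp.subset_connectedComponentIn hr₀ hRl hzR
    rw [connectedComponentIn_eq h1, ← connectedComponentIn_eq hz] at hy
    exact hy (mem_connectedComponentIn hyl)
  have hEJ : E ⊆ (range γ)ᶜ := by
    intro z hz hzJ
    rcases hJaR hzJ with h | h
    · exact hEl hz (lr ▸ .inl h)
    · exact hER z hz h
  have hEA : E ⊆ A := by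
    have hg : g (1 / 2) ∈ closure E := frontier_subset_closure
      (hfr ▸ .inr ⟨1 / 2, by norm_num, rfl⟩)
    obtain ⟨z, hzA, hzE⟩ := mem_closure_iff.1 hg A hAo (gA _ (by norm_num))
    have := hEp.subset_connectedComponentIn hzE hEJ
    rw [hA] at hzA ⊢
    rwa [← connectedComponentIn_eq hzA] at this
  refine ⟨E, hEo, hEA, hfr, fun C hC hCl ⟨z, hzC, hzE⟩ => ?_, ?_⟩
  · have := hC.subset_connectedComponentIn hzC (lr ▸ hCl)
    rwa [← connectedComponentIn_eq hzE] at this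
  · have := exists_closedDisc lc li hyl (hb.subset hEA)
    rwa [← hE, lr] at this

variable {M : Set ℂ} (hM : IsClosed M) (hchart : ∀ p ∈ frontier M, HasHalfPlaneChart M p)
    (hcross : ∀ t : ℝ, γ t ∈ frontier M → CrossesFrontier γ M t) {x : ℂ} (hx : x ∉ range γ)
    {A : Set ℂ} (hA : A = connectedComponentIn (range γ)ᶜ x) (hb : Bornology.IsBounded A)
include hM hchart hcross hx hA hb

/-- An arc of the one-dimensional manifold `frontier M ∩ closure A` from one boundary point to
another has its inner points off the curve, hence in `A`. -/
theorem exists_boundary_arc {u : ℝ} (hu : γ u ∈ frontier M) : ∃ g : ℝ → ℂ,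
    ContinuousOn g (Icc 0 1) ∧ InjOn g (Icc 0 1) ∧ MapsTo g (Icc 0 1) (frontier M) ∧ g 0 = γ u ∧
      g 1 ∈ range γ ∧ (∀ t ∈ Ioo (0 : ℝ) 1, g t ∈ A) ∧
      ∀ z ∈ g '' Icc 0 1, g '' Icc 0 1 ∈ 𝓝[frontier M ∩ closure A] z := by
  have hX := isOneManifold_frontier_inter_closure hc hi hM hchart hcross hx
  rw [← hA] at hX
  have hXc : IsCompact (frontier M ∩ closure A) := hb.isCompact_closure.inter_left isClosed_frontier
  obtain ⟨g, gc, gi, gX, g0, g1, gP, gn⟩ := hX.exists_open_arc hXc ⟨hu, mem_range_self _⟩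
  refine ⟨g, gc, gi, fun t ht => (gX ht).1, g0, g1.2, fun t ht => ?_, gn⟩
  have h1 := gX (Ioo_subset_Icc_self ht)
  have h2 := gP t ht
  rw [closure_eq_self_union_frontier, hA, frontier_component_eq hc hi hx, ← hA] at h1
  exact h1.2.resolve_right fun h => h2 ⟨h1.1, h⟩

theorem exists_initial_boundaryCut (hne : (frontier M ∩ range γ).Nonempty) :
    ∃ s₀ s₁ g, IsBoundaryCut γ M A s₀ s₁ g ∧ ∃ s ∈ Ioo s₀ s₁, γ (s : ℝ) ∈ interior M := by
  obtain ⟨_, hp, t, rfl⟩ := hne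
  obtain ⟨t, rfl⟩ := QuotientAddGroup.mk_surjective t
  change γ (t : AddCircle (1 : ℝ)) ∈ frontier M at hp
  obtain ⟨g, gc, gi, gN, g0, ⟨v, hv⟩, gA, gn⟩ := exists_boundary_arc hc hi hM hchart hcross hx hA hb hp
  have hne : g 1 ≠ g 0 := fun e => one_ne_zero (gi (by simp) (by simp) e)
  -- Of the two arcs of `γ` between the end points, the one that leaves `γ t` into the interior of
  -- `M` is taken; in the second case this requires reversing `g`.
  obtain ⟨η, hη, ⟨-, h2⟩ | ⟨h1, -⟩⟩ := hcross t hp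
  · obtain ⟨s₁, hs₁, rfl⟩ := AddCircle.exists_coe_eq t v
    have hts : t < s₁ := hs₁.1.lt_of_ne (by rintro rfl; exact hne (by rw [← hv, g0]))
    refine ⟨t, s₁, g, ⟨hts, hs₁.2, gc, gi, g0, hv.symm, gN, gA, gn⟩, ?_⟩
    obtain ⟨s, hs, hs'⟩ := exists_between (lt_min hts (by linarith : t < t + η))
    exact ⟨s, ⟨hs, hs'.trans_le (min_le_left _ _)⟩, h2 s ⟨hs, hs'.trans_le (min_le_right _ _)⟩⟩
  · obtain ⟨s₀, hs₀, rfl⟩ := AddCircle.exists_coe_eq (t - 1) v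
    have hts : t - 1 < s₀ := hs₀.1.lt_of_ne (by
      rintro rfl
      refine hne ?_
      rw [← hv, g0, AddCircle.coe_sub, AddCircle.coe_period, sub_zero])
    have hs₀t : s₀ < t := by linarith [hs₀.2]
    have hr : MapsTo (fun s : ℝ => 1 - s) (Icc 0 1) (Icc 0 1) := fun s hs =>
      ⟨by linarith [hs.2], by linarith [hs.1]⟩
    have him : (fun s : ℝ => g (1 - s)) '' Icc 0 1 = g '' Icc 0 1 := by
      refine Subset.antisymm ?_ ?_
      · rintro _ ⟨s, hs, rfl⟩; exact ⟨_, hr hs, rfl⟩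
      · rintro _ ⟨s, hs, rfl⟩; exact ⟨_, hr hs, by simp⟩
    refine ⟨s₀, t, fun s => g (1 - s), ⟨hs₀t, by linarith, gc.comp (by fun_prop) hr,
      fun a ha b hb e => sub_right_injective (gi (hr ha) (hr hb) e), by simpa using hv.symm,
      by simpa using g0, gN.comp hr, fun s hs => gA _ ⟨by linarith [hs.2], by linarith [hs.1]⟩,
      by rwa [him]⟩, ?_⟩
    obtain ⟨s, hs, hs'⟩ := exists_between (max_lt hs₀t (by linarith : t - η < t))
    exact ⟨s, ⟨(le_max_left _ _).trans_lt hs, hs'⟩, h1 s ⟨(le_max_right _ _).trans_lt hs, hs'⟩⟩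

/-- If `M` is disconnected in the disc that a boundary arc cuts off, there is a boundary arc that
cuts off a smaller disc. -/
theorem IsBoundaryCut.exists_smaller
    (hcomp : ∀ L ⊆ A ∩ M, IsCompact L → IsClosed (M \ L) → L = ∅) {s₀ s₁ : ℝ} {g : ℝ → ℂ}
    (hg : IsBoundaryCut γ M A s₀ s₁ g) {E : Set ℂ}
    (hE : IsCutOff A ((fun s : ℝ => γ s) '' Icc s₀ s₁) (g '' Icc 0 1) E)
    (hD : ¬ IsPreconnected ((E ∪ ((fun s : ℝ => γ s) '' Icc s₀ s₁ ∪ g '' Icc 0 1)) ∩ M)) :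
    ∃ u v g', IsBoundaryCut γ M A u v g' ∧ (∃ s ∈ Ioo u v, γ (s : ℝ) ∈ interior M) ∧
      s₀ < u ∧ v ≤ s₁ := by
  set a := (fun s : ℝ => γ s) '' Icc s₀ s₁ with ha
  set b := g '' Icc 0 1 with hbdef
  set D := E ∪ (a ∪ b) with hDdef
  have hγc : Continuous fun s : ℝ => γ s := continuous_comp_coe hc
  have hAJ : A ⊆ (range γ)ᶜ := hA ▸ connectedComponentIn_subset _ _
  have haJ : a ⊆ range γ := by rintro _ ⟨s, -, rfl⟩; exact mem_range_self _
  have hDc : IsCompact D := by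
    obtain ⟨h, h1, -, h2, -⟩ := hE.exists_disc
    rw [hDdef, ← h2]
    exact (isCompact_closedBall _ _).image_of_continuousOn h1
  have hclE : closure E = D := by rw [closure_eq_self_union_frontier, hE.frontier_eq]
  have hbc : IsCompact b := isCompact_Icc.image_of_continuousOn hg.continuousOn
  have hbp : IsPreconnected b := isPreconnected_Icc.image _ hg.continuousOn
  have hNM : frontier M ⊆ M := hM.frontier_subset
  have hbDM : b ⊆ D ∩ M := fun z hz => ⟨.inr (.inr hz), by
    obtain ⟨t, ht, rfl⟩ := hz; exact hNM (hg.mapsTo ht)⟩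
  have key : ∀ K L : Set ℂ, IsClosed K → IsClosed L → D ∩ M ⊆ K ∪ L → D ∩ M ∩ (K ∩ L) = ∅ →
      b ⊆ K → ¬ D ∩ M ⊆ K → ∃ u v g', IsBoundaryCut γ M A u v g' ∧
        (∃ s ∈ Ioo u v, γ (s : ℝ) ∈ interior M) ∧ s₀ < u ∧ v ≤ s₁ := by
    intro K L hK hL hKL hdis hbK hnot
    have hKnL : ∀ z ∈ D ∩ M, z ∈ L → z ∉ K := fun z hz hzL hzK => hdis.le ⟨hz, hzK, hzL⟩
    obtain ⟨z₀, hz₀, hz₀K⟩ := not_subset.1 hnot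
    have hz₀L := (hKL hz₀).resolve_left hz₀K
    -- The part in `L` has to meet the arc `a`.
    obtain ⟨w, hwa, hwL⟩ : ∃ s : ℝ, s ∈ Icc s₀ s₁ ∧ γ s ∈ L ∩ M := by
      by_contra! H
      have hLE : D ∩ M ∩ L ⊆ E := by
        rintro z ⟨⟨hzE | hza | hzb, hzM⟩, hzL⟩
        · exact hzE
        · obtain ⟨s, hs, rfl⟩ := hza
          exact absurd ⟨hzL, hzM⟩ (H s hs)
        · exact absurd (hbK hzb) (hKnL z ⟨.inr (.inr hzb), hzM⟩ hzL)
      refine (hcomp (D ∩ M ∩ L) (fun z hz => ⟨hE.subset (hLE hz), hz.1.2⟩)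
        ((hDc.inter_right hM).inter_right hL) ?_).le ⟨hz₀, hz₀L⟩
      have : M \ (D ∩ M ∩ L) = M ∩ Eᶜ ∪ D ∩ M ∩ K := by
        refine Subset.antisymm ?_ ?_
        · rintro z ⟨hzM, hz⟩
          by_cases hzE : z ∈ E
          · have hzDM : z ∈ D ∩ M := ⟨.inl hzE, hzM⟩
            exact .inr ⟨hzDM, (hKL hzDM).resolve_right fun h => hz ⟨hzDM, h⟩⟩
          · exact .inl ⟨hzM, hzE⟩
        · rintro z (⟨hzM, hzE⟩ | ⟨hzDM, hzK⟩)
          · exact ⟨hzM, fun h => hzE (hLE h)⟩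
          · exact ⟨hzDM.2, fun h => hKnL z hzDM h.2 hzK⟩
      rw [this]
      exact (hM.inter hE.isOpen.isClosed_compl).union ((hDc.isClosed.inter hM).inter hK)
    -- The first parameter on `a` at which the curve is in `L`. Just before it the curve is in
    -- neither part, so it is off `M`; hence this is a crossing, after which the curve runs in the
    -- interior of `M`.
    obtain ⟨u, ⟨huI, huL, huM⟩, hmin⟩ := (isCompact_Icc.inter_right
      ((hL.inter hM).preimage hγc)).exists_isLeast ⟨w, hwa, hwL⟩
    have hγD : ∀ s ∈ Icc s₀ s₁, γ (s : ℝ) ∈ D := fun s hs => .inr (.inl ⟨s, hs, rfl⟩)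
    have huK : γ (u : ℝ) ∉ K := hKnL _ ⟨hγD u huI, huM⟩ huL
    have hs₀u : s₀ < u := huI.1.lt_of_ne (by
      rintro rfl
      exact huK (hbK ⟨0, by simp, hg.zero⟩))
    have hus₁ : u < s₁ := huI.2.lt_of_ne (by
      rintro rfl
      exact huK (hbK ⟨1, by simp, hg.one⟩))
    have hleft : ∀ᶠ s : ℝ in 𝓝[<] u, γ s ∉ M := by
      filter_upwards [Ioo_mem_nhdsLT hs₀u, nhdsWithin_le_nhds (hγc.continuousAt.eventually_mem
        (hK.isOpen_compl.mem_nhds huK))] with s hs hsK hsM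
      have hsI : s ∈ Icc s₀ s₁ := ⟨hs.1.le, (hs.2.trans hus₁).le⟩
      exact hs.2.not_ge (hmin ⟨hsI, (hKL ⟨hγD s hsI, hsM⟩).resolve_left hsK, hsM⟩)
    have huN : γ (u : ℝ) ∈ frontier M := by
      refine ⟨subset_closure huM, fun h => ?_⟩
      obtain ⟨s, hs, hs'⟩ := (hleft.and (nhdsWithin_le_nhds
        (hγc.continuousAt.eventually_mem (isOpen_interior.mem_nhds h)))).exists
      exact hs (interior_subset hs')
    obtain ⟨η, hη, hright⟩ : ∃ η > 0, ∀ s ∈ Ioo u (u + η), γ (s : ℝ) ∈ interior M := by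
      obtain ⟨η, hη, ⟨-, h⟩ | ⟨h, -⟩⟩ := hcross u huN
      · exact ⟨η, hη, h⟩
      · obtain ⟨s, hs, hs'⟩ := (hleft.and (Ioo_mem_nhdsLT (by linarith : u - η < u))).exists
        exact absurd (interior_subset (h s hs')) hs
    obtain ⟨g', gc, gi, gN, g0, g1, gA, gn⟩ := exists_boundary_arc hc hi hM hchart hcross hx hA hb huN
    have gp : IsPreconnected (g' '' Icc 0 1) := isPreconnected_Icc.image _ gc
    have gcl : ∀ S : Set ℂ, g' '' Ioo 0 1 ⊆ S → g' '' Icc 0 1 ⊆ closure S := fun S hS => by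
      rw [← closure_Ioo (zero_ne_one' ℝ)] at gc ⊢
      exact gc.image_closure.trans (closure_mono hS)
    have gX : g' '' Icc 0 1 ⊆ frontier M ∩ closure A := by
      refine subset_inter gN.image_subset (gcl A ?_)
      rintro _ ⟨t, ht, rfl⟩; exact gA t ht
    have hg0 : γ (u : ℝ) ∈ g' '' Icc 0 1 := ⟨0, by simp, g0⟩
    have hub : γ (u : ℝ) ∉ b := fun h => huK (hbK h)
    have hdisj : ∀ z ∈ g' '' Icc 0 1, z ∉ b := by
      by_contra! H
      obtain ⟨z, hz, hzb⟩ := H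
      have hbo : ∀ z ∈ b, z ∈ interior {z | z ∈ frontier M ∩ closure A → z ∈ b} := fun z hz =>
        mem_interior_iff_mem_nhds.2 (mem_inf_principal.1 (hg.mem_nhdsWithin z hz))
      obtain ⟨y, hy, hy1, hy2⟩ := gp _ bᶜ isOpen_interior hbc.isClosed.isOpen_compl
        (fun z hz => (em (z ∈ b)).imp_left (hbo z)) ⟨z, hz, hbo z hzb⟩ ⟨_, hg0, hub⟩
      exact hy2 (interior_subset hy1 (gX hy))
    -- Near `γ u`, which is on the frontier of `E` but off `b`, local connectivity of `A` along `γ`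
    -- puts all points of `A` into `E`. So `g'` starts in `E`, and since it avoids `a` and `b` it
    -- stays there.
    have gE : g' '' Ioo 0 1 ⊆ E := by
      obtain ⟨ε, hε, hεb⟩ := Metric.mem_nhds_iff.1 (hbc.isClosed.isOpen_compl.mem_nhds hub)
      obtain ⟨δ, hδ, hconn⟩ := exists_local_connection hc hi hε
      have hloc : ∀ w ∈ A, w ∈ Metric.ball (γ u) δ → w ∈ E := by
        intro w hwA hwδ
        have huE : γ u ∈ closure E := hclE ▸ hγD u huI
        obtain ⟨v, hvδ, hvE⟩ := mem_closure_iff.1 huE _ Metric.isOpen_ball (Metric.mem_ball_self hδ)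
        obtain ⟨C, hC, hCJ, hCε, hwC, hvC⟩ := hconn _ (mem_range_self _) w hwδ v hvδ
          ⟨A, hAJ, hA ▸ isPreconnected_connectedComponentIn, hwA, hE.subset hvE⟩
        refine hE.maximal C hC (fun z hz h => ?_) ⟨v, hvC, hvE⟩ hwC
        exact h.elim (fun h => hCJ hz (haJ h)) (hεb (hCε hz))
      refine hE.maximal _ (isPreconnected_Ioo.image _ (gc.mono Ioo_subset_Icc_self)) ?_ ?_
      · rintro _ ⟨t, ht, rfl⟩ (h | h)
        · exact hAJ (gA t ht) (haJ h)
        · exact hdisj _ ⟨t, Ioo_subset_Icc_self ht, rfl⟩ h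
      · have h1 : Tendsto g' (𝓝[Ioo 0 1] 0) (𝓝 (γ u)) := by
          rw [← g0]
          exact (gc 0 (by simp)).mono_left (nhdsWithin_mono _ Ioo_subset_Icc_self)
        have hne : (𝓝[Ioo (0 : ℝ) 1] 0).NeBot := mem_closure_iff_nhdsWithin_neBot.1 (by
          rw [closure_Ioo zero_ne_one]; simp)
        obtain ⟨t, ht, ht'⟩ := ((h1.eventually_mem (Metric.ball_mem_nhds _ hδ)).and
          self_mem_nhdsWithin).exists
        exact ⟨g' t, ⟨t, ht', rfl⟩, hloc _ (gA t ht') ht⟩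
    have gD : g' '' Icc 0 1 ⊆ D := hclE ▸ gcl E gE
    have gDM : g' '' Icc 0 1 ⊆ D ∩ M := subset_inter gD (gN.image_subset.trans hNM)
    have gL : g' '' Icc 0 1 ⊆ L := by
      refine (isPreconnected_iff_subset_of_disjoint_closed.1 gp K L hK hL (gDM.trans hKL)
        (subset_eq_empty (inter_subset_inter_left _ gDM) hdis)).resolve_left fun h => huK (h hg0)
    have h1m : g' 1 ∈ g' '' Icc 0 1 := ⟨1, by simp, rfl⟩
    obtain ⟨v, hv, hvg⟩ : g' 1 ∈ a := by
      rcases gD h1m with h | h | h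
      · exact absurd g1 (hAJ (hE.subset h))
      · exact h
      · exact absurd h (hdisj _ h1m)
    beta_reduce at hvg
    -- The end point of `g'` is in `L` as well, so minimality of `u` puts its parameter later on
    -- `a`.
    have huv : u < v := by
      refine lt_of_le_of_ne (hmin ⟨hv, ?_, ?_⟩) ?_
      · beta_reduce; rw [hvg]; exact gL h1m
      · beta_reduce; rw [hvg]; exact (gDM h1m).2
      · rintro rfl
        exact zero_ne_one (gi (by simp) (by simp) (g0.trans hvg))
    refine ⟨u, v, g', ⟨huv, by linarith [hv.2, hg.lt_add_one], gc, gi, g0, hvg.symm, gN, gA, gn⟩, ?_,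
      hs₀u, hv.2⟩
    obtain ⟨s, hs, hs'⟩ := exists_between (lt_min huv (by linarith : u < u + η))
    exact ⟨s, ⟨hs, hs'.trans_le (min_le_left _ _)⟩, hright s ⟨hs, hs'.trans_le (min_le_right _ _)⟩⟩
  rw [isPreconnected_iff_subset_of_disjoint_closed] at hD
  push Not at hD
  obtain ⟨K, L, hK, hL, hKL, hdis, h1, h2⟩ := hD
  rcases isPreconnected_iff_subset_of_disjoint_closed.1 hbp K L hK hL (hbDM.trans hKL)
    (subset_eq_empty (inter_subset_inter_left _ hbDM) hdis) with h | h
  · exact key K L hK hL hKL hdis h h1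
  · exact key L K hL hK (by rwa [union_comm]) (by rwa [inter_comm L]) h h2

/-- The planar version of the theorem. -/
theorem exists_boundaryCut_isPreconnected
    (hcomp : ∀ L ⊆ A ∩ M, IsCompact L → IsClosed (M \ L) → L = ∅)
    (hne : (frontier M ∩ range γ).Nonempty) :
    ∃ s₀ s₁ g E, IsBoundaryCut γ M A s₀ s₁ g ∧
      IsCutOff A ((fun s : ℝ => γ s) '' Icc s₀ s₁) (g '' Icc 0 1) E ∧
      IsPreconnected ((E ∪ ((fun s : ℝ => γ s) '' Icc s₀ s₁ ∪ g '' Icc 0 1)) ∩ M) ∧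
      (E ∩ M).Nonempty := by
  have hfin := finite_frontier_inter_range hc hM hcross
  -- Induction on the number of crossings on the arc `a`. A smaller cut has `s₀ < u`, so the
  -- crossing `γ s₀` is lost. That `a` meets the interior of `M` is carried along, since it makes
  -- `E` meet `M` at the end.
  have main : ∀ n : ℕ, ∀ s₀ s₁ g, IsBoundaryCut γ M A s₀ s₁ g →
      (∃ s ∈ Ioo s₀ s₁, γ (s : ℝ) ∈ interior M) →
      (frontier M ∩ (fun s : ℝ => γ s) '' Icc s₀ s₁).ncard = n →
      ∃ s₀ s₁ g E, IsBoundaryCut γ M A s₀ s₁ g ∧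
      IsCutOff A ((fun s : ℝ => γ s) '' Icc s₀ s₁) (g '' Icc 0 1) E ∧
      IsPreconnected ((E ∪ ((fun s : ℝ => γ s) '' Icc s₀ s₁ ∪ g '' Icc 0 1)) ∩ M) ∧
      (E ∩ M).Nonempty := by
    intro n
    induction n using Nat.strong_induction_on with
    | _ n ih =>
    intro s₀ s₁ g hg ⟨s, hs, hsM⟩ hn
    obtain ⟨E, hE⟩ := exists_isCutOff hc hi hA hb hg.lt hg.lt_add_one hg.continuousOn hg.injOn
      hg.zero hg.one hg.mem
    by_cases hD : IsPreconnected ((E ∪ ((fun s : ℝ => γ s) '' Icc s₀ s₁ ∪ g '' Icc 0 1)) ∩ M)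
    · refine ⟨s₀, s₁, g, E, hg, hE, hD, ?_⟩
      have h1 : γ (s : ℝ) ∈ closure E := frontier_subset_closure
        (hE.frontier_eq ▸ .inl ⟨s, Ioo_subset_Icc_self hs, rfl⟩)
      obtain ⟨z, hz, hzE⟩ := mem_closure_iff.1 h1 _ isOpen_interior hsM
      exact ⟨z, hzE, interior_subset hz⟩
    · obtain ⟨u, v, g', hg', hs', hu, hv⟩ := hg.exists_smaller hc hi hM hchart hcross hx hA hb hcomp hE hD
      refine ih _ ?_ u v g' hg' hs' rfl
      rw [← hn]
      refine ncard_lt_ncard ⟨inter_subset_inter_right _ (image_mono (Icc_subset_Icc hu.le hv)), ?_⟩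
        (hfin.subset (inter_subset_inter_right _ (image_subset_range _ _ |>.trans ?_)))
      · intro h
        have h0 : γ (s₀ : ℝ) ∈ frontier M := hg.zero ▸ hg.mapsTo (by simp)
        obtain ⟨-, r, hr, hr'⟩ := h ⟨h0, s₀, ⟨le_rfl, hg.lt.le⟩, rfl⟩
        have := injOn_comp_coe hi (by linarith [hg.lt_add_one] : s₁ - s₀ < 1)
          ⟨hu.le.trans hr.1, hr.2.trans hv⟩ ⟨le_rfl, hg.lt.le⟩ hr'
        linarith [hr.1]
      · rintro _ ⟨s, rfl⟩; exact mem_range_self _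
  obtain ⟨s₀, s₁, g, hg, hs⟩ := exists_initial_boundaryCut hc hi hM hchart hcross hx hA hb hne
  exact main _ s₀ s₁ g hg hs rfl

end Crosscut

end

section

open Set Topology Filter

/-! ### From the sphere to the plane -/

theorem exists_isOpenEmbedding_sphere (v : Sphere2) :
    ∃ τ : ℂ → Sphere2, IsOpenEmbedding τ ∧ range τ = {v}ᶜ := by
  have : Fact (Module.finrank ℝ (EuclideanSpace ℝ (Fin 3)) = 2 + 1) := ⟨by simp⟩
  set ψ := stereographic' 2 v with hψ
  have h1 : IsOpenEmbedding ψ.symm := ψ.symm.isOpenEmbedding (by simp [hψ])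
  have h2 : range ψ.symm = {v}ᶜ := by
    have := ψ.symm.image_source_eq_target
    rw [ψ.symm_source, ψ.symm_target, hψ, stereographic'_target, stereographic'_source, image_univ] at this
    exact this
  refine ⟨ψ.symm ∘ Complex.orthonormalBasisOneI.repr,
    h1.comp Complex.orthonormalBasisOneI.repr.toHomeomorph.isOpenEmbedding, ?_⟩
  rw [range_comp, Complex.orthonormalBasisOneI.repr.surjective.range_eq, image_univ, h2]

theorem manifoldBoundary_eq_frontier {M : Set Sphere2} (hM : IsSubmanifoldWithBoundary M) :
    manifoldBoundary M = frontier M := by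
  ext p
  constructor
  · rintro ⟨φ, hφ⟩
    exact (mem_frontier_iff_of_halfPlane hφ.mem_iff hφ.mem_source).2 hφ.apply_eq_zero
  · intro hp
    exact (hM.interior_or_boundary p (hM.isClosed.frontier_subset hp)).resolve_left hp.2

/-- The first chart coordinate vanishes at `t` with nonzero derivative, so it changes sign there.
Its sign decides between interior and complement of `M`, and nothing else of the differentiable
structure is used. -/
theorem CrossesTransversally.crossesFrontier {γ : AddCircle (1 : ℝ) → Sphere2} (hc : Continuous γ)
    {M : Set Sphere2} {t : ℝ} (h : CrossesTransversally γ M t) : CrossesFrontier γ M t := by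
  obtain ⟨φ, hφ, v, hv, hv0⟩ := h
  have hc' : Continuous fun s : ℝ => γ (s : AddCircle (1 : ℝ)) :=
    hc.comp (AddCircle.continuous_mk' 1)
  set u : ℝ → ℝ := fun s => φ (γ (s : AddCircle (1 : ℝ))) 0 with hu
  have hder : HasDerivAt u (v 0) t :=
    (EuclideanSpace.proj (0 : Fin 2) : EuclideanSpace ℝ (Fin 2) →L[ℝ] ℝ).hasFDerivAt.comp_hasDerivAt t hv
  have hut : u t = 0 := hφ.apply_eq_zero
  have hslope := hasDerivAt_iff_tendsto_slope.1 hder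
  have hsrc : ∀ᶠ s : ℝ in 𝓝[≠] t, γ (s : AddCircle (1 : ℝ)) ∈ φ.source := nhdsWithin_le_nhds
    (hc'.continuousAt.eventually_mem (φ.open_source.mem_nhds hφ.mem_source))
  have hint : ∀ s : ℝ, γ (s : AddCircle (1 : ℝ)) ∈ φ.source → 0 < u s →
      γ (s : AddCircle (1 : ℝ)) ∈ interior M := fun s hs h =>
    (mem_interior_iff_of_halfPlane hφ.mem_iff hs).2 h
  have hcompl : ∀ s : ℝ, γ (s : AddCircle (1 : ℝ)) ∈ φ.source → u s < 0 →
      γ (s : AddCircle (1 : ℝ)) ∈ Mᶜ := fun s hs h h' => h.not_ge ((hφ.mem_iff _ hs).1 h')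
  have hball : ∀ η : ℝ, Ioo (t - η) t ∪ Ioo t (t + η) ⊆ Metric.ball t η ∩ {t}ᶜ := by
    intro η s hs
    rw [Real.ball_eq_Ioo]
    rcases hs with hs | hs
    · exact ⟨⟨hs.1, by linarith [hs.1, hs.2]⟩, hs.2.ne⟩
    · exact ⟨⟨by linarith [hs.1, hs.2], hs.2⟩, hs.1.ne'⟩
  rcases lt_or_gt_of_ne hv0 with h | h
  · obtain ⟨η, hη, hη'⟩ := Metric.mem_nhdsWithin_iff.1 ((hslope.eventually_lt_const h).and hsrc)
    refine ⟨η, hη, .inr ⟨fun s hs => ?_, fun s hs => ?_⟩⟩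
    · obtain ⟨h1, h2⟩ := hη' (hball η (.inl hs))
      rw [slope_def_field, hut, sub_zero, div_neg_iff] at h1
      exact hint s h2 (h1.resolve_right fun h => by linarith [hs.2, h.2]).1
    · obtain ⟨h1, h2⟩ := hη' (hball η (.inr hs))
      rw [slope_def_field, hut, sub_zero, div_neg_iff] at h1
      exact hcompl s h2 (h1.resolve_left fun h => by linarith [hs.1, h.2]).1
  · obtain ⟨η, hη, hη'⟩ := Metric.mem_nhdsWithin_iff.1 ((hslope.eventually_const_lt h).and hsrc)
    refine ⟨η, hη, .inl ⟨fun s hs => ?_, fun s hs => ?_⟩⟩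
    · obtain ⟨h1, h2⟩ := hη' (hball η (.inl hs))
      rw [slope_def_field, hut, sub_zero, div_pos_iff] at h1
      exact hcompl s h2 (h1.resolve_left fun h => by linarith [hs.2, h.2]).1
    · obtain ⟨h1, h2⟩ := hη' (hball η (.inr hs))
      rw [slope_def_field, hut, sub_zero, div_pos_iff] at h1
      exact hint s h2 (h1.resolve_right fun h => by linarith [hs.1, h.2]).1

section Pullback

variable {Y : Type*} [TopologicalSpace Y] {τ : ℂ → Y} (hτ : IsOpenEmbedding τ)
include hτ

theorem HasHalfPlaneChart.preimage {M : Set Y} {z : ℂ} (h : HasHalfPlaneChart M (τ z)) :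
    HasHalfPlaneChart (τ ⁻¹' M) z := by
  obtain ⟨ψ, hz, hψ⟩ := h
  refine ⟨(hτ.toOpenPartialHomeomorph τ).trans ψ, ?_, fun q hq => ?_⟩
  · simpa using hz
  · exact hψ (τ q) (by simpa using hq)

theorem exists_lift {γ : AddCircle (1 : ℝ) → Y} (hc : Continuous γ) (hi : Function.Injective γ)
    (h : range γ ⊆ range τ) :
    ∃ β : AddCircle (1 : ℝ) → ℂ, Continuous β ∧ Function.Injective β ∧ ∀ t, τ (β t) = γ t := by
  choose β hβ using fun t => h (mem_range_self t)
  have : τ ∘ β = γ := funext hβ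
  refine ⟨β, hτ.isEmbedding.continuous_iff.2 (this ▸ hc), ?_, hβ⟩
  exact Function.Injective.of_comp (f := τ) (this ▸ hi)

theorem CrossesFrontier.preimage {γ : AddCircle (1 : ℝ) → Y} {β : AddCircle (1 : ℝ) → ℂ}
    (hβ : ∀ t, τ (β t) = γ t) {M : Set Y} {t : ℝ} (h : CrossesFrontier γ M t) :
    CrossesFrontier β (τ ⁻¹' M) t := by
  have hint : τ ⁻¹' interior M = interior (τ ⁻¹' M) :=
    hτ.isOpenMap.preimage_interior_eq_interior_preimage hτ.continuous M
  rw [CrossesFrontier, ← hint]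
  simpa only [CrossesFrontier, mem_preimage, mem_compl_iff, hβ] using h

theorem preimage_connectedComponentIn {F : Set Y} {z : ℂ} (hz : τ z ∈ F)
    (h : connectedComponentIn F (τ z) ⊆ range τ) :
    τ ⁻¹' connectedComponentIn F (τ z) = connectedComponentIn (τ ⁻¹' F) z := by
  refine Subset.antisymm ?_ (image_subset_iff.1 ?_)
  · have h1 := (isPreconnected_connectedComponentIn (F := F) (x := τ z)).preimage_of_isOpenMap
      hτ.injective hτ.isOpenMap h
    exact h1.subset_connectedComponentIn (mem_connectedComponentIn hz)
      (preimage_mono (connectedComponentIn_subset F _))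
  · exact (isPreconnected_connectedComponentIn.image τ hτ.continuous.continuousOn).subset_connectedComponentIn
      ⟨z, mem_connectedComponentIn hz, rfl⟩
      (image_subset_iff.2 (connectedComponentIn_subset _ _))

end Pullback

/-- Project from `x` itself. A bounded component of the complement of the projected curve gives an
open set on the sphere whose closure adds only points of `γ` and does not contain `x`; the connected
component of `x` cannot meet it. -/
theorem exists_notMem_closure_component {γ : AddCircle (1 : ℝ) → Sphere2} (hc : Continuous γ)
    (hi : Function.Injective γ) {x : Sphere2} (hx : x ∈ (range γ)ᶜ) :
    ∃ v ∉ range γ, v ∉ closure (connectedComponentIn (range γ)ᶜ x) := by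
  obtain ⟨τ, hτ, hτr⟩ := exists_isOpenEmbedding_sphere x
  obtain ⟨β, βc, βi, hβ⟩ := exists_lift hτ hc hi (by
    rw [hτr]; rintro z hz rfl; exact hx hz)
  obtain ⟨a, ha, hb⟩ := exists_isBounded_component βc βi
  set B := connectedComponentIn (range β)ᶜ a
  have hBo : IsOpen B := (isCompact_range_closedCurve βc).isClosed.isOpen_compl.connectedComponentIn
  have hcl : closure B = B ∪ range β := by
    rw [closure_eq_self_union_frontier, frontier_component_eq βc βi ha]
  have hU : IsOpen (τ '' B) := hτ.isOpenMap B hBo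
  have haB : τ a ∈ τ '' B := ⟨a, mem_connectedComponentIn ha, rfl⟩
  refine ⟨τ a, ?_, fun h => ?_⟩
  · rintro ⟨t, ht⟩
    exact ha ⟨t, hτ.injective ((hβ t).trans ht)⟩
  · obtain ⟨w, hwU, hwA⟩ := mem_closure_iff.1 h _ hU haB
    have hK : IsClosed (τ '' closure B) :=
      (hb.isCompact_closure.image hτ.continuous).isClosed
    obtain ⟨y, -, hy1, hy2⟩ := isPreconnected_connectedComponentIn (F := (range γ)ᶜ) (x := x) _ _
      hU hK.isOpen_compl (fun y hy => by
        by_contra! h'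
        rw [mem_union, not_or, notMem_compl_iff] at h'
        obtain ⟨h1, z, hz, rfl⟩ := h'
        rw [hcl] at hz
        rcases hz with hz | ⟨t, rfl⟩
        · exact h1 ⟨z, hz, rfl⟩
        · exact connectedComponentIn_subset _ _ hy ⟨t, (hβ t).symm⟩) ⟨w, hwA, hwU⟩
      ⟨x, mem_connectedComponentIn hx, fun h' => by
        have := image_subset_range τ _ h'
        rw [hτr] at this
        exact this rfl⟩
    exact hy2 (image_mono subset_closure hy1)

/-- A subset of `M` in the plane that is both compact and open in `M` contains
the component on the sphere of each of its points. -/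
theorem connectedComponentIn_subset_image {Y : Type*} [TopologicalSpace Y] [T2Space Y] {τ : ℂ → Y}
    (hτ : IsOpenEmbedding τ) {M : Set Y} {L : Set ℂ} (hL : IsCompact L) (hLM : L ⊆ τ ⁻¹' M)
    (hc : IsClosed (τ ⁻¹' M \ L)) {z : ℂ} (hz : z ∈ L) : connectedComponentIn M (τ z) ⊆ τ '' L := by
  have hLc : IsClosed (τ '' L) := (hL.image hτ.continuous).isClosed
  have hU : IsOpen (τ '' (τ ⁻¹' M \ L)ᶜ) := hτ.isOpenMap _ hc.isOpen_compl
  have hUM : ∀ y ∈ M, y ∈ τ '' (τ ⁻¹' M \ L)ᶜ → y ∈ τ '' L := by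
    rintro _ hyM ⟨w, hw, rfl⟩
    exact ⟨w, by_contra fun h => hw ⟨hyM, h⟩, rfl⟩
  have hNM : connectedComponentIn M (τ z) ⊆ M := connectedComponentIn_subset _ _
  rcases isPreconnected_iff_subset_of_disjoint.1 (isPreconnected_connectedComponentIn (F := M) (x := τ z))
    _ _ hU hLc.isOpen_compl (fun y hy => (em (y ∈ τ '' L)).imp_left fun ⟨w, hw, e⟩ => ⟨w, fun h => h.2 hw, e⟩)
    (eq_empty_of_forall_notMem fun y hy => hy.2.2 (hUM y (hNM hy.1) hy.2.1)) with h | h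
  · exact fun y hy => hUM y (hNM hy) (h hy)
  · exact absurd ⟨z, hz, rfl⟩ (h (mem_connectedComponentIn (hLM hz)))

end

theorem lemma8 (M : Set Sphere2) (hM : IsSubmanifoldWithBoundary M)
    (γ : AddCircle (1 : ℝ) → Sphere2) (hγ : IsSimpleClosedCurve γ)
    (hne : (Set.range γ ∩ manifoldBoundary M).Nonempty) (htr : IsTransversal γ M)
    (A : Set Sphere2) (hA : IsComponentOf A (Set.range γ)ᶜ)
    (hMA : ∀ N : Set Sphere2, IsComponentOf N M → ¬ N ⊆ A) :
    ∃ (p q : Sphere2) (a b D : Set Sphere2),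
      IsArc a p q ∧ a ⊆ Set.range γ ∧
      IsArc b p q ∧ b ⊆ manifoldBoundary M ∧
      a ∩ b = {p, q} ∧
      IsDiscBoundedBy D (a ∪ b) ∧ D \ a ⊆ A ∧
      IsConnected (D ∩ M) ∧ ((D \ (a ∪ b)) ∩ M).Nonempty := by
  obtain ⟨hc, hi⟩ := hγ
  obtain ⟨x, hx, rfl⟩ := hA
  rw [manifoldBoundary_eq_frontier hM] at hne ⊢
  -- With `v` outside the closure of `A` as center of projection, `A` becomes a bounded plane
  -- domain.
  obtain ⟨v, hvγ, hvA⟩ := exists_notMem_closure_component hc hi hx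
  obtain ⟨τ, hτ, hτr⟩ := exists_isOpenEmbedding_sphere v
  have hxτ : x ∈ Set.range τ := by
    rw [hτr]
    rintro rfl
    exact hvA (subset_closure (mem_connectedComponentIn hx))
  obtain ⟨x, rfl⟩ := hxτ
  obtain ⟨β, βc, βi, hβ⟩ := exists_lift hτ hc hi (by
    rw [hτr]; rintro z hz rfl; exact hvγ hz)
  have hβr : τ ⁻¹' (Set.range γ)ᶜ = (Set.range β)ᶜ := by
    ext z
    simp only [Set.mem_preimage, Set.mem_compl_iff, Set.mem_range, not_exists, ← hβ,
      hτ.injective.eq_iff]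
  set A := connectedComponentIn (Set.range γ)ᶜ (τ x)
  have hclA : closure A ⊆ Set.range τ := by
    rw [hτr]; rintro z hz rfl; exact hvA hz
  have hA₁ : τ ⁻¹' A = connectedComponentIn (Set.range β)ᶜ x := by
    rw [preimage_connectedComponentIn hτ hx (subset_closure.trans hclA), hβr]
  have hx₁ : x ∉ Set.range β := by rwa [← Set.mem_compl_iff, ← hβr]
  have hb : Bornology.IsBounded (τ ⁻¹' A) :=
    (hτ.isInducing.isCompact_preimage' isClosed_closure.isCompact hclA).isBounded.subset
      (Set.preimage_mono subset_closure)
  have hfr : τ ⁻¹' frontier M = frontier (τ ⁻¹' M) :=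
    hτ.isOpenMap.preimage_frontier_eq_frontier_preimage hτ.continuous M
  have hcross : ∀ t : ℝ, β t ∈ frontier (τ ⁻¹' M) → CrossesFrontier β (τ ⁻¹' M) t := by
    intro t ht
    refine CrossesFrontier.preimage hτ hβ ((htr t ?_).crossesFrontier hc)
    rw [manifoldBoundary_eq_frontier hM, ← hβ]
    exact hfr.ge ht
  obtain ⟨s₀, s₁, g, E, hg, hE, hpre, hEM⟩ := exists_boundaryCut_isPreconnected βc βi
    (hM.isClosed.preimage hτ.continuous) (fun z hz => by
      obtain ⟨φ, hφ⟩ : τ z ∈ manifoldBoundary M := by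
        rw [manifoldBoundary_eq_frontier hM]; exact hfr.ge hz
      exact HasHalfPlaneChart.preimage hτ ⟨φ, hφ.mem_source, hφ.mem_iff⟩) hcross hx₁ hA₁ hb
    -- A compact, relatively open piece of `M` inside `A` contains the component of `M` on the
    -- sphere through each of its points, which the hypothesis on components forbids.
    (fun L hL hLc hLM => by
      refine Set.eq_empty_of_forall_notMem fun z hz => ?_
      have hzM : τ z ∈ M := (hL hz).2
      refine hMA _ ⟨τ z, hzM, rfl⟩ ((connectedComponentIn_subset_image hτ hLc
        (fun w hw => (hL hw).2) hLM hz).trans ?_)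
      rintro _ ⟨w, hw, rfl⟩
      exact (hL hw).1) (by
      obtain ⟨_, ⟨t, rfl⟩, ht⟩ := hne
      refine ⟨β t, hfr.le ?_, t, rfl⟩
      rwa [Set.mem_preimage, hβ])
  have hpos : 0 < s₁ - s₀ := sub_pos.2 hg.lt
  have hAJ : ∀ z ∈ τ ⁻¹' A, z ∉ Set.range β := fun z hz => by
    rw [hA₁] at hz
    exact connectedComponentIn_subset _ _ hz
  set a := (fun s : ℝ => β s) '' Set.Icc s₀ s₁
  set b := g '' Set.Icc 0 1
  have haβ : a ⊆ Set.range β := by rintro _ ⟨s, -, rfl⟩; exact Set.mem_range_self _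
  have hab : ∀ z ∈ b, z ∈ Set.range β → z = β s₀ ∨ z = β s₁ := by
    rintro _ ⟨t, ht, rfl⟩ hz
    rcases ht.1.eq_or_lt with rfl | ht0
    · exact .inl hg.zero
    rcases ht.2.eq_or_lt with rfl | ht1
    · exact .inr hg.one
    · exact absurd hz (hAJ _ (hg.mem t ⟨ht0, ht1⟩))
  have h0a : β (s₀ : ℝ) ∈ a := ⟨s₀, ⟨le_rfl, hg.lt.le⟩, rfl⟩
  have h1a : β (s₁ : ℝ) ∈ a := ⟨s₁, ⟨hg.lt.le, le_rfl⟩, rfl⟩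
  have h0b : β (s₀ : ℝ) ∈ b := ⟨0, by simp, hg.zero⟩
  have h1b : β (s₁ : ℝ) ∈ b := ⟨1, by simp, hg.one⟩
  refine ⟨τ (β s₀), τ (β s₁), τ '' a, τ '' b, τ '' (E ∪ (a ∪ b)), ?_, ?_, ?_, ?_, ?_, ?_, ?_, ?_, ?_⟩
  · have hm : Set.MapsTo (fun t : ℝ => s₀ + (s₁ - s₀) * t) (Set.Icc 0 1) (Set.Icc s₀ s₁) :=
      fun t ht => ⟨by nlinarith [ht.1], by nlinarith [ht.2]⟩
    have hinj := injOn_comp_coe βi (by linarith [hg.lt_add_one] : s₁ - s₀ < 1)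
    refine ⟨fun t => τ (β ((s₀ + (s₁ - s₀) * t : ℝ) : AddCircle (1 : ℝ))),
      (hτ.continuous.comp ((continuous_comp_coe βc).comp (by fun_prop))).continuousOn,
      fun t ht t' ht' e => ?_, ?_, by simp, by simp⟩
    · exact mul_left_cancel₀ hpos.ne' (add_left_cancel (hinj (hm ht) (hm ht') (hτ.injective e)))
    · refine Set.Subset.antisymm ?_ ?_
      · rintro _ ⟨t, ht, rfl⟩
        exact ⟨_, ⟨_, hm ht, rfl⟩, rfl⟩
      · rintro _ ⟨_, ⟨s, hs, rfl⟩, rfl⟩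
        refine ⟨(s - s₀) / (s₁ - s₀), ⟨div_nonneg (by linarith [hs.1]) hpos.le,
          (div_le_one hpos).2 (by linarith [hs.2])⟩, ?_⟩
        beta_reduce
        rw [mul_div_cancel₀ _ hpos.ne', add_sub_cancel]
  · rintro _ ⟨_, ⟨s, -, rfl⟩, rfl⟩
    exact ⟨s, (hβ _).symm⟩
  · refine ⟨τ ∘ g, hτ.continuous.comp_continuousOn hg.continuousOn, hτ.injective.comp_injOn hg.injOn,
      Set.image_comp _ _ _, by rw [Function.comp_apply, hg.zero], by rw [Function.comp_apply, hg.one]⟩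
  · rintro _ ⟨_, ⟨t, ht, rfl⟩, rfl⟩
    exact hfr.ge (hg.mapsTo ht)
  · rw [← Set.image_inter hτ.injective, ← Set.image_pair]
    congr 1
    refine Set.Subset.antisymm (fun z hz => hab z hz.2 (haβ hz.1)) ?_
    rintro z (rfl | rfl)
    · exact ⟨h0a, h0b⟩
    · exact ⟨h1a, h1b⟩
  · obtain ⟨h, h1, h2, h3, h4⟩ := hE.exists_disc
    set κ := Complex.orthonormalBasisOneI.repr.symm
    have hκb : κ '' Metric.closedBall 0 1 = Metric.closedBall 0 1 := by
      rw [κ.image_closedBall, map_zero]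
    have hκs : κ '' Metric.sphere 0 1 = Metric.sphere 0 1 := by
      rw [κ.image_sphere, map_zero]
    have hκm : Set.MapsTo κ (Metric.closedBall 0 1) (Metric.closedBall 0 1) :=
      Set.mapsTo_iff_image_subset.2 hκb.le
    refine ⟨fun z => τ (h (κ z)), hτ.continuous.comp_continuousOn
      (h1.comp κ.continuous.continuousOn hκm), fun z hz w hw e =>
      κ.injective (h2 (hκm hz) (hκm hw) (hτ.injective e)), ?_, ?_⟩
    · rw [← h3, ← hκb, Set.image_image, Set.image_image]
    · rw [← Set.image_union, ← h4, ← hκs, Set.image_image, Set.image_image]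
  · rintro _ ⟨⟨z, hz | hz | ⟨t, ht, rfl⟩, rfl⟩, hza⟩
    · exact hE.subset hz
    · exact absurd ⟨z, hz, rfl⟩ hza
    · rcases ht.1.eq_or_lt with rfl | ht0
      · exact absurd ⟨_, hg.zero ▸ h0a, rfl⟩ hza
      rcases ht.2.eq_or_lt with rfl | ht1
      · exact absurd ⟨_, hg.one ▸ h1a, rfl⟩ hza
      · exact hg.mem t ⟨ht0, ht1⟩
  · have : τ '' (E ∪ (a ∪ b)) ∩ M = τ '' ((E ∪ (a ∪ b)) ∩ τ ⁻¹' M) := Set.image_inter_preimage _ _ _ |>.symm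
    rw [this]
    obtain ⟨z, hz, hzM⟩ := hEM
    exact ⟨⟨τ z, z, ⟨.inl hz, hzM⟩, rfl⟩, hpre.image τ hτ.continuous.continuousOn⟩
  · obtain ⟨z, hz, hzM⟩ := hEM
    refine ⟨τ z, ⟨⟨z, .inl hz, rfl⟩, ?_⟩, hzM⟩
    rw [← Set.image_union]
    rintro ⟨w, hw, e⟩
    rw [hτ.injective e] at hw
    exact hE.isOpen.inter_frontier_eq.le ⟨hz, hE.frontier_eq ▸ hw⟩
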